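/- **Setting.** There are $m$ positions, $n$ advertisers and a cap $K\le m$. A feasible allocation is $x\in\{0,1\}^{n\times m}$ with at most one position per advertiser, at most one advertiser per position and at most $K$ filled positions; an augmented allocation is a pair $\chi=(x,\sigma)$ with $\sigma$ a permutation of the positions (the rendering order). Let $p_{ij}\in[0,1]$ be the standalone click-through rates. In the cascade model advertiser $i$ is clicked with probability $$\pi_i(x,\sigma)=\sum_{j} x_{ij}p_{ij}\prod_{j':\sigma(j')<\sigma(j)}\Bigl(1-\sum_{i'}x_{i'j'}p_{i'j'}\Bigr).$$ A mechanism maps each vector of reports $\hat v\in\mathbb R_+^n$ to a lottery $q(\hat v)$ over augmented allocations and to expected payments $t(\hat v)\in\mathbb R_+^n$ (all measurable in $\hat v$). Put $y_i(\hat v)=\sum_\chi q(\hat v)[\chi]\,\pi_i(\chi)$ and $u_i(\hat v,v_i)=v_i\,y_i(\hat v)-t_i(\hat v)$. For $\epsilon\ge 0$ the mechanism is $\epsilon$-IC if $u_i((v_i,\hat v_{-i}),v_i)\ge u_i(\hat v,v_i)-\epsilon$ for all $i$, all $\hat v\in\mathbb R_+^n$ and all $v_i\ge0$; it is IC if it is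 $0$-IC; it is IR if $u_i((v_i,\hat v_{-i}),v_i)\ge0$ for all $i$, $\hat v$, $v_i$ as before. The values $v_i\ge 0$ are independent, with distribution functions $F_i$ and densities $f_i$. The welfare of a mechanism is $\mathbb E_v\bigl[\sum_i v_i y_i(v)\bigr]$ and its revenue is $\mathbb E_v\bigl[\sum_i t_i(v)\bigr]$, both in $[0,\infty]$. **Computation.** A program is one for a real RAM: exact real arithmetic and comparisons at unit cost, natural-number indices with addition, subtraction and comparison, no rounding. It receives $n,m,K,p,\epsilon$ and the reports $v$ as its input, and outputs the lottery $q(v)$ as an explicit list of weighted augmented allocations, together with the payments $t(v)$. It is efficient if for some polynomial $T$ it always halts within $T(s)$ steps, where $s$ is $n+m$ plus the number of binary digits of $\lceil (v_1+\dots+v_n)/\epsilon\rceil$. **Statement.** There is an absolute constant $C$ such that the following hold. 1. *(Welfare.)* There is one efficient program that, for all $n$, $m$, $K\le m$, $p\in[0,1]^{n\times m}$ and $\epsilon>0$, computes an $\epsilon$-IC and IR mechanism $M$ such that, for all value distributions as above and every IC and IR mechanism $M'$, $$\mathrm{Welfare}(M')\le C\ln(m+1)\cdot\mathrm{Welfare}(M).$$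 2. *(Revenue.)* There is one efficient program, which may in addition query the values $F_i(x)$ and $f_i(x)$ at unit cost, that, for all $n$, $m$, $K\le m$, $p\in[0,1]^{n\times m}$, $\epsilon>0$ and all value distributions that have finite means and are regular ($f_i$ is positive exactly on an interval, and the virtual value $\varphi_i(x)=x-\frac{1-F_i(x)}{f_i(x)}$ is nondecreasing on it), computes an $\epsilon$-IC and IR mechanism $M$ such that, for every IC and IR mechanism $M'$, $$\mathrm{Revenue}(M')\le C\ln(m+1)\cdot\mathrm{Revenue}(M).$$ -/

import Mathlib

open MeasureTheory

noncomputable section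

namespace CascadeAuction

/-! ## Augmented allocations and the cascade model -/

/-- `x ∈ {0,1}^{n×m}` is feasible: every advertiser gets at most one position, every position
gets at most one advertiser, and at most `K` positions are filled. -/
def IsAllocation {n m : ℕ} (K : ℕ) (x : Fin n → Fin m → Fin 2) : Prop :=
  (∀ i, ∑ j, (x i j : ℕ) ≤ 1) ∧ (∀ j, ∑ i, (x i j : ℕ) ≤ 1) ∧ ∑ i, ∑ j, (x i j : ℕ) ≤ K

instance {n m K : ℕ} : DecidablePred (IsAllocation (n := n) (m := m) K) := fun x => by
  unfold IsAllocation; infer_instance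

/-- The set `𝒳` of feasible allocations. -/
abbrev Alloc (n m K : ℕ) : Type := {x : Fin n → Fin m → Fin 2 // IsAllocation K x}

/-- Augmented allocations `(x, σ)`; `σ j` is the place of position `j` in the rendering order. -/
abbrev AugAlloc (n m K : ℕ) : Type := Alloc n m K × Equiv.Perm (Fin m)

/-- Click-through rate of advertiser `i` in the cascade model with standalone rates `p`. -/
def ctr {n m K : ℕ} (p : Fin n → Fin m → ℝ) (χ : AugAlloc n m K) (i : Fin n) : ℝ :=
  ∑ j, ((χ.1.1 i j : ℕ) : ℝ) * p i j *
    ∏ j' ∈ Finset.univ.filter (fun j' => χ.2 j' < χ.2 j),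
      (1 - ∑ i', ((χ.1.1 i' j' : ℕ) : ℝ) * p i' j')

/-! ## Mechanisms -/

/-- A (measurable) direct mechanism: a lottery `q v` over augmented allocations and nonnegative
(expected) payments `t v i` for every report vector `v`. Only reports in the nonnegative orthant
matter below; the functions are total on `ℝⁿ` for convenience. -/
structure Mechanism (n m K : ℕ) where
  q : (Fin n → ℝ) → AugAlloc n m K → ℝ
  t : (Fin n → ℝ) → Fin n → ℝ
  q_nonneg : ∀ v χ, 0 ≤ q v χ
  q_sum : ∀ v, ∑ χ, q v χ = 1
  t_nonneg : ∀ v i, 0 ≤ t v i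
  q_measurable : ∀ χ, Measurable fun v => q v χ
  t_measurable : ∀ i, Measurable fun v => t v i

namespace Mechanism

variable {n m K : ℕ}

/-- Total click probability of advertiser `i` at reports `v`. -/
def clickProb (M : Mechanism n m K) (p : Fin n → Fin m → ℝ) (v : Fin n → ℝ) (i : Fin n) : ℝ :=
  ∑ χ, M.q v χ * ctr p χ i

/-- Expected utility of advertiser `i` with value `x` at reports `r`. -/
def utility (M : Mechanism n m K) (p : Fin n → Fin m → ℝ) (i : Fin n) (r : Fin n → ℝ) (x : ℝ) : ℝ :=
  x * M.clickProb p r i - M.t r i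

/-- `ε`-incentive compatibility in dominant strategies: whatever the others report, no misreport
gains more than `ε` over truthful reporting. -/
def IsEpsIC (M : Mechanism n m K) (p : Fin n → Fin m → ℝ) (ε : ℝ) : Prop :=
  ∀ (i : Fin n) (r : Fin n → ℝ) (x : ℝ), (∀ k, 0 ≤ r k) → 0 ≤ x →
    M.utility p i r x - ε ≤ M.utility p i (Function.update r i x) x

/-- Incentive compatibility in dominant strategies. -/
def IsIC (M : Mechanism n m K) (p : Fin n → Fin m → ℝ) : Prop :=
  ∀ (i : Fin n) (r : Fin n → ℝ) (x : ℝ), (∀ k, 0 ≤ r k) → 0 ≤ x →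
    M.utility p i r x ≤ M.utility p i (Function.update r i x) x

/-- Individual rationality. -/
def IsIR (M : Mechanism n m K) (p : Fin n → Fin m → ℝ) : Prop :=
  ∀ (i : Fin n) (r : Fin n → ℝ) (x : ℝ), (∀ k, 0 ≤ r k) → 0 ≤ x →
    0 ≤ M.utility p i (Function.update r i x) x

end Mechanism

/-! ## Value distributions and objectives -/

/-- An absolutely continuous probability distribution on `[0, ∞)`, given by its density. -/
structure ValueDist where
  pdf : ℝ → ℝ
  pdf_measurable : Measurable pdf
  pdf_nonneg : ∀ x, 0 ≤ pdf x
  pdf_of_neg : ∀ x, x < 0 → pdf x = 0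
  lintegral_pdf : ∫⁻ x, ENNReal.ofReal (pdf x) = 1

namespace ValueDist

/-- The distribution as a measure. -/
def law (D : ValueDist) : Measure ℝ := volume.withDensity fun x => ENNReal.ofReal (D.pdf x)

/-- Cumulative distribution function `F`. -/
def cdf (D : ValueDist) (x : ℝ) : ℝ := D.law.real (Set.Iic x)

/-- Virtual value `φ(x) = x - (1 - F(x)) / f(x)`, meaningful where the density is positive. -/
def virtualValue (D : ValueDist) (x : ℝ) : ℝ := x - (1 - D.cdf x) / D.pdf x

/-- The density is positive exactly on an interval, and the virtual value is
nondecreasing there. -/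
def IsRegular (D : ValueDist) : Prop :=
  {x | 0 < D.pdf x}.OrdConnected ∧ MonotoneOn D.virtualValue {x | 0 < D.pdf x}

/-- The mean is finite. -/
def HasFiniteMean (D : ValueDist) : Prop := Integrable (fun x => x) D.law

end ValueDist

/-- The joint law of independent values. -/
def jointLaw {n : ℕ} (D : Fin n → ValueDist) : Measure (Fin n → ℝ) :=
  Measure.pi fun i => (D i).law

/-- Expected welfare, in `[0, ∞]`. -/
def welfare {n m K : ℕ} (p : Fin n → Fin m → ℝ) (D : Fin n → ValueDist)
    (M : Mechanism n m K) : ENNReal :=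
  ∫⁻ v, ENNReal.ofReal (∑ i, v i * M.clickProb p v i) ∂(jointLaw D)

/-- Expected revenue, in `[0, ∞]`. -/
def revenue {n m K : ℕ} (D : Fin n → ValueDist) (M : Mechanism n m K) : ENNReal :=
  ∫⁻ v, ENNReal.ofReal (∑ i, M.t v i) ∂(jointLaw D)

/-! ## The machine model: a real RAM

A machine has finitely many named two-dimensional arrays of natural numbers (used for indices and
counters) and of real numbers, each of unbounded extent. Natural numbers are added, subtracted
(truncated at `0`) and compared; real numbers are added, subtracted, multiplied, divided and
compared, exactly and at unit cost. There is no rounding, and no other passage from reals to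
naturals than branching on comparisons. The only constants are natural numbers. A program
may query an oracle for the cumulative distribution functions and the densities of the values. -/

/-- Memory: `nat a i j` and `real a i j` are the entries `(i, j)` of the arrays with name `a`. -/
structure Store where
  nat : ℕ → ℕ → ℕ → ℕ
  real : ℕ → ℕ → ℕ → ℝ

/-- Oracle answers: `cdf i x` and `pdf i x` for advertiser number `i` at the point `x`. -/
structure Oracle where
  cdf : ℕ → ℝ → ℝ
  pdf : ℕ → ℝ → ℝ

/-- The oracle without any information. -/
def Oracle.trivial : Oracle := ⟨fun _ _ => 0, fun _ _ => 0⟩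

/-- The oracle that answers queries about the value distributions `D`. -/
def Oracle.ofDist {n : ℕ} (D : Fin n → ValueDist) : Oracle where
  cdf i x := if h : i < n then (D ⟨i, h⟩).cdf x else 0
  pdf i x := if h : i < n then (D ⟨i, h⟩).pdf x else 0

/-- Expressions for natural numbers. -/
inductive NExpr where
  | const (c : ℕ)
  | get (a : ℕ) (i j : NExpr)
  | add (e₁ e₂ : NExpr)
  | sub (e₁ e₂ : NExpr)

/-- Expressions for real numbers. -/
inductive RExpr where
  | ofNat (e : NExpr)
  | get (a : ℕ) (i j : NExpr)
  | add (e₁ e₂ : RExpr)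
  | sub (e₁ e₂ : RExpr)
  | mul (e₁ e₂ : RExpr)
  | div (e₁ e₂ : RExpr)
  | cdf (i : NExpr) (e : RExpr)
  | pdf (i : NExpr) (e : RExpr)

/-- Tests. -/
inductive BExpr where
  | leN (e₁ e₂ : NExpr)
  | leR (e₁ e₂ : RExpr)
  | neg (b : BExpr)
  | and (b₁ b₂ : BExpr)

/-- Programs. -/
inductive Prog where
  | skip
  | setN (a : ℕ) (i j : NExpr) (e : NExpr)
  | setR (a : ℕ) (i j : NExpr) (e : RExpr)
  | seq (c₁ c₂ : Prog)
  | ite (b : BExpr) (c₁ c₂ : Prog)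
  | loop (b : BExpr) (c : Prog)

/-- Value of an expression for a natural number. -/
def NExpr.eval (s : Store) : NExpr → ℕ
  | .const c => c
  | .get a i j => s.nat a (i.eval s) (j.eval s)
  | .add e₁ e₂ => e₁.eval s + e₂.eval s
  | .sub e₁ e₂ => e₁.eval s - e₂.eval s

/-- Value of an expression for a real number. -/
def RExpr.eval (O : Oracle) (s : Store) : RExpr → ℝ
  | .ofNat e => (e.eval s : ℝ)
  | .get a i j => s.real a (i.eval s) (j.eval s)
  | .add e₁ e₂ => e₁.eval O s + e₂.eval O s
  | .sub e₁ e₂ => e₁.eval O s - e₂.eval O s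
  | .mul e₁ e₂ => e₁.eval O s * e₂.eval O s
  | .div e₁ e₂ => e₁.eval O s / e₂.eval O s
  | .cdf i e => O.cdf (i.eval s) (e.eval O s)
  | .pdf i e => O.pdf (i.eval s) (e.eval O s)

/-- Truth of a test. -/
def BExpr.Holds (O : Oracle) (s : Store) : BExpr → Prop
  | .leN e₁ e₂ => e₁.eval s ≤ e₂.eval s
  | .leR e₁ e₂ => e₁.eval O s ≤ e₂.eval O s
  | .neg b => ¬ b.Holds O s
  | .and b₁ b₂ => b₁.Holds O s ∧ b₂.Holds O s

/-- Store a natural number. -/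
def Store.setNat (s : Store) (a i j x : ℕ) : Store where
  nat a' i' j' := if a' = a ∧ i' = i ∧ j' = j then x else s.nat a' i' j'
  real := s.real

/-- Store a real number. -/
def Store.setReal (s : Store) (a i j : ℕ) (x : ℝ) : Store where
  nat := s.nat
  real a' i' j' := if a' = a ∧ i' = i ∧ j' = j then x else s.real a' i' j'

/-- `Runs O c s k s'`: the program `c`, started with memory `s`, halts after exactly `k` steps with
memory `s'`. Every assignment and every evaluation of a test is one step; as the expressions are
a fixed part of the program, this is the number of elementary operations up to
a constant factor that depends on the program only. -/
inductive Runs (O : Oracle) : Prog → Store → ℕ → Store → Prop where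
  | skip (s : Store) : Runs O .skip s 1 s
  | setN (a : ℕ) (i j e : NExpr) (s : Store) :
      Runs O (.setN a i j e) s 1 (s.setNat a (i.eval s) (j.eval s) (e.eval s))
  | setR (a : ℕ) (i j : NExpr) (e : RExpr) (s : Store) :
      Runs O (.setR a i j e) s 1 (s.setReal a (i.eval s) (j.eval s) (e.eval O s))
  | seq {c₁ c₂ : Prog} {s₁ s₂ s₃ : Store} {k₁ k₂ : ℕ} :
      Runs O c₁ s₁ k₁ s₂ → Runs O c₂ s₂ k₂ s₃ → Runs O (.seq c₁ c₂) s₁ (k₁ + k₂) s₃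
  | iteTrue {b : BExpr} {c₁ c₂ : Prog} {s s' : Store} {k : ℕ} :
      b.Holds O s → Runs O c₁ s k s' → Runs O (.ite b c₁ c₂) s (k + 1) s'
  | iteFalse {b : BExpr} {c₁ c₂ : Prog} {s s' : Store} {k : ℕ} :
      ¬ b.Holds O s → Runs O c₂ s k s' → Runs O (.ite b c₁ c₂) s (k + 1) s'
  | loopTrue {b : BExpr} {c : Prog} {s₁ s₂ s₃ : Store} {k₁ k₂ : ℕ} :
      b.Holds O s₁ → Runs O c s₁ k₁ s₂ → Runs O (.loop b c) s₂ k₂ s₃ →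
        Runs O (.loop b c) s₁ (k₁ + k₂ + 1) s₃
  | loopFalse {b : BExpr} {c : Prog} {s : Store} :
      ¬ b.Holds O s → Runs O (.loop b c) s 1 s

/-! ## Auctions run by a program -/

/-- Initial memory. Array `0` of naturals holds `n, m, K` in its row `0`; the arrays
`0, 1, 2` of reals hold the matrix `p`, the reports `v` (as column `0`) and the accuracy `ε`
(entry `(0, 0)`). All other entries are `0`. -/
def input {n m : ℕ} (K : ℕ) (p : Fin n → Fin m → ℝ) (ε : ℝ) (v : Fin n → ℝ) : Store where
  nat a i j :=
    if a = 0 ∧ i = 0 then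
      if j = 0 then n else if j = 1 then m else if j = 2 then K else 0
    else 0
  real a i j :=
    if a = 0 then (if h : i < n ∧ j < m then p ⟨i, h.1⟩ ⟨j, h.2⟩ else 0)
    else if a = 1 then (if h : i < n ∧ j = 0 then v ⟨i, h.1⟩ else 0)
    else if a = 2 then (if i = 0 ∧ j = 0 then ε else 0)
    else 0

/-- The final memory `s` lists the lottery `q` and the payments `t`. Entry `(0, 0)` of array `1` of
naturals is the length `L` of a list of weighted augmented allocations. For the `l`-th of them,
entry `(l, 0)` of array `3` of reals is its weight; entry `(l, j)` of array `2` of naturals is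
`i + 1` if position `j` shows advertiser `i` (advertisers being numbered from `0`), and a number
outside `1, …, n` if it is empty; entry `(l, j)` of array `3` of naturals is the place of
position `j` in the rendering order. Column `0` of array `4` of reals holds the payments. -/
def IsOutput {n m K : ℕ} (s : Store) (q : AugAlloc n m K → ℝ) (t : Fin n → ℝ) : Prop :=
  (∃ χ : Fin (s.nat 1 0 0) → AugAlloc n m K,
    (∀ l : Fin (s.nat 1 0 0), 0 ≤ s.real 3 l 0 ∧
      (∀ (i : Fin n) (j : Fin m), (χ l).1.1 i j = 1 ↔ s.nat 2 l j = (i : ℕ) + 1) ∧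
      (∀ j : Fin m, s.nat 3 l j = ((χ l).2 j : ℕ))) ∧
    ∀ χ', q χ' = ∑ l : Fin (s.nat 1 0 0), if χ l = χ' then s.real 3 l 0 else 0) ∧
  ∀ i, t i = s.real 4 i 0

/-- The size of the problem at reports `v` and accuracy `ε`: `n + m` plus the number of binary
digits of `⌈(v₁ + ⋯ + vₙ) / ε⌉`. -/
def problemSize (n m : ℕ) (ε : ℝ) (v : Fin n → ℝ) : ℕ :=
  n + m + Nat.size ⌈(∑ i, v i) / ε⌉₊

/-- With the oracle `O`, the program `P` computes the lottery and the payments of the mechanism `M`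
from `n, m, K, p, ε` and the reports, within `T` (problem size) steps. -/
def Implements {n m K : ℕ} (P : Prog) (T : Polynomial ℕ) (O : Oracle)
    (p : Fin n → Fin m → ℝ) (ε : ℝ) (M : Mechanism n m K) : Prop :=
  ∀ v : Fin n → ℝ, (∀ i, 0 ≤ v i) →
    ∃ (k : ℕ) (s : Store), Runs O P (input K p ε v) k s ∧
      k ≤ T.eval (problemSize n m ε v) ∧ IsOutput s (M.q v) (M.t v)

end CascadeAuction

end

open CascadeAuction

/-!
The auction draws one of about `log₂ m` buckets uniformly at random. Bucket `a` holds the pairs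
(advertiser, position) of standalone rate at most `2⁻ᵃ` and is matched greedily, by weight score times
rate, with at most `min K 2ᵃ` pairs. The scores are the reports for welfare and virtual values for
revenue.

*Externalities.* Show the whole matching with weight `1`, and its part at the positions from `k ≥ 1` on
with weight the rate matched at position `k - 1`, always in natural order. By telescoping, the weighted
click-through rate of every shown advertiser is its standalone rate (`Market.sum_prefix_weights`).
As the rates in a matching of bucket `a` sum up to at most `1`, the weights sum up to at most `2`; halved,
they form a lottery in which every advertiser is clicked with half its standalone rate
(`Market.sum_weight_mul_ctr`). The cascade thus disappears from the incentive analysis.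

*Approximation.* Given an arbitrary augmented allocation, each of its pairs is charged in the finest
bucket that contains it. A pair that conflicts with the greedy matching is covered by the matched
weights at its two ends. A free pair is lighter than every greedy choice; it is covered by its share in
the cap if the matching was stopped by `K`, and otherwise, its rate being more than `2⁻ᵃ⁻¹`, by twice
its probability of being clicked. These probabilities sum up to at most `1`, so that the allocation has
at most five times the greedy weight, summed over the buckets (`Market.sum_score_ctr_le`), and there
are `O(log (m + 1))` buckets (`Market.buckets_le_log`).

*Incentives.* Raising the score of an advertiser never worsens its position in a greedy matching
(`Market.greedy_rate_mono`), so that its click probability `y` is a nondecreasing function of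
its report, with at most `m` positive jumps in each bucket. The payment `x y(x) - ∫₀ˣ y` would be
exactly incentive compatible. Locating the jumps by bisection and charging each at the upper end of
an interval of length at most `ε` gives a payment that is at least the exact one, exceeds it by at most
`ε y(x)`, and is at most `x y(x)` (`pay_spec`). This yields individual rationality and `ε`-incentive
compatibility; as payments are rounded up, no revenue is lost.

*Revenue.* The expected payments of an incentive compatible and individually rational mechanism are at
most its expected virtual values, and the exact payments of the auction attain its own
(`integral_payment_le`, `Market.le_integral_payment`). The latter needs that an advertiser is never
shown below its support, which is why scores are `0` there. Regularity makes the scores monotone.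

*Running time.* The programs are verified with a Hoare logic of total correctness with step counts
(`Halts`), in which a program is known to leave the arrays alone that it does not assign to (`Agree`).
-/

noncomputable section

namespace CascadeAuction

/-! ### Total correctness of real-RAM programs -/

/-- Whether a program contains an assignment to the array `a` of naturals. -/
def Prog.writesNat : Prog → ℕ → Bool
  | .skip, _ => false
  | .setN b _ _ _, a => decide (a = b)
  | .setR _ _ _ _, _ => false
  | .seq c₁ c₂, a => c₁.writesNat a || c₂.writesNat a
  | .ite _ c₁ c₂, a => c₁.writesNat a || c₂.writesNat a
  | .loop _ c, a => c.writesNat a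

/-- Whether a program contains an assignment to the array `a` of reals. -/
def Prog.writesReal : Prog → ℕ → Bool
  | .skip, _ => false
  | .setN _ _ _ _, _ => false
  | .setR b _ _ _, a => decide (a = b)
  | .seq c₁ c₂, a => c₁.writesReal a || c₂.writesReal a
  | .ite _ c₁ c₂, a => c₁.writesReal a || c₂.writesReal a
  | .loop _ c, a => c.writesReal a

/-- The memories `s` and `s'` agree on all arrays that `c` does not assign to. -/
structure Agree (c : Prog) (s s' : Store) : Prop where
  nat : ∀ a, c.writesNat a = false → s'.nat a = s.nat a
  real : ∀ a, c.writesReal a = false → s'.real a = s.real a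

theorem Agree.refl (c : Prog) (s : Store) : Agree c s s := ⟨fun _ _ => rfl, fun _ _ => rfl⟩

theorem Agree.trans {c : Prog} {s₁ s₂ s₃ : Store} (h : Agree c s₁ s₂) (h' : Agree c s₂ s₃) :
    Agree c s₁ s₃ :=
  ⟨fun a ha => (h'.nat a ha).trans (h.nat a ha), fun a ha => (h'.real a ha).trans (h.real a ha)⟩

theorem Agree.mono {c c' : Prog} {s s' : Store} (h : Agree c s s')
    (hn : ∀ a, c'.writesNat a = false → c.writesNat a = false)
    (hr : ∀ a, c'.writesReal a = false → c.writesReal a = false) : Agree c' s s' :=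
  ⟨fun a ha => h.nat a (hn a ha), fun a ha => h.real a (hr a ha)⟩

@[simp] theorem Store.setNat_real (s : Store) (a i j x : ℕ) : (s.setNat a i j x).real = s.real := rfl

@[simp] theorem Store.setReal_nat (s : Store) (a i j : ℕ) (x : ℝ) :
    (s.setReal a i j x).nat = s.nat := rfl

theorem Store.setNat_nat (s : Store) (a i j x a' i' j' : ℕ) :
    (s.setNat a i j x).nat a' i' j' = if a' = a ∧ i' = i ∧ j' = j then x else s.nat a' i' j' := rfl

theorem Store.setReal_real (s : Store) (a i j : ℕ) (x : ℝ) (a' i' j' : ℕ) :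
    (s.setReal a i j x).real a' i' j' = if a' = a ∧ i' = i ∧ j' = j then x else s.real a' i' j' :=
  rfl

theorem Store.setNat_nat_of_ne (s : Store) {a a' : ℕ} (i j x : ℕ) (h : a' ≠ a) :
    (s.setNat a i j x).nat a' = s.nat a' := by
  funext i' j'; simp [Store.setNat_nat, h]

theorem Store.setReal_real_of_ne (s : Store) {a a' : ℕ} (i j : ℕ) (x : ℝ) (h : a' ≠ a) :
    (s.setReal a i j x).real a' = s.real a' := by
  funext i' j'; simp [Store.setReal_real, h]

theorem Runs.agree {O : Oracle} {c : Prog} {s s' : Store} {k : ℕ} (h : Runs O c s k s') :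
    Agree c s s' := by
  induction h with
  | skip s => exact Agree.refl _ _
  | setN a i j e s =>
    refine ⟨fun b hb => ?_, fun b _ => rfl⟩
    exact Store.setNat_nat_of_ne _ _ _ _ (by simpa [Prog.writesNat] using hb)
  | setR a i j e s =>
    refine ⟨fun b _ => rfl, fun b hb => ?_⟩
    exact Store.setReal_real_of_ne _ _ _ _ (by simpa [Prog.writesReal] using hb)
  | seq _ _ h₁ h₂ =>
    exact (h₁.mono (by simp +contextual [Prog.writesNat]) (by simp +contextual [Prog.writesReal])).trans
      (h₂.mono (by simp +contextual [Prog.writesNat]) (by simp +contextual [Prog.writesReal]))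
  | iteTrue _ _ h => exact h.mono (by simp +contextual [Prog.writesNat]) (by simp +contextual [Prog.writesReal])
  | iteFalse _ _ h => exact h.mono (by simp +contextual [Prog.writesNat]) (by simp +contextual [Prog.writesReal])
  | loopTrue _ _ _ h₁ h₂ => exact (h₁.mono (by simp [Prog.writesNat]) (by simp [Prog.writesReal])).trans h₂
  | loopFalse _ => exact Agree.refl _ _

/-- Total correctness with a time bound: `c`, started in `s`, halts within `N` steps in a memory
that satisfies `Q`. -/
def Halts (O : Oracle) (c : Prog) (s : Store) (N : ℕ) (Q : Store → Prop) : Prop :=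
  ∃ k s', k ≤ N ∧ Runs O c s k s' ∧ Q s'

namespace Halts

variable {O : Oracle} {c c₁ c₂ : Prog} {s : Store} {N N₁ N₂ : ℕ} {Q Q' : Store → Prop}

theorem mono (h : Halts O c s N₁ Q) (hN : N₁ ≤ N₂) (hQ : ∀ s', Q s' → Q' s') :
    Halts O c s N₂ Q' := by
  obtain ⟨k, s', hk, hr, hq⟩ := h
  exact ⟨k, s', hk.trans hN, hr, hQ _ hq⟩

theorem agree (h : Halts O c s N Q) : Halts O c s N (fun s' => Agree c s s' ∧ Q s') := by
  obtain ⟨k, s', hk, hr, hq⟩ := h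
  exact ⟨k, s', hk, hr, hr.agree, hq⟩

theorem skip (h : Q s) : Halts O .skip s 1 Q := ⟨1, s, le_rfl, .skip s, h⟩

theorem setN {a : ℕ} {i j e : NExpr} (h : Q (s.setNat a (i.eval s) (j.eval s) (e.eval s))) :
    Halts O (.setN a i j e) s 1 Q := ⟨1, _, le_rfl, .setN a i j e s, h⟩

theorem setR {a : ℕ} {i j : NExpr} {e : RExpr}
    (h : Q (s.setReal a (i.eval s) (j.eval s) (e.eval O s))) :
    Halts O (.setR a i j e) s 1 Q := ⟨1, _, le_rfl, .setR a i j e s, h⟩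

theorem seq {Q₁ : Store → Prop} (h₁ : Halts O c₁ s N₁ Q₁)
    (h₂ : ∀ s', Agree c₁ s s' → Q₁ s' → Halts O c₂ s' N₂ Q) :
    Halts O (.seq c₁ c₂) s (N₁ + N₂) Q := by
  obtain ⟨k, s', hk, hr, ha, hq⟩ := h₁.agree
  obtain ⟨k', s'', hk', hr', hq'⟩ := h₂ s' ha hq
  exact ⟨_, s'', add_le_add hk hk', .seq hr hr', hq'⟩

theorem ite {b : BExpr} (h₁ : b.Holds O s → Halts O c₁ s N Q)
    (h₂ : ¬ b.Holds O s → Halts O c₂ s N Q) : Halts O (.ite b c₁ c₂) s (N + 1) Q := by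
  by_cases h : b.Holds O s
  · obtain ⟨k, s', hk, hr, hq⟩ := h₁ h
    exact ⟨_, s', Nat.succ_le_succ hk, .iteTrue h hr, hq⟩
  · obtain ⟨k, s', hk, hr, hq⟩ := h₂ h
    exact ⟨_, s', Nat.succ_le_succ hk, .iteFalse h hr, hq⟩

/-- A loop whose state `x` evolves by `f` and whose guard fails after at most `K` rounds. The function
`f` fixes the states at which the loop ends, so that the final state is `f^[K] x` even if
the loop ends early. -/
theorem loop {α : Type*} {b : BExpr} (R : α → Store → Prop) (done : α → Prop) (f : α → α)
    (hb : ∀ x s, R x s → (b.Holds O s ↔ ¬ done x)) (hf : ∀ x, done x → f x = x)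
    (step : ∀ x s, ¬ done x → R x s → Halts O c s N (R (f x)))
    (K : ℕ) : ∀ (x : α) (s : Store), done (f^[K] x) → R x s →
      Halts O (.loop b c) s (K * (N + 1) + 1) (R (f^[K] x)) := by
  induction K with
  | zero =>
    intro x s hd hR
    exact ⟨1, s, by simp, .loopFalse (by rw [hb x s hR]; simpa using hd), hR⟩
  | succ K ih =>
    intro x s hd hR
    by_cases hx : done x
    · have hfix : ∀ k, f^[k] x = x := fun k => Function.iterate_fixed (hf x hx) k
      exact ⟨1, s, by simp, .loopFalse (by rw [hb x s hR]; simpa using hx), by rw [hfix]; exact hR⟩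
    · obtain ⟨k, s', hk, hr, hq⟩ := step x s hx hR
      obtain ⟨k', s'', hk', hr', hq'⟩ := ih (f x) s' (by simpa using hd) hq
      refine ⟨k + k' + 1, s'', ?_, .loopTrue ((hb x s hR).2 hx) hr hr', by simpa using hq'⟩
      calc k + k' + 1 ≤ N + (K * (N + 1) + 1) + 1 := by omega
        _ = (K + 1) * (N + 1) + 1 := by ring

end Halts

/-- The entry `(0, 0)` of the array `a` of naturals, used as a variable. -/
def nvar (a : ℕ) : NExpr := .get a (.const 0) (.const 0)

/-- The entry `(0, 0)` of the array `a` of reals, used as a variable. -/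
def rvar (a : ℕ) : RExpr := .get a (.const 0) (.const 0)

@[simp] theorem nvar_eval (a : ℕ) (s : Store) : (nvar a).eval s = s.nat a 0 0 := rfl

@[simp] theorem rvar_eval (a : ℕ) (O : Oracle) (s : Store) : (rvar a).eval O s = s.real a 0 0 := rfl

/-- The counted loop `for v = 0, …, e - 1 do c`. -/
def forN (v : ℕ) (e : NExpr) (c : Prog) : Prog :=
  .seq (.setN v (.const 0) (.const 0) (.const 0))
    (.loop (.neg (.leN e (nvar v)))
      (.seq c (.setN v (.const 0) (.const 0) (.add (nvar v) (.const 1)))))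

@[simp] theorem forN_writesNat (v : ℕ) (e : NExpr) (c : Prog) (a : ℕ) :
    (forN v e c).writesNat a = (decide (a = v) || c.writesNat a) := by
  simp only [forN, Prog.writesNat]
  cases decide (a = v) <;> simp

@[simp] theorem forN_writesReal (v : ℕ) (e : NExpr) (c : Prog) (a : ℕ) :
    (forN v e c).writesReal a = c.writesReal a := by
  simp [forN, Prog.writesReal]

/-- The invariant rule for counted loops. The invariant must ignore the loop variable, as
that is incremented between two rounds. -/
theorem Halts.forN {O : Oracle} {v : ℕ} {e : NExpr} {c : Prog} {s : Store} {N B : ℕ}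
    (I : ℕ → Store → Prop) (hv : c.writesNat v = false)
    (hI : ∀ t s x, I t s → I t (s.setNat v 0 0 x))
    (he : ∀ s', Agree (forN v e c) s s' → e.eval s' = B) (h0 : I 0 s)
    (step : ∀ t s', t < B → Agree (CascadeAuction.forN v e c) s s' → I t s' → s'.nat v 0 0 = t →
      Halts O c s' N (I (t + 1))) :
    Halts O (CascadeAuction.forN v e c) s (B * (N + 2) + 2)
      (fun s' => Agree (CascadeAuction.forN v e c) s s' ∧ I B s') := by
  have hset : ∀ (s₁ : Store) (x : ℕ), Agree (CascadeAuction.forN v e c) s₁ (s₁.setNat v 0 0 x) := by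
    intro s₁ x
    refine ⟨fun a ha => Store.setNat_nat_of_ne _ _ _ _ ?_, fun a _ => rfl⟩
    rintro rfl
    simp at ha
  have main : ∀ (d t : ℕ) (s' : Store), t + d = B → Agree (CascadeAuction.forN v e c) s s' → I t s' →
      s'.nat v 0 0 = t →
      Halts O (.loop (.neg (.leN e (nvar v)))
      (.seq c (.setN v (.const 0) (.const 0) (.add (nvar v) (.const 1))))) s' (d * (N + 2) + 1)
      (fun s' => Agree (CascadeAuction.forN v e c) s s' ∧ I B s') := by
    intro d
    induction d with
    | zero =>
      intro t s' ht ha hi hvt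
      refine ⟨1, s', by simp, .loopFalse ?_, ha, ?_⟩
      · simp [BExpr.Holds, he s' ha, hvt]; omega
      · have : t = B := by omega
        exact this ▸ hi
    | succ d ih =>
      intro t s' ht ha hi hvt
      obtain ⟨k, s₁, hk, hr, hag, hi₁⟩ := (step t s' (by omega) ha hi hvt).agree
      have hv₁ : s₁.nat v 0 0 = t := by rw [hag.nat v hv, hvt]
      have ha₁ : Agree (CascadeAuction.forN v e c) s s₁ :=
        ha.trans (hag.mono (by simp +contextual) (by simp))
      obtain ⟨k', s₂, hk', hr', hq⟩ := ih (t + 1) (s₁.setNat v 0 0 (t + 1)) (by omega)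
        (ha₁.trans (hset _ _)) (hI _ _ _ hi₁) (by simp [Store.setNat_nat])
      have hr2 : Runs O (.setN v (.const 0) (.const 0) (.add (nvar v) (.const 1))) s₁ 1
          (s₁.setNat v 0 0 (t + 1)) := by
        have := Runs.setN (O := O) v (.const 0) (.const 0) (.add (nvar v) (.const 1)) s₁
        simpa [NExpr.eval, hv₁, nvar] using this
      refine ⟨_, s₂, ?_, .loopTrue ?_ (.seq hr hr2) hr', hq⟩
      · calc k + 1 + k' + 1 ≤ N + 1 + (d * (N + 2) + 1) + 1 := by omega
          _ = (d + 1) * (N + 2) + 1 := by ring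
      · simp [BExpr.Holds, he s' ha, hvt]; omega
  have h := main B 0 (s.setNat v 0 0 0) (by omega) (hset s 0) (hI _ _ _ h0)
    (by simp [Store.setNat_nat])
  have h2 : Halts O (.setN v (.const 0) (.const 0) (.const 0)) s 1
      (fun s' => s' = s.setNat v 0 0 0) := Halts.setN rfl
  exact (Halts.seq h2 (fun s' _ hs => hs ▸ h)).mono (by omega) (fun _ h => h)

/-! ### Greedy matchings in one bucket -/

/-- `forFold f k x` applies `f 0, f 1, …, f (k - 1)` to `x`, in this order. -/
def forFold {α : Type*} (f : ℕ → α → α) : ℕ → α → α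
  | 0, x => x
  | k + 1, x => f k (forFold f k x)

theorem forFold_induct {α : Type*} {f : ℕ → α → α} {x : α} (P : ℕ → α → Prop) (k : ℕ)
    (h0 : P 0 x) (hs : ∀ t y, t < k → P t y → P (t + 1) (f t y)) : P k (forFold f k x) := by
  induction k with
  | zero => exact h0
  | succ k ih => exact hs k _ (Nat.lt_succ_self k) (ih fun t y ht => hs t y (ht.trans (Nat.lt_succ_self k)))

/-- Two folds preserve a relation that their steps preserve. -/
theorem forFold_induct₂ {α : Type*} {f g : ℕ → α → α} {x y : α} (P : α → α → Prop) (k : ℕ)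
    (h0 : P x y) (hs : ∀ t x y, t < k → P x y → P (f t x) (g t y)) :
    P (forFold f k x) (forFold g k y) := by
  induction k with
  | zero => exact h0
  | succ k ih =>
    exact hs k _ _ (Nat.lt_succ_self k) (ih fun t y z ht => hs t y z (ht.trans (Nat.lt_succ_self k)))

/-- The data of the auction that are not reported: `n` advertisers, `m` positions, the cap `K` and
the standalone click-through rates, indexed by natural numbers (only `i < n` and `j < m` matter). -/
structure Market where
  n : ℕ
  m : ℕ
  K : ℕ
  p : ℕ → ℕ → ℝ

/-- A partial matching: `asg j` is `i + 1` if position `j` shows advertiser `i`, and `0` if it is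
empty; `pos i` is `j + 1` if advertiser `i` is shown at position `j`, and `0` if it is not shown. -/
structure GState where
  asg : ℕ → ℕ
  pos : ℕ → ℕ

/-- The rate of advertiser `i` at its position in `S`, and `0` if it has none. -/
def GState.rate (S : GState) (p : ℕ → ℕ → ℝ) (i : ℕ) : ℝ :=
  if S.pos i = 0 then 0 else p i (S.pos i - 1)

/-- The rate of the advertiser at position `j` in `S`, and `0` if `j` is empty. -/
def GState.posRate (S : GState) (p : ℕ → ℕ → ℝ) (j : ℕ) : ℝ :=
  if S.asg j = 0 then 0 else p (S.asg j - 1) j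

namespace Market

variable (E : Market)

/-- The pair `(i, j)` may be added to `S` in the bucket of pairs of rate at most `1 / b`. -/
def Free (b : ℕ) (S : GState) (i j : ℕ) : Prop :=
  S.pos i = 0 ∧ S.asg j = 0 ∧ E.p i j * b ≤ 1

open Classical in
/-- Replace the best pair so far, `x = (weight, i', j')`, by `(i, j)` if that is free and
strictly heavier for the scores `s`. -/
def better (s : ℕ → ℝ) (b : ℕ) (S : GState) (i j : ℕ) (x : ℝ × ℕ × ℕ) : ℝ × ℕ × ℕ :=
  if E.Free b S i j ∧ x.1 < s i * E.p i j then (s i * E.p i j, i, j) else x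

/-- The heaviest free pair with positive weight; the weight is `0` if there is none. -/
def best (s : ℕ → ℝ) (b : ℕ) (S : GState) : ℝ × ℕ × ℕ :=
  forFold (fun i => forFold (fun j => E.better s b S i j) E.m) E.n (0, 0, 0)

/-- Add the pair `(i, j)` to the matching `S`. -/
def _root_.CascadeAuction.GState.insert (S : GState) (i j : ℕ) : GState :=
  ⟨Function.update S.asg j (i + 1), Function.update S.pos i (j + 1)⟩

open Classical in
/-- One round of the greedy algorithm. -/
def greedyStep (s : ℕ → ℝ) (b : ℕ) (S : GState) : GState :=
  if 0 < (E.best s b S).1 then S.insert (E.best s b S).2.1 (E.best s b S).2.2 else S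

/-- The greedy matching after `c` rounds, of which the first `b` are active. -/
def greedy (s : ℕ → ℝ) (b c : ℕ) : GState :=
  forFold (fun c S => if c < b then E.greedyStep s b S else S) c ⟨fun _ => 0, fun _ => 0⟩

variable {E}

theorem better_mono_weight (s : ℕ → ℝ) (b : ℕ) (S : GState) (i j : ℕ) (x : ℝ × ℕ × ℕ) :
    x.1 ≤ (E.better s b S i j x).1 := by
  unfold better
  split_ifs with h
  · exact h.2.le
  · exact le_rfl

/-- The weight found is the largest one of a free pair (or `0`), and is attained if it is positive. -/
theorem best_spec (s : ℕ → ℝ) (b : ℕ) (S : GState) :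
    0 ≤ (E.best s b S).1 ∧
    (0 < (E.best s b S).1 → (E.best s b S).2.1 < E.n ∧ (E.best s b S).2.2 < E.m ∧
      E.Free b S (E.best s b S).2.1 (E.best s b S).2.2 ∧
      (E.best s b S).1 = s (E.best s b S).2.1 * E.p (E.best s b S).2.1 (E.best s b S).2.2) ∧
    ∀ i < E.n, ∀ j < E.m, E.Free b S i j → s i * E.p i j ≤ (E.best s b S).1 := by
  -- A candidate is sound if it is the initial one or describes a free pair.
  let Sp : ℝ × ℕ × ℕ → Prop := fun x => 0 ≤ x.1 ∧ (0 < x.1 → x.2.1 < E.n ∧ x.2.2 < E.m ∧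
      E.Free b S x.2.1 x.2.2 ∧ x.1 = s x.2.1 * E.p x.2.1 x.2.2)
  have hb : ∀ i j x, i < E.n → j < E.m → Sp x → Sp (E.better s b S i j x) := by
    intro i j x hi hj hx
    unfold better
    split_ifs with h
    · exact ⟨hx.1.trans h.2.le, fun _ => ⟨hi, hj, h.1, rfl⟩⟩
    · exact hx
  have hb2 : ∀ i j x, E.Free b S i j → s i * E.p i j ≤ (E.better s b S i j x).1 := by
    intro i j x hf
    unfold better
    split_ifs with h
    · exact le_rfl
    · by_contra h'
      exact h ⟨hf, not_le.1 h'⟩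
  have row : ∀ i x, i < E.n → Sp x →
      (fun y : ℝ × ℕ × ℕ => Sp y ∧ x.1 ≤ y.1 ∧ ∀ j < E.m, E.Free b S i j → s i * E.p i j ≤ y.1)
      (forFold (fun j => E.better s b S i j) E.m x) := by
    intro i x hi hx
    refine forFold_induct (fun t (y : ℝ × ℕ × ℕ) => Sp y ∧ x.1 ≤ y.1 ∧
      ∀ j < t, E.Free b S i j → s i * E.p i j ≤ y.1) E.m ⟨hx, le_rfl, by simp⟩ ?_
    rintro t y ht ⟨h1, h2, h3⟩
    refine ⟨hb _ _ _ hi ht h1, h2.trans (better_mono_weight ..), fun j hj hf => ?_⟩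
    rcases Nat.lt_succ_iff_lt_or_eq.1 hj with h | rfl
    · exact (h3 j h hf).trans (better_mono_weight ..)
    · exact hb2 _ _ _ hf
  have := forFold_induct (f := fun i => forFold (fun j => E.better s b S i j) E.m)
    (x := ((0 : ℝ), 0, 0)) (fun t (y : ℝ × ℕ × ℕ) => Sp y ∧
      ∀ i < t, ∀ j < E.m, E.Free b S i j → s i * E.p i j ≤ y.1) E.n
      ⟨⟨le_rfl, fun h => absurd h (lt_irrefl _)⟩, by simp⟩ (by
        rintro t y ht ⟨h1, h2⟩
        obtain ⟨r1, r2, r3⟩ := row t y ht h1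
        refine ⟨r1, fun i hi j hj hf => ?_⟩
        rcases Nat.lt_succ_iff_lt_or_eq.1 hi with h | rfl
        · exact (h2 i h j hj hf).trans r2
        · exact r3 j hj hf)
  exact ⟨this.1.1, this.1.2, this.2⟩

/-- If the score of advertiser `i` is raised, the best pair stays the same or becomes
a pair of `i`. -/
theorem best_raise (hp : ∀ i j, 0 ≤ E.p i j) {s s' : ℕ → ℝ} {i : ℕ} (hne : ∀ k, k ≠ i → s' k = s k)
    (hi : 0 < s i → s i ≤ s' i) (b : ℕ) (S : GState) :
    E.best s' b S = E.best s b S ∨ ((E.best s' b S).2.1 = i ∧ 0 < (E.best s' b S).1) := by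
  -- This relation between the candidates for `s` and for `s'` is kept throughout the search.
  let Rel : ℝ × ℕ × ℕ → ℝ × ℕ × ℕ → Prop := fun x x' =>
    x.1 ≤ x'.1 ∧ 0 ≤ x.1 ∧ (x' = x ∨ (x'.2.1 = i ∧ 0 < x'.1))
  have hb : ∀ k j x x', Rel x x' → Rel (E.better s b S k j x) (E.better s' b S k j x') := by
    rintro k j x x' ⟨h1, h2, h3⟩
    unfold better
    by_cases hf : E.Free b S k j
    swap
    · simp only [hf, false_and, if_false]; exact ⟨h1, h2, h3⟩
    simp only [hf, true_and]
    by_cases hk : k = i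
    · subst hk
      have hw : x.1 < s k * E.p k j → s k * E.p k j ≤ s' k * E.p k j := by
        intro h
        have : 0 < s k := by
          by_contra hneg
          have := mul_nonpos_of_nonpos_of_nonneg (not_lt.1 hneg) (hp k j)
          linarith
        exact mul_le_mul_of_nonneg_right (hi this) (hp k j)
      split_ifs with hx hx' hx'
      · exact ⟨hw hx, h2.trans hx.le, Or.inr ⟨rfl, by simp only; linarith [hw hx]⟩⟩
      · have : ¬ (x' = x) := by rintro rfl; exact hx' (hx.trans_le (hw hx))
        exact ⟨(hw hx).trans (not_lt.1 hx'), h2.trans hx.le, Or.inr (h3.resolve_left this)⟩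
      · exact ⟨(h1.trans hx'.le), h2, Or.inr ⟨rfl, by simp only; linarith⟩⟩
      · exact ⟨h1, h2, h3⟩
    · rw [hne k hk]
      split_ifs with hx hx' hx'
      · exact ⟨le_rfl, h2.trans hx.le, Or.inl rfl⟩
      · have : ¬ (x' = x) := by rintro rfl; exact hx' hx
        exact ⟨(not_lt.1 hx'), h2.trans hx.le, Or.inr (h3.resolve_left this)⟩
      · exact absurd (h1.trans_lt hx') hx
      · exact ⟨h1, h2, h3⟩
  have : Rel (E.best s b S) (E.best s' b S) := by
    refine forFold_induct₂ Rel E.n ⟨le_rfl, le_rfl, Or.inl rfl⟩ fun t x y _ h => ?_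
    exact forFold_induct₂ Rel E.m h fun j x y _ h => hb t j x y h
  exact this.2.2

/-- Structural invariants of the greedy matching: the two arrays describe the same matching, and
matched pairs have positive weight and rate at most `1 / b`. -/
structure Valid (E : Market) (s : ℕ → ℝ) (b : ℕ) (S : GState) : Prop where
  iff : ∀ i j, S.asg j = i + 1 ↔ S.pos i = j + 1
  asg_lt : ∀ j, S.asg j ≠ 0 → j < E.m
  pos_lt : ∀ i, S.pos i ≠ 0 → i < E.n
  small : ∀ i j, S.pos i = j + 1 → E.p i j * b ≤ 1
  weight : ∀ i j, S.pos i = j + 1 → 0 < s i * E.p i j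

theorem Valid.insert {s : ℕ → ℝ} {b : ℕ} {S : GState} (h : Valid E s b S) {i j : ℕ} (hi : i < E.n)
    (hj : j < E.m) (hf : E.Free b S i j) (hw : 0 < s i * E.p i j) : Valid E s b (S.insert i j) := by
  obtain ⟨h1, h2, h3⟩ := hf
  refine ⟨fun i' j' => ?_, fun j' hj' => ?_, fun i' hi' => ?_, fun i' j' hh => ?_, fun i' j' hh => ?_⟩
  · simp only [GState.insert, Function.update_apply]
    have e1 := h.iff i' j'
    have e2 := h.iff i j'
    have e3 := h.iff i' j
    split_ifs with ha hb hb
    · subst ha; subst hb; simp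
    · subst ha
      constructor
      · intro hh; omega
      · intro hh; rw [← e3] at hh; omega
    · subst hb
      constructor
      · intro hh; rw [e2] at hh; omega
      · intro hh; omega
    · exact e1
  · simp only [GState.insert, Function.update_apply] at hj'
    split_ifs at hj' with ha
    · exact ha ▸ hj
    · exact h.asg_lt _ hj'
  · simp only [GState.insert, Function.update_apply] at hi'
    split_ifs at hi' with ha
    · exact ha ▸ hi
    · exact h.pos_lt _ hi'
  · simp only [GState.insert, Function.update_apply] at hh
    split_ifs at hh with ha
    · subst ha; obtain rfl : j = j' := by omega
      exact h3
    · exact h.small _ _ hh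
  · simp only [GState.insert, Function.update_apply] at hh
    split_ifs at hh with ha
    · subst ha; obtain rfl : j = j' := by omega
      exact hw
    · exact h.weight _ _ hh

/-- The matched weight. -/
def gain (E : Market) (s : ℕ → ℝ) (S : GState) : ℝ := ∑ i ∈ Finset.range E.n, s i * S.rate E.p i

/-- The weight of the pair at position `j`. -/
def posWeight (E : Market) (s : ℕ → ℝ) (S : GState) (j : ℕ) : ℝ :=
  if S.asg j = 0 then 0 else s (S.asg j - 1) * E.p (S.asg j - 1) j

/-- Dual feasibility of the greedy matching after `c` rounds: the weight of a blocked pair is covered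
by the matched weight at its two ends, that of a free pair by the average matched weight. -/
structure Dual (E : Market) (s : ℕ → ℝ) (b c : ℕ) (S : GState) : Prop where
  valid : Valid E s b S
  card : ((Finset.range E.m).filter fun j => S.asg j ≠ 0).card ≤ c
  blocked : ∀ i < E.n, ∀ j < E.m, E.p i j * b ≤ 1 → (S.pos i ≠ 0 ∨ S.asg j ≠ 0) →
    s i * E.p i j ≤ s i * S.rate E.p i + E.posWeight s S j
  free : ∀ i < E.n, ∀ j < E.m, E.Free b S i j → c * (s i * E.p i j) ≤ E.gain s S
  sum_pos : ∑ j ∈ Finset.range E.m, E.posWeight s S j = E.gain s S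

theorem Valid.rate_nonneg {s : ℕ → ℝ} {b : ℕ} {S : GState} (h : Valid E s b S) (i : ℕ) :
    0 ≤ s i * S.rate E.p i := by
  unfold GState.rate
  split_ifs with h0
  · simp
  · exact (h.weight i (S.pos i - 1) (by omega)).le

theorem Valid.posWeight_nonneg {s : ℕ → ℝ} {b : ℕ} {S : GState} (h : Valid E s b S) (j : ℕ) :
    0 ≤ E.posWeight s S j := by
  unfold posWeight
  split_ifs with h0
  · simp
  · refine (h.weight (S.asg j - 1) j ?_).le
    rw [← h.iff]; omega

theorem Valid.gain_nonneg {s : ℕ → ℝ} {b : ℕ} {S : GState} (h : Valid E s b S) : 0 ≤ E.gain s S :=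
  Finset.sum_nonneg fun i _ => h.rate_nonneg i

theorem rate_insert (p : ℕ → ℕ → ℝ) (S : GState) (i j k : ℕ) :
    (S.insert i j).rate p k = if k = i then p i j else S.rate p k := by
  simp only [GState.rate, GState.insert, Function.update_apply]
  split_ifs with h <;> simp_all

theorem posWeight_insert (s : ℕ → ℝ) (S : GState) (i j k : ℕ) :
    E.posWeight s (S.insert i j) k = if k = j then s i * E.p i j else E.posWeight s S k := by
  simp only [posWeight, GState.insert, Function.update_apply]
  split_ifs with h <;> simp_all

theorem gain_insert (s : ℕ → ℝ) (S : GState) {i j : ℕ} (hi : i < E.n) (h0 : S.pos i = 0) :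
    E.gain s (S.insert i j) = E.gain s S + s i * E.p i j := by
  have h1 : ∀ k, s k * (S.insert i j).rate E.p k =
      s k * S.rate E.p k + if k = i then s i * E.p i j else 0 := by
    intro k
    rw [rate_insert]
    split_ifs with h
    · subst h; simp [GState.rate, h0]
    · simp
  simp only [gain, h1, Finset.sum_add_distrib]
  simp [hi]

/-- The pair chosen next is at least as heavy as every free pair, so that it covers those it blocks. -/
theorem Dual.step {s : ℕ → ℝ} {b c : ℕ} {S : GState} (h : Dual E s b c S) :
    Dual E s b (c + 1) (E.greedyStep s b S) := by
  obtain ⟨b1, b2, b3⟩ := best_spec (E := E) s b S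
  unfold greedyStep
  split_ifs with hpos
  · obtain ⟨hi, hj, hf, hw⟩ := b2 hpos
    set i := (E.best s b S).2.1
    set j := (E.best s b S).2.2
    have hw' : 0 < s i * E.p i j := hw ▸ hpos
    have hv := h.valid.insert hi hj hf hw'
    refine ⟨hv, ?_, ?_, ?_, ?_⟩
    · refine (Finset.card_le_card (t := insert j ((Finset.range E.m).filter fun j => S.asg j ≠ 0))
        ?_).trans ((Finset.card_insert_le _ _).trans (Nat.succ_le_succ h.card))
      intro k hk
      simp only [Finset.mem_filter, Finset.mem_range, GState.insert, Function.update_apply,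
        Finset.mem_insert] at hk ⊢
      split_ifs at hk with hkj
      · exact Or.inl hkj
      · exact Or.inr hk
    · intro i' hi' j' hj' hs hor
      rw [rate_insert, posWeight_insert]
      by_cases hold : S.pos i' ≠ 0 ∨ S.asg j' ≠ 0
      · refine (h.blocked i' hi' j' hj' hs hold).trans (add_le_add ?_ ?_)
        · split_ifs with e
          · rw [e]; simp [GState.rate, hf.1, hw'.le]
          · exact le_rfl
        · split_ifs with e
          · rw [e]; simp [posWeight, hf.2.1, hw'.le]
          · exact le_rfl
      · push Not at hold
        have hle : s i' * E.p i' j' ≤ s i * E.p i j := hw ▸ b3 i' hi' j' hj' ⟨hold.1, hold.2, hs⟩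
        have n1 := h.valid.rate_nonneg i'
        have n2 := h.valid.posWeight_nonneg j'
        simp only [GState.insert, Function.update_apply] at hor
        by_cases e1 : i' = i
        · have e3 : s i' * E.p i j = s i * E.p i j := by rw [e1]
          rw [if_pos e1]
          split_ifs with e2 <;> linarith
        · rw [if_neg e1] at hor ⊢
          have e2 : j' = j := by
            by_contra e2
            rw [if_neg e2] at hor
            exact hor.elim (fun h => h hold.1) (fun h => h hold.2)
          rw [if_pos e2]; linarith
    · intro i' hi' j' hj' hf'
      have hfo : E.Free b S i' j' := by
        obtain ⟨f1, f2, f3⟩ := hf'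
        simp only [GState.insert, Function.update_apply] at f1 f2
        refine ⟨?_, ?_, f3⟩
        · split_ifs at f1; exact f1
        · split_ifs at f2; exact f2
      rw [gain_insert s S hi hf.1]
      have h1 := h.free i' hi' j' hj' hfo
      have h2 : s i' * E.p i' j' ≤ s i * E.p i j := hw ▸ b3 i' hi' j' hj' hfo
      push_cast; linarith
    · rw [gain_insert s S hi hf.1, ← h.sum_pos]
      have h1 : ∀ k, E.posWeight s (S.insert i j) k =
          E.posWeight s S k + if k = j then s i * E.p i j else 0 := by
        intro k
        rw [posWeight_insert]
        split_ifs with h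
        · subst h; simp [posWeight, hf.2.1]
        · simp
      simp only [h1, Finset.sum_add_distrib]
      simp [hj]
  · refine ⟨h.valid, h.card.trans (Nat.le_succ c), h.blocked, fun i hi j hj hf => ?_, h.sum_pos⟩
    have h1 := h.free i hi j hj hf
    have h2 : s i * E.p i j ≤ 0 := (b3 i hi j hj hf).trans (not_lt.1 hpos)
    push_cast; linarith

theorem greedy_dual (E : Market) (s : ℕ → ℝ) (b c : ℕ) : Dual E s b (min c b) (E.greedy s b c) := by
  unfold greedy
  refine forFold_induct (fun t S => Dual E s b (min t b) S) c ?_ ?_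
  · refine ⟨⟨by simp, by simp, by simp, by simp, by simp⟩, by simp, by simp, ?_, ?_⟩
    · intro i _ j _ _; simp [gain, GState.rate]
    · simp [gain, GState.rate, posWeight]
  · intro t S _ h
    split_ifs with ht
    · have := h.step
      rwa [show min t b + 1 = min (t + 1) b by omega] at this
    · rwa [show min (t + 1) b = min t b by omega]

/-- Raising the score of advertiser `i` does not lower the rate of its position: the two runs agree
until the one with the higher score matches `i`, which then gets the best of the free positions. -/
theorem greedy_rate_mono (hp : ∀ i j, 0 ≤ E.p i j) {s s' : ℕ → ℝ} {i : ℕ}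
    (hne : ∀ k, k ≠ i → s' k = s k) (hi : 0 < s i → s i ≤ s' i) (b c : ℕ) :
    (E.greedy s b c).rate E.p i ≤ (E.greedy s' b c).rate E.p i := by
  -- Either the runs still agree, or the second one has matched `i` at a position that is no worse
  -- than that of `i` in the first run and than every position still free there.
  let Rel : GState → GState → Prop := fun S S' => S = S' ∨
    (S'.pos i ≠ 0 ∧ S.rate E.p i ≤ S'.rate E.p i ∧
      (S.pos i = 0 → ∀ j < E.m, S.asg j = 0 → E.p i j * b ≤ 1 → E.p i j ≤ S'.rate E.p i))
  -- A step leaves `i` alone once it is matched.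
  have keep : ∀ (s : ℕ → ℝ) (S : GState), S.pos i ≠ 0 → (E.greedyStep s b S).pos i = S.pos i := by
    intro s S hS
    unfold greedyStep
    split_ifs with h
    · obtain ⟨-, -, hf, -⟩ := (best_spec s b S).2.1 h
      have : i ≠ (E.best s b S).2.1 := by rintro h'; rw [← h'] at hf; exact hS hf.1
      simp [GState.insert, Function.update_of_ne this]
    · rfl
  have asg_mono : ∀ (s : ℕ → ℝ) (S : GState) j, (E.greedyStep s b S).asg j = 0 → S.asg j = 0 := by
    intro s S j hS
    unfold greedyStep at hS
    split_ifs at hS with h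
    · simp only [GState.insert, Function.update_apply] at hS
      split_ifs at hS; exact hS
    · exact hS
  -- A step gives an unmatched `i` at most the rate of the best free position.
  have pick : ∀ (S : GState) (r : ℝ), 0 ≤ r → S.pos i = 0 →
      (∀ j < E.m, S.asg j = 0 → E.p i j * b ≤ 1 → E.p i j ≤ r) →
      (E.greedyStep s b S).rate E.p i ≤ r := by
    intro S r hr h0 hS
    unfold greedyStep
    split_ifs with h
    · obtain ⟨-, hj, hf, -⟩ := (best_spec s b S).2.1 h
      rw [rate_insert]
      split_ifs with h'
      · rw [← h'] at hf ⊢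
        exact hS _ hj hf.2.1 hf.2.2
      · simp [GState.rate, h0, hr]
    · simp [GState.rate, h0, hr]
  have rate_nn : ∀ S : GState, 0 ≤ S.rate E.p i := by
    intro S; unfold GState.rate; split_ifs
    · exact le_rfl
    · exact hp _ _
  have hstep : ∀ S S', Rel S S' → Rel (E.greedyStep s b S) (E.greedyStep s' b S') := by
    rintro S S' (rfl | ⟨h1, h2, h3⟩)
    · rcases best_raise hp hne hi b S with h | ⟨h, hpos⟩
      · left; simp [greedyStep, h]
      · right
        obtain ⟨-, hj, hf, hw⟩ := (best_spec s' b S).2.1 hpos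
        have hmax := (best_spec (E := E) s' b S).2.2
        have hn := ((best_spec (E := E) s' b S).2.1 hpos).1
        rw [h] at hf hw hn
        have hs' : 0 < s' i := by
          by_contra hneg
          have := mul_nonpos_of_nonpos_of_nonneg (not_lt.1 hneg) (hp i (E.best s' b S).2.2)
          linarith
        have hr : (E.greedyStep s' b S).rate E.p i = E.p i (E.best s' b S).2.2 := by
          rw [greedyStep, if_pos hpos, rate_insert, h, if_pos rfl]
        have hle : ∀ j < E.m, S.asg j = 0 → E.p i j * b ≤ 1 →
            E.p i j ≤ (E.greedyStep s' b S).rate E.p i := by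
          intro j hj ha hs
          have := hmax i hn j hj ⟨hf.1, ha, hs⟩
          rw [hw] at this
          rw [hr]
          exact le_of_mul_le_mul_left this hs'
        refine ⟨?_, pick S _ (rate_nn _) hf.1 hle, fun _ j hj ha hs => hle j hj (asg_mono _ _ _ ha) hs⟩
        rw [greedyStep, if_pos hpos, h]
        simp [GState.insert]
    · right
      have hr : (E.greedyStep s' b S').rate E.p i = S'.rate E.p i := by
        simp [GState.rate, keep s' S' h1]
      refine ⟨by rwa [keep s' S' h1], ?_, ?_⟩
      · rw [hr]
        by_cases h0 : S.pos i = 0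
        · exact pick S _ (rate_nn _) h0 (h3 h0)
        · have : (E.greedyStep s b S).rate E.p i = S.rate E.p i := by
            simp [GState.rate, keep s S h0]
          rwa [this]
      · rw [hr]
        intro h0 j hj ha hs
        refine h3 ?_ j hj (asg_mono _ _ _ ha) hs
        by_contra h0'
        exact h0' (by rw [← keep s S h0']; exact h0)
  have : Rel (E.greedy s b c) (E.greedy s' b c) := by
    refine forFold_induct₂ Rel c (Or.inl rfl) fun t S S' _ h => ?_
    split_ifs
    · exact hstep _ _ h
    · exact h
  rcases this with h | h
  · rw [h]
  · exact h.2.1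

end Market

/-! ### The lottery over buckets and its click probabilities -/

namespace Market

variable {E : Market}

/-- The number of buckets; bucket `a` holds the pairs of rate at most `2⁻ᵃ`. -/
def buckets (E : Market) : ℕ := Nat.size E.m + 1

/-- The greedy matching of at most `min K 2ᵃ` pairs of rate at most `2⁻ᵃ`. -/
def bucket (E : Market) (s : ℕ → ℝ) (a : ℕ) : GState := E.greedy s (2 ^ a) E.K

/-- The click probability of advertiser `i` in the lottery. -/
def clicks (E : Market) (s : ℕ → ℝ) (i : ℕ) : ℝ :=
  ∑ a ∈ Finset.range E.buckets, (E.bucket s a).rate E.p i / (2 * E.buckets)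

/-- The array entry that describes position `j` in entry `l` of the lottery. Entry `0` is the empty
allocation; entry `1 + a (m + 1) + k` shows the part of bucket `a` at the positions `j ≥ k`. -/
def entry (E : Market) (s : ℕ → ℝ) : ℕ → ℕ → ℕ
  | 0, _ => 0
  | l + 1, j => if l % (E.m + 1) ≤ j then (E.bucket s (l / (E.m + 1))).asg j else 0

/-- The weight of the part of bucket `a` at the positions `j ≥ k`. The factor `1 / 2` leaves room for
all the parts, as the rates in a bucket sum up to at most `1`. -/
def bucketWeight (E : Market) (s : ℕ → ℝ) (a k : ℕ) : ℝ :=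
  (if k = 0 then 1 else (E.bucket s a).posRate E.p (k - 1)) / (2 * E.buckets)

/-- The weights of the lottery; the empty allocation in entry `0` takes what is left. -/
def weight (E : Market) (s : ℕ → ℝ) : ℕ → ℝ
  | 0 => 1 - ∑ l ∈ Finset.range (E.buckets * (E.m + 1)),
      E.bucketWeight s (l / (E.m + 1)) (l % (E.m + 1))
  | l + 1 => E.bucketWeight s (l / (E.m + 1)) (l % (E.m + 1))

/-- The length of the lottery. -/
def len (E : Market) : ℕ := E.buckets * (E.m + 1) + 1

theorem bucket_dual (E : Market) (s : ℕ → ℝ) (a : ℕ) :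
    Dual E s (2 ^ a) (min E.K (2 ^ a)) (E.bucket s a) := greedy_dual E s _ _

theorem sum_range_div_mod (F : ℕ → ℕ → ℝ) (B M : ℕ) (hM : 0 < M) :
    ∑ l ∈ Finset.range (B * M), F (l / M) (l % M) =
      ∑ a ∈ Finset.range B, ∑ k ∈ Finset.range M, F a k := by
  induction B with
  | zero => simp
  | succ B ih =>
    rw [Nat.succ_mul, Finset.sum_range_add, ih, Finset.sum_range_succ]
    congr 1
    refine Finset.sum_congr rfl fun k hk => ?_
    have hk := Finset.mem_range.1 hk
    rw [mul_comm B M, Nat.mul_add_div hM, Nat.mul_add_mod, Nat.div_eq_of_lt hk, Nat.mod_eq_of_lt hk,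
      add_zero]

theorem posRate_nonneg (hp : ∀ i j, 0 ≤ E.p i j) (S : GState) (j : ℕ) : 0 ≤ S.posRate E.p j := by
  unfold GState.posRate
  split_ifs
  exacts [le_rfl, hp _ _]

theorem rate_nonneg (hp : ∀ i j, 0 ≤ E.p i j) (S : GState) (j : ℕ) : 0 ≤ S.rate E.p j := by
  unfold GState.rate
  split_ifs
  exacts [le_rfl, hp _ _]

/-- There are at most `2ᵃ` matched pairs, each of rate at most `2⁻ᵃ`. -/
theorem sum_posRate_le (E : Market) (s : ℕ → ℝ) (a : ℕ) :
    ∑ j ∈ Finset.range E.m, (E.bucket s a).posRate E.p j ≤ 1 := by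
  have hd := bucket_dual E s a
  set S := E.bucket s a
  have hb : (0 : ℝ) < 2 ^ a := by positivity
  have h1 : ∀ j ∈ Finset.range E.m, S.posRate E.p j ≤ if S.asg j ≠ 0 then 1 / (2 : ℝ) ^ a else 0 := by
    intro j _
    unfold GState.posRate
    by_cases h0 : S.asg j = 0
    · simp [h0]
    · rw [if_neg h0, if_pos h0, le_div_iff₀ hb]
      have : S.pos (S.asg j - 1) = j + 1 := by rw [← hd.valid.iff]; omega
      simpa using hd.valid.small _ _ this
  refine (Finset.sum_le_sum h1).trans ?_
  rw [← Finset.sum_filter, Finset.sum_const, nsmul_eq_mul, mul_one_div, div_le_one hb]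
  have := hd.card.trans (min_le_right _ _)
  exact_mod_cast this

theorem buckets_pos (E : Market) : (0 : ℝ) < E.buckets := by
  unfold buckets; positivity

theorem bucketWeight_nonneg (hp : ∀ i j, 0 ≤ E.p i j) (s : ℕ → ℝ) (a k : ℕ) :
    0 ≤ E.bucketWeight s a k := by
  unfold bucketWeight
  have := E.buckets_pos
  split_ifs
  · positivity
  · exact div_nonneg (posRate_nonneg hp _ _) (by positivity)

theorem weight_nonneg (hp : ∀ i j, 0 ≤ E.p i j) (s : ℕ → ℝ) (l : ℕ) : 0 ≤ E.weight s l := by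
  cases l with
  | succ l => exact bucketWeight_nonneg hp s _ _
  | zero =>
    have hB := E.buckets_pos
    simp only [weight]
    rw [sum_range_div_mod (fun a k => E.bucketWeight s a k) _ _ (Nat.succ_pos _), sub_nonneg]
    have h1 : ∀ a ∈ Finset.range E.buckets, ∑ k ∈ Finset.range (E.m + 1), E.bucketWeight s a k ≤
        1 / E.buckets := by
      intro a _
      have := sum_posRate_le E s a
      rw [Finset.sum_range_succ']
      simp only [bucketWeight, Nat.succ_ne_zero, if_false, Nat.add_sub_cancel, if_true,
        ← Finset.sum_div]
      rw [← add_div, div_le_div_iff₀ (by positivity) hB]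
      nlinarith
    refine (Finset.sum_le_sum h1).trans ?_
    rw [Finset.sum_const, Finset.card_range, nsmul_eq_mul, mul_one_div, div_self hB.ne']

theorem sum_weight (E : Market) (s : ℕ → ℝ) : ∑ l ∈ Finset.range E.len, E.weight s l = 1 := by
  rw [len, Finset.sum_range_succ']
  simp [weight]

theorem entry_eq_succ {s : ℕ → ℝ} {l i j : ℕ} (h : E.entry s l j = i + 1) :
    (E.bucket s ((l - 1) / (E.m + 1))).asg j = i + 1 := by
  cases l with
  | zero => simp [entry] at h
  | succ l =>
    simp only [entry] at h
    split_ifs at h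
    exact h

theorem isAllocation_entry (E : Market) (s : ℕ → ℝ) (l : ℕ) :
    IsAllocation E.K (fun (i : Fin E.n) (j : Fin E.m) =>
      if E.entry s l j = (i : ℕ) + 1 then (1 : Fin 2) else 0) := by
  have hd := bucket_dual E s ((l - 1) / (E.m + 1))
  have hcast : ∀ (P : Prop) [Decidable P], (((if P then (1 : Fin 2) else 0) : Fin 2) : ℕ) =
      if P then 1 else 0 := by intro P _; split_ifs <;> rfl
  have hcol : ∀ j : Fin E.m, ∑ i : Fin E.n, (if E.entry s l j = (i : ℕ) + 1 then 1 else 0) ≤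
      if (E.bucket s ((l - 1) / (E.m + 1))).asg j ≠ 0 then 1 else 0 := by
    intro j
    split_ifs with h0
    · rw [← Finset.card_filter, Finset.card_le_one]
      intro i hi i' hi'
      simp only [Finset.mem_filter] at hi hi'
      exact Fin.ext (by omega)
    · refine (Finset.sum_eq_zero fun i _ => if_neg fun h => h0 ?_).le
      rw [entry_eq_succ h]; omega
  refine ⟨fun i => ?_, fun j => ?_, ?_⟩
  · simp only [hcast]
    rw [← Finset.card_filter, Finset.card_le_one]
    intro j hj j' hj'
    simp only [Finset.mem_filter, Finset.mem_univ, true_and] at hj hj'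
    have h1 := (hd.valid.iff _ _).1 (entry_eq_succ hj)
    have h2 := (hd.valid.iff _ _).1 (entry_eq_succ hj')
    exact Fin.ext (by omega)
  · simp only [hcast]
    refine (hcol j).trans ?_
    split_ifs <;> simp
  · simp only [hcast]
    rw [Finset.sum_comm]
    refine (Finset.sum_le_sum fun j _ => hcol j).trans ?_
    rw [Fin.sum_univ_eq_sum_range (fun j => if (E.bucket s ((l - 1) / (E.m + 1))).asg j ≠ 0 then 1 else 0),
      ← Finset.card_filter]
    exact hd.card.trans (min_le_left _ _)

/-- The augmented allocation in entry `l` of the lottery. -/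
def augAlloc (E : Market) (s : ℕ → ℝ) (l : ℕ) : AugAlloc E.n E.m E.K :=
  (⟨fun i j => if E.entry s l j = (i : ℕ) + 1 then 1 else 0, isAllocation_entry E s l⟩, 1)

/-- Showing the positions `j ≥ k` with weight `1` if `k = 0` and `P (k - 1)` otherwise, in
natural order, compensates the externalities exactly. -/
theorem sum_prefix_weights (P : ℕ → ℝ) (j : ℕ) :
    ∑ k ∈ Finset.range (j + 1), (if k = 0 then 1 else P (k - 1)) *
      ∏ j' ∈ Finset.range j, (1 - if k ≤ j' then P j' else 0) = 1 := by
  induction j with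
  | zero => simp
  | succ j ih =>
    rw [Finset.sum_range_succ]
    have h1 : ∏ j' ∈ Finset.range (j + 1), (1 - if j + 1 ≤ j' then P j' else 0) = 1 := by
      refine Finset.prod_eq_one fun k hk => ?_
      have := Finset.mem_range.1 hk
      rw [if_neg (by omega), sub_zero]
    have h2 : ∀ k ∈ Finset.range (j + 1), (if k = 0 then 1 else P (k - 1)) *
        ∏ j' ∈ Finset.range (j + 1), (1 - if k ≤ j' then P j' else 0) =
        ((if k = 0 then 1 else P (k - 1)) *
        ∏ j' ∈ Finset.range j, (1 - if k ≤ j' then P j' else 0)) * (1 - P j) := by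
      intro k hk
      have := Finset.mem_range.1 hk
      rw [Finset.prod_range_succ, if_pos (show k ≤ j by omega), mul_assoc]
    rw [Finset.sum_congr rfl h2, ← Finset.sum_mul, ih, h1]
    simp

theorem prod_filter_lt (m : ℕ) (f : ℕ → ℝ) (j : Fin m) :
    ∏ j' ∈ Finset.univ.filter (fun j' : Fin m => j' < j), f j' = ∏ k ∈ Finset.range j, f k := by
  rw [Finset.prod_filter]
  have := Fin.prod_univ_eq_prod_range (fun k => if k < (j : ℕ) then f k else 1) m
  simp only [Fin.lt_def]
  rw [this, ← Finset.prod_filter]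
  congr 1
  ext k
  simp only [Finset.mem_filter, Finset.mem_range]
  have := j.2
  omega

/-- Click-through rates in the suffix of bucket `l / (m + 1)` that starts at position `l % (m + 1)`. -/
theorem ctr_augAlloc {q : Fin E.n → Fin E.m → ℝ} (hq : ∀ i j, q i j = E.p i j) (s : ℕ → ℝ) (l : ℕ)
    (i : Fin E.n) :
    ctr q (E.augAlloc s (l + 1)) i = ∑ j ∈ Finset.range E.m,
      (if (E.bucket s (l / (E.m + 1))).asg j = i + 1 then E.p i j *
        (if l % (E.m + 1) ≤ j then ∏ k ∈ Finset.range j,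
        (1 - if l % (E.m + 1) ≤ k then (E.bucket s (l / (E.m + 1))).posRate E.p k else 0) else 0)
      else 0) := by
  rw [← Fin.sum_univ_eq_sum_range (fun j => if (E.bucket s (l / (E.m + 1))).asg j = i + 1 then E.p i j *
        (if l % (E.m + 1) ≤ j then ∏ k ∈ Finset.range j,
        (1 - if l % (E.m + 1) ≤ k then (E.bucket s (l / (E.m + 1))).posRate E.p k else 0) else 0)
      else 0)]
  unfold ctr
  refine Finset.sum_congr rfl fun j _ => ?_
  have hcast : ∀ (P : Prop) [Decidable P], ((((if P then (1 : Fin 2) else 0) : Fin 2) : ℕ) : ℝ) =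
      if P then 1 else 0 := by intro P _; split_ifs <;> simp
  have hfil : Finset.univ.filter (fun j' => (E.augAlloc s (l + 1)).2 j' < (E.augAlloc s (l + 1)).2 j) =
      Finset.univ.filter (fun j' => j' < j) := by
    ext j'
    simp only [Finset.mem_filter, Finset.mem_univ, true_and]
    rfl
  rw [hfil]
  simp only [augAlloc, hcast, hq]
  have hd := bucket_dual E s (l / (E.m + 1))
  set S := E.bucket s (l / (E.m + 1)) with hS
  have hsum : ∀ j' : Fin E.m, ∑ i' : Fin E.n, (if E.entry s (l + 1) j' = (i' : ℕ) + 1 then (1 : ℝ) else 0)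
      * E.p i' j' = if l % (E.m + 1) ≤ j' then S.posRate E.p j' else 0 := by
    intro j'
    simp only [entry, ← hS]
    by_cases h : l % (E.m + 1) ≤ j'
    · simp only [if_pos h]
      unfold GState.posRate
      split_ifs with h0
      · simp [h0]
      · have hlt : S.asg j' - 1 < E.n := by
          apply hd.valid.pos_lt
          have : S.pos (S.asg j' - 1) = j' + 1 := by rw [← hd.valid.iff]; omega
          omega
        rw [Finset.sum_eq_single ⟨S.asg j' - 1, hlt⟩]
        · simp only
          rw [if_pos (by omega), one_mul]
        · intro b _ hb
          rw [if_neg, zero_mul]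
          intro hb'
          exact hb (Fin.ext (by simp only; omega))
        · simp
    · simp [h]
  simp only [hsum]
  rw [prod_filter_lt E.m (fun k => 1 - if l % (E.m + 1) ≤ k then S.posRate E.p k else 0)]
  simp only [entry, ← hS]
  by_cases h : l % (E.m + 1) ≤ j
  · simp only [h, if_true]
    split_ifs <;> ring
  · simp [h]

theorem sum_asg_eq_rate {s : ℕ → ℝ} {b : ℕ} {S : GState} (h : Valid E s b S) (i : ℕ) :
    ∑ j ∈ Finset.range E.m, (if S.asg j = i + 1 then E.p i j else 0) = S.rate E.p i := by
  unfold GState.rate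
  simp only [h.iff]
  split_ifs with h0
  · exact Finset.sum_eq_zero fun j _ => if_neg (by omega)
  · have h1 : S.asg (S.pos i - 1) = i + 1 := by rw [h.iff]; omega
    have hlt : S.pos i - 1 < E.m := h.asg_lt _ (by omega)
    rw [Finset.sum_eq_single (S.pos i - 1)]
    · rw [if_pos (by omega)]
    · intro j _ hj
      rw [if_neg (by omega)]
    · intro h2; exact absurd (Finset.mem_range.2 hlt) h2

/-- In the lottery the externalities cancel: the matching of a bucket contributes half the standalone
rate, divided by the number of buckets. -/
theorem sum_weight_mul_ctr {q : Fin E.n → Fin E.m → ℝ} (hq : ∀ i j, q i j = E.p i j) (s : ℕ → ℝ)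
    (i : Fin E.n) :
    ∑ l ∈ Finset.range E.len, E.weight s l * ctr q (E.augAlloc s l) i = E.clicks s i := by
  rw [len, Finset.sum_range_succ']
  have h0 : ctr q (E.augAlloc s 0) i = 0 := by
    simp [ctr, augAlloc, entry]
  rw [h0, mul_zero, add_zero]
  simp only [ctr_augAlloc hq, weight]
  rw [sum_range_div_mod (fun a k => E.bucketWeight s a k * ∑ j ∈ Finset.range E.m,
      (if (E.bucket s a).asg j = i + 1 then E.p i j *
        (if k ≤ j then ∏ k' ∈ Finset.range j,
        (1 - if k ≤ k' then (E.bucket s a).posRate E.p k' else 0) else 0)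
      else 0)) _ _ (Nat.succ_pos _)]
  refine Finset.sum_congr rfl fun a _ => ?_
  simp only [Finset.mul_sum]
  rw [Finset.sum_comm, ← sum_asg_eq_rate (bucket_dual E s a).valid, Finset.sum_div]
  refine Finset.sum_congr rfl fun j hj => ?_
  have hj := Finset.mem_range.1 hj
  split_ifs with h
  · have h1 := sum_prefix_weights ((E.bucket s a).posRate E.p) j
    calc _ = ∑ k ∈ Finset.range (E.m + 1), (if k ≤ j then (E.p i j / (2 * E.buckets)) *
          ((if k = 0 then 1 else (E.bucket s a).posRate E.p (k - 1)) *
          ∏ k' ∈ Finset.range j, (1 - if k ≤ k' then (E.bucket s a).posRate E.p k' else 0)) else 0) := by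
          refine Finset.sum_congr rfl fun k _ => ?_
          by_cases hk : k ≤ j
          · simp only [hk, if_true, bucketWeight]; ring
          · simp [hk]
      _ = ∑ k ∈ Finset.range (j + 1), (E.p i j / (2 * E.buckets)) *
          ((if k = 0 then 1 else (E.bucket s a).posRate E.p (k - 1)) *
          ∏ k' ∈ Finset.range j, (1 - if k ≤ k' then (E.bucket s a).posRate E.p k' else 0)) := by
          rw [← Finset.sum_filter]
          refine Finset.sum_congr ?_ fun _ _ => rfl
          ext k
          simp only [Finset.mem_filter, Finset.mem_range]
          omega
      _ = _ := by rw [← Finset.mul_sum, h1, mul_one]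
  · simp

/-! ### The approximation guarantee -/

/-- The probabilities of the first click being at position `j`, where position `j` is clicked with
conditional probability `u j`, sum up to at most `1`. -/
theorem sum_mul_prod_le_one {m : ℕ} (σ : Equiv.Perm (Fin m)) (u : Fin m → ℝ) (h1 : ∀ j, u j ≤ 1) :
    ∑ j, u j * ∏ j' ∈ Finset.univ.filter (fun j' => σ j' < σ j), (1 - u j') ≤ 1 := by
  have h := Finset.prod_one_sub_ordered Finset.univ (fun k => u (σ.symm k))
  have hpos : 0 ≤ ∏ k, (1 - u (σ.symm k)) := Finset.prod_nonneg fun k _ => by linarith [h1 (σ.symm k)]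
  have : ∑ j, u j * ∏ j' ∈ Finset.univ.filter (fun j' => σ j' < σ j), (1 - u j') =
      ∑ k, u (σ.symm k) * ∏ k' ∈ Finset.univ.filter (fun k' => k' < k), (1 - u (σ.symm k')) := by
    rw [← Equiv.sum_comp σ.symm]
    refine Finset.sum_congr rfl fun k _ => ?_
    congr 1
    refine Finset.prod_bij (fun j _ => σ j) ?_ ?_ ?_ ?_
    · simp
    · simp
    · intro b hb
      exact ⟨σ.symm b, by simpa using hb, by simp⟩
    · simp
  rw [this]
  linarith

/-- The finest of the buckets `0, …, L` that contains pairs of rate `r`. -/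
theorem exists_bucket {r : ℝ} (h1 : r ≤ 1) (L : ℕ) :
    ∃ a ≤ L, r * 2 ^ a ≤ 1 ∧ (a < L → 1 < r * 2 ^ (a + 1)) := by
  classical
  refine ⟨Nat.findGreatest (fun a => r * 2 ^ a ≤ 1) L, Nat.findGreatest_le _, ?_, fun h => ?_⟩
  · exact Nat.findGreatest_spec (P := fun a => r * 2 ^ a ≤ 1) (m := 0) (Nat.zero_le _) (by simpa using h1)
  · by_contra hc
    exact Nat.findGreatest_is_greatest (P := fun a => r * 2 ^ a ≤ 1) (Nat.lt_succ_self _) h (not_lt.1 hc)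

/-- The scored click probabilities of any augmented allocation are at most `10 · buckets` times those
of the lottery. Each pair of the allocation belongs to a bucket in which it is covered by the
dual solution of the greedy matching; a free pair is covered by its share in the cap `K` or, if the
bucket was filled for `2ᵃ` rounds, by its probability of being clicked. -/
theorem sum_score_ctr_le (hp0 : ∀ i j, 0 ≤ E.p i j) (hp1 : ∀ i j, E.p i j ≤ 1) (hK : E.K ≤ E.m)
    {q : Fin E.n → Fin E.m → ℝ} (hq : ∀ i j, q i j = E.p i j) (s : ℕ → ℝ) (χ : AugAlloc E.n E.m E.K) :
    ∑ i : Fin E.n, s i * ctr q χ i ≤ 10 * E.buckets * ∑ i : Fin E.n, s i * E.clicks s i := by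
  set X : Fin E.n → Fin E.m → ℝ := fun i j => ((χ.1.1 i j : ℕ) : ℝ) with hX
  set u : Fin E.m → ℝ := fun j => ∑ i, X i j * E.p i j with hu
  set D : Fin E.m → ℝ := fun j => ∏ j' ∈ Finset.univ.filter (fun j' => χ.2 j' < χ.2 j), (1 - u j') with hD
  set G : ℕ → ℝ := fun a => E.gain s (E.bucket s a) with hG
  have hX0 : ∀ i j, 0 ≤ X i j := fun i j => Nat.cast_nonneg _
  have hrow : ∀ i, ∑ j, X i j ≤ 1 := fun i => by
    have := χ.1.2.1 i
    simp only [hX]; exact_mod_cast this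
  have hcol : ∀ j, ∑ i, X i j ≤ 1 := fun j => by
    have := χ.1.2.2.1 j
    simp only [hX]; exact_mod_cast this
  have htot : ∑ i, ∑ j, X i j ≤ E.K := by
    have := χ.1.2.2.2
    simp only [hX]; exact_mod_cast this
  have hu0 : ∀ j, 0 ≤ u j := fun j => Finset.sum_nonneg fun i _ => mul_nonneg (hX0 i j) (hp0 _ _)
  have hu1 : ∀ j, u j ≤ 1 := fun j =>
    (Finset.sum_le_sum fun i _ => mul_le_of_le_one_right (hX0 i j) (hp1 _ _)).trans (hcol j)
  have hD0 : ∀ j, 0 ≤ D j := fun j => Finset.prod_nonneg fun k _ => by linarith [hu1 k]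
  have hD1 : ∀ j, D j ≤ 1 := fun j => Finset.prod_le_one (fun k _ => by linarith [hu1 k])
    (fun k _ => by linarith [hu0 k])
  have hd := fun a => bucket_dual E s a
  have hG0 : ∀ a, 0 ≤ G a := fun a => (hd a).valid.gain_nonneg
  have hctr : ∀ i, ctr q χ i = ∑ j, X i j * E.p i j * D j := by
    intro i; simp only [ctr, hq, hD, hu, hX]
  -- The amount that bucket `a` provides for the pair `(i, j)`: the matched weights at its two ends,
  -- its click probability, and its share in the cap.
  let term : ℕ → Fin E.n → Fin E.m → ℝ := fun a i j => s i * (E.bucket s a).rate E.p i +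
    E.posWeight s (E.bucket s a) j + 2 * G a * (E.p i j * D j) + G a / E.K
  have hterm0 : ∀ a i j, 0 ≤ term a i j := by
    intro a i j
    have h1 := (hd a).valid.rate_nonneg i
    have h2 := (hd a).valid.posWeight_nonneg j
    have h3 := mul_nonneg (hG0 a) (mul_nonneg (hp0 i j) (hD0 j))
    have h4 : 0 ≤ G a / E.K := div_nonneg (hG0 a) (Nat.cast_nonneg _)
    simp only [term]; linarith
  have key : ∀ i j, X i j * (s i * E.p i j * D j) ≤
      X i j * ∑ a ∈ Finset.range E.buckets, term a i j := by
    intro i j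
    rcases eq_or_ne (X i j) 0 with h0 | h0
    · simp [h0]
    refine mul_le_mul_of_nonneg_left ?_ (hX0 i j)
    have hK1 : 0 < E.K := by
      have h1 : X i j ≤ ∑ i, ∑ j, X i j :=
        (Finset.single_le_sum (f := fun j => X i j) (fun j _ => hX0 i j) (Finset.mem_univ j)).trans
          (Finset.single_le_sum (f := fun i => ∑ j, X i j)
            (fun i _ => Finset.sum_nonneg fun j _ => hX0 i j) (Finset.mem_univ i))
      have h2 : (0 : ℝ) < E.K := lt_of_lt_of_le (lt_of_le_of_ne (hX0 i j) h0.symm) (h1.trans htot)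
      exact_mod_cast h2
    have hK' : (0 : ℝ) < E.K := by exact_mod_cast hK1
    obtain ⟨a, haL, hs, hl⟩ := exists_bucket (hp1 i j) (Nat.size E.m)
    refine le_trans ?_ (Finset.single_le_sum (f := fun a => term a i j) (fun a _ => hterm0 a i j)
      (Finset.mem_range.2 (Nat.lt_succ_of_le haL)))
    by_cases hw : s i * E.p i j ≤ 0
    · exact (mul_nonpos_of_nonpos_of_nonneg hw (hD0 j)).trans (hterm0 a i j)
    push Not at hw
    have hwD : s i * E.p i j * D j ≤ s i * E.p i j := mul_le_of_le_one_right hw.le (hD1 j)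
    have h1 := (hd a).valid.rate_nonneg i
    have h2 := (hd a).valid.posWeight_nonneg j
    have h3 := mul_nonneg (hG0 a) (mul_nonneg (hp0 i j) (hD0 j))
    have h4 : 0 ≤ G a / E.K := div_nonneg (hG0 a) (Nat.cast_nonneg _)
    have hs' : E.p i j * ((2 ^ a : ℕ) : ℝ) ≤ 1 := by push_cast; exact hs
    by_cases hb : (E.bucket s a).pos i ≠ 0 ∨ (E.bucket s a).asg j ≠ 0
    · have := (hd a).blocked i i.2 j j.2 hs' hb
      simp only [term]; linarith
    · push Not at hb
      have hf := (hd a).free i i.2 j j.2 ⟨hb.1, hb.2, hs'⟩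
      rcases le_or_gt E.K (2 ^ a) with hc | hc
      · rw [min_eq_left hc] at hf
        have : s i * E.p i j ≤ G a / E.K := by
          rw [le_div_iff₀ hK']; linarith
        simp only [term]; linarith
      · -- As `2 ^ a < K ≤ m`, a finer bucket exists, and `(i, j)` is too likely to be in it.
        rw [min_eq_right hc.le] at hf
        have ha : a < Nat.size E.m := Nat.lt_size.2 (hc.le.trans hK)
        have h5 := hl ha
        rw [pow_succ] at h5
        push_cast at hf
        have h6 : s i * E.p i j ≤ 2 * G a * E.p i j := by
          have h7 : s i * E.p i j * 1 ≤ s i * E.p i j * (E.p i j * (2 ^ a * 2)) :=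
            mul_le_mul_of_nonneg_left h5.le hw.le
          have h8 : (2 ^ a * (s i * E.p i j)) * (2 * E.p i j) ≤ G a * (2 * E.p i j) :=
            mul_le_mul_of_nonneg_right hf (by linarith [hp0 i j])
          nlinarith
        have h9 := mul_le_mul_of_nonneg_right h6 (hD0 j)
        simp only [term]; linarith
  -- The four parts of `term` sum up to `G a`, `G a`, `2 * G a` and `G a` at most.
  have hsum : ∀ a, ∑ i, ∑ j, X i j * term a i j ≤ 5 * G a := by
    intro a
    have e1 : ∑ i, ∑ j, X i j * (s i * (E.bucket s a).rate E.p i) ≤ G a := by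
      simp only [← Finset.sum_mul]
      refine (Finset.sum_le_sum fun (i : Fin E.n) _ => mul_le_of_le_one_left ((hd a).valid.rate_nonneg i)
        (hrow i)).trans ?_
      rw [Fin.sum_univ_eq_sum_range (fun i => s i * (E.bucket s a).rate E.p i)]
      exact le_rfl
    have e2 : ∑ i, ∑ j, X i j * E.posWeight s (E.bucket s a) j ≤ G a := by
      rw [Finset.sum_comm]
      simp only [← Finset.sum_mul]
      refine (Finset.sum_le_sum fun (j : Fin E.m) _ => mul_le_of_le_one_left ((hd a).valid.posWeight_nonneg j)
        (hcol j)).trans ?_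
      rw [Fin.sum_univ_eq_sum_range (fun j => E.posWeight s (E.bucket s a) j)]
      exact (hd a).sum_pos.le
    have e3 : ∑ i, ∑ j, X i j * (2 * G a * (E.p i j * D j)) ≤ 2 * G a := by
      rw [Finset.sum_comm]
      have : ∀ j, ∑ i, X i j * (2 * G a * (E.p i j * D j)) = 2 * G a * (u j * D j) := by
        intro j
        simp only [hu, Finset.mul_sum, Finset.sum_mul]
        exact Finset.sum_congr rfl fun i _ => by ring
      simp only [this, ← Finset.mul_sum]
      exact mul_le_of_le_one_right (by linarith [hG0 a]) (sum_mul_prod_le_one χ.2 u hu1)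
    have e4 : ∑ i, ∑ j, X i j * (G a / E.K) ≤ G a := by
      simp only [← Finset.sum_mul]
      rcases Nat.eq_zero_or_pos E.K with h0 | h0
      · simp [h0, hG0 a]
      · have hK' : (0 : ℝ) < E.K := by exact_mod_cast h0
        rw [mul_div_assoc', div_le_iff₀ hK', mul_comm (G a)]
        exact mul_le_mul_of_nonneg_right htot (hG0 a)
    simp only [term, mul_add, Finset.sum_add_distrib]
    linarith
  have hB := E.buckets_pos
  have hrhs : 10 * E.buckets * ∑ i : Fin E.n, s i * E.clicks s i =
      ∑ a ∈ Finset.range E.buckets, 5 * G a := by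
    simp only [clicks, Finset.mul_sum]
    rw [Finset.sum_comm]
    refine Finset.sum_congr rfl fun a _ => ?_
    simp only [hG, gain]
    rw [← Fin.sum_univ_eq_sum_range (fun i => s i * (E.bucket s a).rate E.p i), Finset.mul_sum]
    refine Finset.sum_congr rfl fun i _ => ?_
    field_simp
    ring
  rw [hrhs]
  calc ∑ i : Fin E.n, s i * ctr q χ i = ∑ i, ∑ j, X i j * (s i * E.p i j * D j) := by
        refine Finset.sum_congr rfl fun i _ => ?_
        rw [hctr, Finset.mul_sum]
        exact Finset.sum_congr rfl fun j _ => by ring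
    _ ≤ ∑ i, ∑ j, X i j * ∑ a ∈ Finset.range E.buckets, term a i j :=
        Finset.sum_le_sum fun i _ => Finset.sum_le_sum fun j _ => key i j
    _ = ∑ a ∈ Finset.range E.buckets, ∑ i, ∑ j, X i j * term a i j := by
        rw [Finset.sum_comm]
        simp only [Finset.mul_sum]
        rw [Finset.sum_comm]
        conv_rhs => rw [Finset.sum_comm]
        refine Finset.sum_congr rfl fun j _ => ?_
        rw [Finset.sum_comm]
    _ ≤ _ := Finset.sum_le_sum fun a _ => hsum a

/-- The number of buckets is logarithmic in the number of positions. -/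
theorem buckets_le_log (hm : 0 < E.m) : (E.buckets : ℝ) ≤ 5 * Real.log (E.m + 1) := by
  have hl2 := Real.log_two_gt_d9
  have hm' : (1 : ℝ) ≤ E.m := by exact_mod_cast hm
  have h1 : 2 ^ (Nat.size E.m - 1) ≤ E.m := by
    rw [← Nat.lt_size]
    have := Nat.size_pos.2 hm
    omega
  have h2 : (Nat.size E.m - 1 : ℕ) * Real.log 2 ≤ Real.log (E.m + 1) := by
    rw [← Real.log_pow]
    refine Real.log_le_log (by positivity) ?_
    have : ((2 ^ (Nat.size E.m - 1) : ℕ) : ℝ) ≤ E.m := by exact_mod_cast h1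
    push_cast at this
    linarith
  have h3 : Real.log 2 ≤ Real.log (E.m + 1) := Real.log_le_log (by norm_num) (by linarith)
  have h4 : (E.buckets : ℝ) = (Nat.size E.m - 1 : ℕ) + 2 := by
    have := Nat.size_pos.2 hm
    have h5 : E.buckets = (Nat.size E.m - 1) + 2 := by unfold buckets; omega
    rw [h5]; push_cast; ring
  have h6 : (0 : ℝ) ≤ (Nat.size E.m - 1 : ℕ) := Nat.cast_nonneg _
  rw [h4]
  nlinarith

end Market

/-! ### Payments by bisection -/

/-- The payment that makes the nondecreasing click probability `y` incentive compatible. -/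
def exactPayment (y : ℝ → ℝ) (x : ℝ) : ℝ := x * y x - ∫ z in (0 : ℝ)..x, y z

theorem exactPayment_zero (y : ℝ → ℝ) : exactPayment y 0 = 0 := by simp [exactPayment]

theorem intervalIntegrable_of_monotoneOn_Ici {y : ℝ → ℝ} (hy : MonotoneOn y (Set.Ici 0)) {x x' : ℝ}
    (hx : 0 ≤ x) (hx' : 0 ≤ x') : IntervalIntegrable y volume x x' :=
  (hy.mono fun _ hz => (le_min hx hx').trans hz.1).intervalIntegrable

/-- An increment of the click probability between `x` and `x'` is charged between `x` and `x'`. -/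
theorem exactPayment_sub_mem {y : ℝ → ℝ} (hy : MonotoneOn y (Set.Ici 0)) {x x' : ℝ} (hx : 0 ≤ x)
    (h : x ≤ x') : (y x' - y x) * x ≤ exactPayment y x' - exactPayment y x ∧
      exactPayment y x' - exactPayment y x ≤ (y x' - y x) * x' := by
  have hi := intervalIntegrable_of_monotoneOn_Ici hy hx (hx.trans h)
  have h0 := intervalIntegrable_of_monotoneOn_Ici hy le_rfl hx
  have hsplit : ∫ z in (0 : ℝ)..x', y z = (∫ z in (0 : ℝ)..x, y z) + ∫ z in x..x', y z :=
    (intervalIntegral.integral_add_adjacent_intervals h0 hi).symm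
  have h1 : ∫ z in x..x', y z ≤ ∫ z in x..x', y x' :=
    intervalIntegral.integral_mono_on h hi (by simp) fun z hz =>
      hy (hx.trans hz.1) (hx.trans h) hz.2
  have h2 : ∫ z in x..x', y x ≤ ∫ z in x..x', y z :=
    intervalIntegral.integral_mono_on h (by simp) hi fun z hz => hy hx (hx.trans hz.1) hz.1
  simp only [intervalIntegral.integral_const, smul_eq_mul] at h1 h2
  unfold exactPayment
  rw [hsplit]
  constructor <;> nlinarith

/-- With exact payments truthful reporting is optimal. -/
theorem exactPayment_ic {y : ℝ → ℝ} (hy : MonotoneOn y (Set.Ici 0)) {r x : ℝ} (hr : 0 ≤ r)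
    (hx : 0 ≤ x) : x * y r - exactPayment y r ≤ x * y x - exactPayment y x := by
  rcases le_total r x with h | h
  · have := (exactPayment_sub_mem hy hr h).2
    nlinarith
  · have := (exactPayment_sub_mem hy hx h).1
    nlinarith

/-- State of the payment computation: `paid` is the payment for the increments of `y` above `hi`; the
jump of `y` from `ylo = y lo` to `a = y hi` is being located in `[lo, hi]`. -/
structure PayState where
  paid : ℝ
  a : ℝ
  hi : ℝ
  lo : ℝ
  ylo : ℝ

open Classical in
/-- One round of the payment computation: once the interval is short, its jump is charged at the upper
end and the search goes on below; otherwise the interval is halved. -/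
def payStep (ε : ℝ) (y : ℝ → ℝ) (S : PayState) : PayState :=
  if S.a ≤ 0 then S
  else if S.hi - S.lo ≤ ε then ⟨S.paid + (S.a - S.ylo) * S.hi, S.ylo, S.lo, 0, 0⟩
  else if S.a ≤ y ((S.lo + S.hi) / 2) then ⟨S.paid, S.a, (S.lo + S.hi) / 2, S.lo, S.ylo⟩
  else ⟨S.paid, S.a, S.hi, (S.lo + S.hi) / 2, y ((S.lo + S.hi) / 2)⟩

/-- The initial state at report `V`. -/
def payInit (y : ℝ → ℝ) (V : ℝ) : PayState := ⟨0, y V, V, 0, 0⟩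

/-- The invariant of the payment computation at report `V`: `paid` is the exact payment for the
increments of `y` above `hi`, up to an excess of at most `ε` per unit. -/
structure PayInv (ε : ℝ) (y : ℝ → ℝ) (V : ℝ) (S : PayState) : Prop where
  lo_nonneg : 0 ≤ S.lo
  lo_le : S.lo ≤ S.hi
  hi_le : S.hi ≤ V
  a_eq : S.a = y S.hi
  ylo_eq : S.ylo = y S.lo
  ylo_lt : 0 < S.a → S.ylo < S.a
  paid_nonneg : 0 ≤ S.paid
  paid_le : S.paid ≤ V * (y V - S.a)
  lower : exactPayment y V - exactPayment y S.hi ≤ S.paid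
  upper : S.paid ≤ exactPayment y V - exactPayment y S.hi + ε * (y V - S.a)

theorem payInit_inv {ε : ℝ} {y : ℝ → ℝ} (h0 : y 0 = 0) {V : ℝ} (hV : 0 ≤ V) :
    PayInv ε y V (payInit y V) := by
  constructor <;> simp [payInit, h0, hV]

theorem PayInv.step {ε : ℝ} {y : ℝ → ℝ} (hy : MonotoneOn y (Set.Ici 0)) (h0 : y 0 = 0) {V : ℝ}
    {S : PayState} (h : PayInv ε y V S) : PayInv ε y V (payStep ε y S) := by
  obtain ⟨h1, h2, h3, h4, h5, h6, h7, h8, h9, h10⟩ := h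
  have hlo : y S.lo ≤ y S.hi := hy h1 (h1.trans h2) h2
  have hylo : 0 ≤ y S.lo := h0 ▸ hy (le_refl (0 : ℝ)) h1 h1
  have hd := exactPayment_sub_mem hy h1 h2
  unfold payStep
  split_ifs with c1 c2 c3
  · exact ⟨h1, h2, h3, h4, h5, h6, h7, h8, h9, h10⟩
  · refine ⟨le_rfl, h1, h2.trans h3, h5, h0.symm, fun h => h, ?_, ?_, ?_, ?_⟩ <;> simp only
    · have : 0 ≤ (S.a - S.ylo) * S.hi := mul_nonneg (by linarith) (h1.trans h2)
      linarith
    · nlinarith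
    · rw [h4, h5]; linarith
    · rw [h4] at *; rw [h5] at *
      nlinarith
  · have hm : y ((S.lo + S.hi) / 2) = S.a := by
      refine le_antisymm ?_ c3
      rw [h4]
      exact hy (show (0 : ℝ) ≤ _ by linarith) (h1.trans h2) (by linarith)
    have hd' := exactPayment_sub_mem hy (show (0 : ℝ) ≤ (S.lo + S.hi) / 2 by linarith)
      (show (S.lo + S.hi) / 2 ≤ S.hi by linarith)
    rw [hm, ← h4] at hd'
    simp only [sub_self, zero_mul] at hd'
    refine ⟨h1, ?_, ?_, hm.symm, h5, h6, h7, h8, ?_, ?_⟩ <;> simp only <;> linarith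
  · push Not at c3
    exact ⟨show (0 : ℝ) ≤ _ by simp only; linarith, by simp only; linarith, h3, h4, rfl,
      fun _ => c3, h7, h8, h9, h10⟩

theorem payStep_done (ε : ℝ) (y : ℝ → ℝ) (S : PayState) (h : S.a ≤ 0) : payStep ε y S = S := by
  simp [payStep, h]

/-- `N` ranks the values of `y`: it is nondecreasing and grows strictly where `y` does. -/
structure IsRank (y : ℝ → ℝ) (N : ℝ → ℕ) : Prop where
  mono : ∀ x x', 0 ≤ x → x ≤ x' → N x ≤ N x'
  lt : ∀ x x', 0 ≤ x → x ≤ x' → y x < y x' → N x < N x'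

/-- Each round either halves the interval, at most `β` times in a row, or charges a jump, which lowers
the rank of `hi`; `k` and `r` count the halvings and the jumps that are left. -/
theorem payStep_terminates {ε : ℝ} {y : ℝ → ℝ} (hy : MonotoneOn y (Set.Ici 0))
    (h0 : y 0 = 0) {V : ℝ} {N : ℝ → ℕ} (hN : IsRank y N) {β : ℕ} (hβ : V ≤ 2 ^ β * ε) (T : ℕ) :
    ∀ (S : PayState) (k r : ℕ), PayInv ε y V S → k ≤ β → S.hi - S.lo ≤ 2 ^ k * ε → N S.hi ≤ r →
      k + r * (β + 1) ≤ T → ((payStep ε y)^[T] S).a ≤ 0 := by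
  induction T with
  | zero =>
    intro S k r h _ _ hr hT
    have hr0 : r = 0 := by
      by_contra hc
      have : 1 * 1 ≤ r * (β + 1) := Nat.mul_le_mul (Nat.one_le_iff_ne_zero.2 hc) (by omega)
      omega
    by_contra hc
    simp only [Function.iterate_zero, id_eq, not_le] at hc
    have := hN.lt 0 S.hi le_rfl (h.lo_nonneg.trans h.lo_le) (by rw [h0, ← h.a_eq]; exact hc)
    omega
  | succ T ih =>
    intro S k r h hk hw hr hT
    rw [Function.iterate_succ_apply]
    by_cases c1 : S.a ≤ 0
    · rw [payStep_done _ _ _ c1, Function.iterate_fixed (payStep_done _ _ _ c1)]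
      exact c1
    have hhi := h.lo_nonneg.trans h.lo_le
    have hinv := h.step hy h0
    push Not at c1
    have hrpos : 0 < r := by
      have := hN.lt 0 S.hi le_rfl hhi (by rw [h0, ← h.a_eq]; exact c1)
      omega
    by_cases c2 : S.hi - S.lo ≤ ε
    · have e : payStep ε y S = ⟨S.paid + (S.a - S.ylo) * S.hi, S.ylo, S.lo, 0, 0⟩ := by
        rw [payStep, if_neg (not_le.2 c1), if_pos c2]
      have hlt := hN.lt S.lo S.hi h.lo_nonneg h.lo_le (by rw [← h.a_eq, ← h.ylo_eq]; exact h.ylo_lt c1)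
      obtain ⟨r, rfl⟩ : ∃ r', r = r' + 1 := ⟨r - 1, by omega⟩
      refine ih _ β r hinv le_rfl ?_ ?_ ?_
      · rw [e]; simp only [sub_zero]
        exact (h.lo_le.trans h.hi_le).trans hβ
      · rw [e]; simp only; omega
      · rw [Nat.succ_mul] at hT; omega
    · obtain ⟨k, rfl⟩ : ∃ k', k = k' + 1 := by
        rcases k with _ | k
        · simp only [pow_zero, one_mul] at hw; exact absurd hw c2
        · exact ⟨k, rfl⟩
      rw [pow_succ] at hw
      have hl := h.lo_le
      refine ih _ k r hinv (by omega) ?_ ?_ (by omega)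
      · rw [payStep, if_neg (not_le.2 c1), if_neg c2]
        split_ifs <;> simp only <;> linarith
      · refine (hN.mono _ _ (hinv.lo_nonneg.trans hinv.lo_le) ?_).trans hr
        rw [payStep, if_neg (not_le.2 c1), if_neg c2]
        split_ifs <;> simp only <;> linarith

/-- The payment at report `V` after `T` rounds. -/
def pay (ε : ℝ) (y : ℝ → ℝ) (T : ℕ) (V : ℝ) : ℝ := ((payStep ε y)^[T] (payInit y V)).paid

theorem payIterate_inv {ε : ℝ} {y : ℝ → ℝ} (hy : MonotoneOn y (Set.Ici 0)) (h0 : y 0 = 0) {V : ℝ}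
    (hV : 0 ≤ V) (T : ℕ) : PayInv ε y V ((payStep ε y)^[T] (payInit y V)) := by
  induction T with
  | zero => exact payInit_inv h0 hV
  | succ T ih => rw [Function.iterate_succ_apply']; exact ih.step hy h0

/-- The computed payment exceeds the exact payment by at most `ε`, never exceeds the reported value
of the clicks, and never falls below the exact payment. -/
theorem pay_spec {ε : ℝ} {y : ℝ → ℝ} (hy : MonotoneOn y (Set.Ici 0)) (h0 : y 0 = 0) {V : ℝ}
    (hV : 0 ≤ V) {T : ℕ} (hT : ((payStep ε y)^[T] (payInit y V)).a ≤ 0) :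
    0 ≤ pay ε y T V ∧ pay ε y T V ≤ V * y V ∧ exactPayment y V ≤ pay ε y T V ∧
      pay ε y T V ≤ exactPayment y V + ε * y V := by
  have h := payIterate_inv (ε := ε) hy h0 hV T
  unfold pay
  set S := (payStep ε y)^[T] (payInit y V)
  have hhi := h.lo_nonneg.trans h.lo_le
  have hmono : y 0 ≤ y S.hi := hy (le_refl (0 : ℝ)) hhi hhi
  have ha : S.a = 0 := le_antisymm hT (by rw [h.a_eq, ← h0]; exact hmono)
  have hd := exactPayment_sub_mem hy (le_refl (0 : ℝ)) hhi
  rw [← h.a_eq, ha, h0, exactPayment_zero] at hd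
  have h8 := h.paid_le
  have h9 := h.lower
  have h10 := h.upper
  rw [ha] at h8 h10
  simp only [sub_self, zero_mul] at hd
  refine ⟨h.paid_nonneg, ?_, ?_, ?_⟩ <;> linarith

namespace Market

variable {E : Market}

/-! ### The click probability as a function of one report -/

/-- The scores `g i (R i)` of the reports `R`. -/
def scores (g : ℕ → ℝ → ℝ) (R : ℕ → ℝ) (i : ℕ) : ℝ := g i (R i)

/-- The click probability of advertiser `i` as a function of its report. -/
def curve (E : Market) (g : ℕ → ℝ → ℝ) (R : ℕ → ℝ) (i : ℕ) (x : ℝ) : ℝ :=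
  E.clicks (scores g (Function.update R i x)) i

/-- A score function under which the mechanism is well behaved: positive scores do not decrease with
the report, and the report `0` has no positive score. -/
structure IsScore (g : ℕ → ℝ → ℝ) : Prop where
  measurable : ∀ i, Measurable (g i)
  zero : ∀ i, g i 0 ≤ 0
  mono : ∀ i x x', 0 ≤ x → x ≤ x' → 0 < g i x → g i x ≤ g i x'

theorem curve_update (g : ℕ → ℝ → ℝ) (R : ℕ → ℝ) (i : ℕ) (x : ℝ) :
    E.curve g (Function.update R i x) i = E.curve g R i := by
  funext z; simp [curve]

theorem curve_self (g : ℕ → ℝ → ℝ) (R : ℕ → ℝ) (i : ℕ) :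
    E.curve g R i (R i) = E.clicks (scores g R) i := by
  simp [curve]

theorem rate_eq_zero {s : ℕ → ℝ} {b : ℕ} {S : GState} (hp : ∀ i j, 0 ≤ E.p i j) (h : Valid E s b S)
    {i : ℕ} (hs : s i ≤ 0) : S.rate E.p i = 0 := by
  unfold GState.rate
  split_ifs with h0
  · rfl
  · exfalso
    have := h.weight i (S.pos i - 1) (by omega)
    have h2 := mul_nonpos_of_nonpos_of_nonneg hs (hp i (S.pos i - 1))
    linarith

theorem clicks_eq_zero (hp : ∀ i j, 0 ≤ E.p i j) {s : ℕ → ℝ} {i : ℕ} (hs : s i ≤ 0) :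
    E.clicks s i = 0 := by
  refine Finset.sum_eq_zero fun a _ => ?_
  rw [rate_eq_zero hp (bucket_dual E s a).valid hs, zero_div]

theorem clicks_nonneg (hp : ∀ i j, 0 ≤ E.p i j) (s : ℕ → ℝ) (i : ℕ) : 0 ≤ E.clicks s i :=
  Finset.sum_nonneg fun a _ => div_nonneg (rate_nonneg hp _ _) (by positivity)

theorem clicks_le_one (hp : ∀ i j, E.p i j ≤ 1) (s : ℕ → ℝ) (i : ℕ) : E.clicks s i ≤ 1 := by
  have hB := E.buckets_pos
  have h1 : ∀ a ∈ Finset.range E.buckets, (E.bucket s a).rate E.p i / (2 * E.buckets) ≤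
      1 / (2 * E.buckets) := by
    intro a _
    refine div_le_div_of_nonneg_right ?_ (by positivity)
    unfold GState.rate
    split_ifs
    · exact zero_le_one
    · exact hp _ _
  refine (Finset.sum_le_sum h1).trans ?_
  rw [Finset.sum_const, Finset.card_range, nsmul_eq_mul, mul_one_div, div_le_one (by positivity)]
  linarith

theorem bucket_rate_mono (hp : ∀ i j, 0 ≤ E.p i j) {g : ℕ → ℝ → ℝ} (hg : IsScore g) (R : ℕ → ℝ)
    (i a : ℕ) {x x' : ℝ} (hx : 0 ≤ x) (h : x ≤ x') :
    (E.bucket (scores g (Function.update R i x)) a).rate E.p i ≤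
      (E.bucket (scores g (Function.update R i x')) a).rate E.p i := by
  refine greedy_rate_mono hp (fun k hk => ?_) (fun h0 => ?_) _ _
  · simp [scores, Function.update_of_ne hk]
  · simp only [scores, Function.update_self] at h0 ⊢
    exact hg.mono i x x' hx h h0

theorem curve_monotoneOn (hp : ∀ i j, 0 ≤ E.p i j) {g : ℕ → ℝ → ℝ} (hg : IsScore g) (R : ℕ → ℝ)
    (i : ℕ) : MonotoneOn (E.curve g R i) (Set.Ici 0) := by
  intro x hx x' _ h
  simp only [curve, clicks]
  refine Finset.sum_le_sum fun a _ => div_le_div_of_nonneg_right ?_ (by positivity)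
  exact bucket_rate_mono hp hg R i a hx h

theorem curve_zero (hp : ∀ i j, 0 ≤ E.p i j) {g : ℕ → ℝ → ℝ} (hg : IsScore g) (R : ℕ → ℝ)
    (i : ℕ) : E.curve g R i 0 = 0 :=
  clicks_eq_zero hp (by simpa [scores] using hg.zero i)

/-- The number of pairs of a bucket and a position of positive rate for `i` that is no better for `i`
than its position in this bucket, at report `x`. -/
def rank (E : Market) (g : ℕ → ℝ → ℝ) (R : ℕ → ℝ) (i : ℕ) (x : ℝ) : ℕ :=
  ∑ a ∈ Finset.range E.buckets, ((Finset.range E.m).filter fun j => 0 < E.p i j ∧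
    E.p i j ≤ (E.bucket (scores g (Function.update R i x)) a).rate E.p i).card

theorem rank_le (g : ℕ → ℝ → ℝ) (R : ℕ → ℝ) (i : ℕ) (x : ℝ) :
    E.rank g R i x ≤ E.buckets * E.m := by
  refine (Finset.sum_le_card_nsmul _ _ E.m fun a _ => ?_).trans (by simp)
  exact (Finset.card_filter_le _ _).trans (by simp)

theorem isRank (hp : ∀ i j, 0 ≤ E.p i j) {g : ℕ → ℝ → ℝ} (hg : IsScore g) (R : ℕ → ℝ)
    (i : ℕ) : IsRank (E.curve g R i) (E.rank g R i) := by
  have hmono : ∀ x x', 0 ≤ x → x ≤ x' → ∀ a,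
      (Finset.range E.m).filter (fun j => 0 < E.p i j ∧
        E.p i j ≤ (E.bucket (scores g (Function.update R i x)) a).rate E.p i) ⊆
      (Finset.range E.m).filter (fun j => 0 < E.p i j ∧
        E.p i j ≤ (E.bucket (scores g (Function.update R i x')) a).rate E.p i) := by
    intro x x' hx h a j hj
    simp only [Finset.mem_filter] at hj ⊢
    exact ⟨hj.1, hj.2.1, hj.2.2.trans (bucket_rate_mono hp hg R i a hx h)⟩
  refine ⟨fun x x' hx h => Finset.sum_le_sum fun a _ => Finset.card_le_card (hmono x x' hx h a),
    fun x x' hx h hlt => ?_⟩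
  obtain ⟨a, ha, hr⟩ : ∃ a ∈ Finset.range E.buckets,
      (E.bucket (scores g (Function.update R i x)) a).rate E.p i / (2 * E.buckets) <
      (E.bucket (scores g (Function.update R i x')) a).rate E.p i / (2 * E.buckets) :=
    Finset.exists_lt_of_sum_lt hlt
  have hB := E.buckets_pos
  rw [div_lt_div_iff_of_pos_right (by positivity)] at hr
  refine Finset.sum_lt_sum (fun a _ => Finset.card_le_card (hmono x x' hx h a)) ⟨a, ha, ?_⟩
  refine Finset.card_lt_card ((Finset.ssubset_iff_of_subset (hmono x x' hx h a)).2 ?_)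
  have hv := (bucket_dual E (scores g (Function.update R i x')) a).valid
  set S := E.bucket (scores g (Function.update R i x')) a
  have h0 := rate_nonneg hp (E.bucket (scores g (Function.update R i x)) a) i
  have hr' : S.rate E.p i = if S.pos i = 0 then 0 else E.p i (S.pos i - 1) := rfl
  have hne : S.pos i ≠ 0 := by
    intro hc
    rw [hr', if_pos hc] at hr
    linarith
  rw [if_neg hne] at hr'
  refine ⟨S.pos i - 1, ?_, ?_⟩
  · simp only [Finset.mem_filter, Finset.mem_range]
    refine ⟨hv.asg_lt _ ?_, by linarith, hr'.ge⟩
    have : S.asg (S.pos i - 1) = i + 1 := by rw [hv.iff]; omega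
    omega
  · simp only [Finset.mem_filter, not_and, not_le]
    intro _ _
    linarith

/-- The number of rounds after which the payment computation at report `V` has ended. -/
def rounds (E : Market) (ε V : ℝ) : ℕ := (E.buckets * E.m + 1) * (Nat.size ⌈V / ε⌉₊ + 1)

/-- The payment of advertiser `i` at reports `R`. -/
def payment (E : Market) (g : ℕ → ℝ → ℝ) (ε : ℝ) (R : ℕ → ℝ) (i : ℕ) : ℝ :=
  pay ε (E.curve g R i) (E.rounds ε (R i)) (R i)

theorem pay_rounds_done (hp : ∀ i j, 0 ≤ E.p i j) {g : ℕ → ℝ → ℝ} (hg : IsScore g) {ε : ℝ}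
    (hε : 0 < ε) (R : ℕ → ℝ) (i : ℕ) (hR : 0 ≤ R i) :
    ((payStep ε (E.curve g R i))^[E.rounds ε (R i)] (payInit (E.curve g R i) (R i))).a ≤ 0 := by
  have hβ : R i ≤ 2 ^ Nat.size ⌈R i / ε⌉₊ * ε := by
    rw [← div_le_iff₀ hε]
    refine (Nat.le_ceil _).trans ?_
    have := (Nat.lt_size_self ⌈R i / ε⌉₊).le
    exact_mod_cast this
  refine payStep_terminates (curve_monotoneOn hp hg R i) (curve_zero hp hg R i)
    (isRank hp hg R i) hβ _ _ (Nat.size ⌈R i / ε⌉₊) (E.buckets * E.m)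
    (payInit_inv (curve_zero hp hg R i) hR) le_rfl (by simpa [payInit] using hβ) (rank_le _ _ _ _) ?_
  unfold rounds
  rw [Nat.succ_mul]
  omega

theorem payment_spec (hp : ∀ i j, 0 ≤ E.p i j) {g : ℕ → ℝ → ℝ} (hg : IsScore g) {ε : ℝ}
    (hε : 0 < ε) (R : ℕ → ℝ) (i : ℕ) (hR : 0 ≤ R i) :
    0 ≤ E.payment g ε R i ∧ E.payment g ε R i ≤ R i * E.clicks (scores g R) i ∧
      exactPayment (E.curve g R i) (R i) ≤ E.payment g ε R i ∧
      E.payment g ε R i ≤ exactPayment (E.curve g R i) (R i) + ε * E.clicks (scores g R) i := by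
  rw [← curve_self]
  exact pay_spec (curve_monotoneOn hp hg R i) (curve_zero hp hg R i) hR
    (pay_rounds_done hp hg hε R i hR)

/-! ### Measurability -/

/-- A property of random states that the steps preserve, such as measurability, holds after the fold. -/
theorem forFold_family {Ω α : Type*} (Q : (Ω → α) → Prop) {f : Ω → ℕ → α → α} {x : Ω → α} (k : ℕ)
    (h0 : Q x) (hs : ∀ t y, Q y → Q fun ω => f ω t (y ω)) : Q fun ω => forFold (f ω) k (x ω) := by
  induction k with
  | zero => exact h0
  | succ k ih => exact hs k _ ih

section Measurability

variable {Ω : Type*} [MeasurableSpace Ω]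

/-- Both arrays of a random matching are measurable. -/
structure MeasurableState (S : Ω → GState) : Prop where
  asg : ∀ j, Measurable fun ω => (S ω).asg j
  pos : ∀ i, Measurable fun ω => (S ω).pos i

theorem measurableSet_nat_eq {f : Ω → ℕ} (hf : Measurable f) (k : ℕ) : MeasurableSet {ω | f ω = k} :=
  hf (measurableSet_singleton k)

theorem measurable_best {s : Ω → ℕ → ℝ} (hs : ∀ i, Measurable fun ω => s ω i) (b : ℕ)
    {S : Ω → GState} (hS : MeasurableState S) : Measurable fun ω => E.best (s ω) b (S ω) := by
  refine forFold_family Measurable E.n measurable_const fun i y hy => ?_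
  refine forFold_family Measurable E.m hy fun j y hy => ?_
  unfold better
  refine Measurable.ite ?_ (((hs i).mul_const _).prodMk measurable_const) hy
  refine MeasurableSet.inter ?_ (measurableSet_lt hy.fst ((hs i).mul_const _))
  exact (measurableSet_nat_eq (hS.pos i) 0).inter ((measurableSet_nat_eq (hS.asg j) 0).inter
    (MeasurableSet.const _))

theorem MeasurableState.greedyStep {s : Ω → ℕ → ℝ} (hs : ∀ i, Measurable fun ω => s ω i) (b : ℕ)
    {S : Ω → GState} (hS : MeasurableState S) :
    MeasurableState fun ω => E.greedyStep (s ω) b (S ω) := by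
  have hb := measurable_best (E := E) hs b hS
  have hpos : MeasurableSet {ω | 0 < (E.best (s ω) b (S ω)).1} :=
    measurableSet_lt measurable_const hb.fst
  constructor
  · intro j
    have : (fun ω => (E.greedyStep (s ω) b (S ω)).asg j) = fun ω =>
        if 0 < (E.best (s ω) b (S ω)).1 then (if (E.best (s ω) b (S ω)).2.2 = j then
          (E.best (s ω) b (S ω)).2.1 + 1 else (S ω).asg j) else (S ω).asg j := by
      funext ω
      unfold Market.greedyStep
      split_ifs with h1 h2 <;> simp_all [GState.insert, eq_comm]
    rw [this]
    exact Measurable.ite hpos (Measurable.ite (measurableSet_nat_eq hb.snd.snd j)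
      (hb.snd.fst.add_const 1) (hS.asg j)) (hS.asg j)
  · intro i
    have : (fun ω => (E.greedyStep (s ω) b (S ω)).pos i) = fun ω =>
        if 0 < (E.best (s ω) b (S ω)).1 then (if (E.best (s ω) b (S ω)).2.1 = i then
          (E.best (s ω) b (S ω)).2.2 + 1 else (S ω).pos i) else (S ω).pos i := by
      funext ω
      unfold Market.greedyStep
      split_ifs with h1 h2 <;> simp_all [GState.insert, eq_comm]
    rw [this]
    exact Measurable.ite hpos (Measurable.ite (measurableSet_nat_eq hb.snd.fst i)
      (hb.snd.snd.add_const 1) (hS.pos i)) (hS.pos i)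

theorem measurableState_bucket {s : Ω → ℕ → ℝ} (hs : ∀ i, Measurable fun ω => s ω i) (a : ℕ) :
    MeasurableState fun ω => E.bucket (s ω) a := by
  refine forFold_family MeasurableState E.K ⟨fun _ => measurable_const, fun _ => measurable_const⟩
    fun c S hS => ?_
  split_ifs
  · exact hS.greedyStep hs _
  · exact hS

theorem MeasurableState.rate {S : Ω → GState} (hS : MeasurableState S) (p : ℕ → ℕ → ℝ) (i : ℕ) :
    Measurable fun ω => (S ω).rate p i :=
  (measurable_from_nat (f := fun k => if k = 0 then 0 else p i (k - 1))).comp (hS.pos i)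

theorem MeasurableState.posRate {S : Ω → GState} (hS : MeasurableState S) (p : ℕ → ℕ → ℝ) (j : ℕ) :
    Measurable fun ω => (S ω).posRate p j :=
  (measurable_from_nat (f := fun k => if k = 0 then 0 else p (k - 1) j)).comp (hS.asg j)

theorem measurable_clicks {s : Ω → ℕ → ℝ} (hs : ∀ i, Measurable fun ω => s ω i) (i : ℕ) :
    Measurable fun ω => E.clicks (s ω) i :=
  Finset.measurable_sum _ fun a _ => ((measurableState_bucket hs a).rate E.p i).div_const _

theorem measurable_bucketWeight {s : Ω → ℕ → ℝ} (hs : ∀ i, Measurable fun ω => s ω i) (a k : ℕ) :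
    Measurable fun ω => E.bucketWeight (s ω) a k := by
  unfold bucketWeight
  refine Measurable.div_const ?_ _
  split_ifs
  · exact measurable_const
  · exact (measurableState_bucket hs a).posRate _ _

theorem measurable_weight {s : Ω → ℕ → ℝ} (hs : ∀ i, Measurable fun ω => s ω i) (l : ℕ) :
    Measurable fun ω => E.weight (s ω) l := by
  cases l with
  | zero =>
    exact measurable_const.sub (Finset.measurable_sum _ fun l _ => measurable_bucketWeight hs _ _)
  | succ l => exact measurable_bucketWeight hs _ _

theorem measurable_entry {s : Ω → ℕ → ℝ} (hs : ∀ i, Measurable fun ω => s ω i) (l j : ℕ) :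
    Measurable fun ω => E.entry (s ω) l j := by
  cases l with
  | zero => exact measurable_const
  | succ l =>
    simp only [entry]
    split_ifs
    · exact (measurableState_bucket hs _).asg j
    · exact measurable_const

theorem measurableSet_augAlloc {s : Ω → ℕ → ℝ} (hs : ∀ i, Measurable fun ω => s ω i) (l : ℕ)
    (χ : AugAlloc E.n E.m E.K) : MeasurableSet {ω | E.augAlloc (s ω) l = χ} := by
  have : {ω | E.augAlloc (s ω) l = χ} = {_ω : Ω | (1 : Equiv.Perm (Fin E.m)) = χ.2} ∩
      ⋂ i : Fin E.n, ⋂ j : Fin E.m, {ω | (fun k : ℕ => if k = (i : ℕ) + 1 then (1 : Fin 2) else 0)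
        (E.entry (s ω) l j) = χ.1.1 i j} := by
    ext ω
    simp only [augAlloc, Prod.ext_iff, Subtype.ext_iff, funext_iff, Set.mem_inter_iff,
      Set.mem_iInter, Set.mem_ofPred_eq]
    tauto
  rw [this]
  refine (MeasurableSet.const _).inter (MeasurableSet.iInter fun i => MeasurableSet.iInter fun j => ?_)
  exact (measurable_entry hs l j) (MeasurableSet.of_discrete
    (s := {k : ℕ | (if k = (i : ℕ) + 1 then (1 : Fin 2) else 0) = χ.1.1 i j}))

theorem measurable_scores {g : ℕ → ℝ → ℝ} (hg : IsScore g) {R : Ω → ℕ → ℝ}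
    (hR : ∀ i, Measurable fun ω => R ω i) (i : ℕ) : Measurable fun ω => scores g (R ω) i :=
  (hg.measurable i).comp (hR i)

theorem measurable_curve {g : ℕ → ℝ → ℝ} (hg : IsScore g) {R : Ω → ℕ → ℝ}
    (hR : ∀ i, Measurable fun ω => R ω i) (i : ℕ) {x : Ω → ℝ} (hx : Measurable x) :
    Measurable fun ω => E.curve g (R ω) i (x ω) := by
  refine measurable_clicks (fun k => measurable_scores hg (fun k => ?_) k) i
  simp only [Function.update_apply]
  split_ifs
  · exact hx
  · exact hR k

/-- All components of a random payment state are measurable. -/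
structure MeasurablePay (S : Ω → PayState) : Prop where
  paid : Measurable fun ω => (S ω).paid
  a : Measurable fun ω => (S ω).a
  hi : Measurable fun ω => (S ω).hi
  lo : Measurable fun ω => (S ω).lo
  ylo : Measurable fun ω => (S ω).ylo

theorem MeasurablePay.ite {c : Ω → Prop} [DecidablePred c] (hc : MeasurableSet {ω | c ω})
    {S S' : Ω → PayState} (h : MeasurablePay S) (h' : MeasurablePay S') :
    MeasurablePay fun ω => if c ω then S ω else S' ω := by
  constructor
  · simp only [apply_ite PayState.paid]; exact Measurable.ite hc h.paid h'.paid
  · simp only [apply_ite PayState.a]; exact Measurable.ite hc h.a h'.a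
  · simp only [apply_ite PayState.hi]; exact Measurable.ite hc h.hi h'.hi
  · simp only [apply_ite PayState.lo]; exact Measurable.ite hc h.lo h'.lo
  · simp only [apply_ite PayState.ylo]; exact Measurable.ite hc h.ylo h'.ylo

theorem MeasurablePay.step {ε : ℝ} {y : Ω → ℝ → ℝ}
    (hy : ∀ x : Ω → ℝ, Measurable x → Measurable fun ω => y ω (x ω)) {S : Ω → PayState}
    (h : MeasurablePay S) : MeasurablePay fun ω => payStep ε (y ω) (S ω) := by
  have hmid : Measurable fun ω => ((S ω).lo + (S ω).hi) / 2 := (h.lo.add h.hi).div_const 2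
  have hym := hy _ hmid
  unfold payStep
  refine MeasurablePay.ite (measurableSet_le h.a measurable_const) h ?_
  refine MeasurablePay.ite (measurableSet_le (h.hi.sub h.lo) measurable_const) ?_ ?_
  · exact ⟨h.paid.add ((h.a.sub h.ylo).mul h.hi), h.ylo, h.lo, measurable_const, measurable_const⟩
  refine MeasurablePay.ite (measurableSet_le h.a hym) ?_ ?_
  · exact ⟨h.paid, h.a, hmid, h.lo, h.ylo⟩
  · exact ⟨h.paid, h.a, h.hi, hmid, hym⟩

theorem MeasurablePay.iterate {ε : ℝ} {y : Ω → ℝ → ℝ}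
    (hy : ∀ x : Ω → ℝ, Measurable x → Measurable fun ω => y ω (x ω)) {S : Ω → PayState}
    (h : MeasurablePay S) (T : ℕ) : MeasurablePay fun ω => (payStep ε (y ω))^[T] (S ω) := by
  induction T with
  | zero => exact h
  | succ T ih => simp only [Function.iterate_succ_apply']; exact ih.step hy

theorem measurable_rounds {ε : ℝ} {x : Ω → ℝ} (hx : Measurable x) :
    Measurable fun ω => E.rounds ε (x ω) := by
  have hc : Measurable fun ω => ⌈x ω / ε⌉₊ := (hx.div_const ε).nat_ceil
  have hk : Measurable fun k : ℕ => (E.buckets * E.m + 1) * (Nat.size k + 1) := measurable_from_nat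
  exact hk.comp hc

theorem measurable_pay {ε : ℝ} {y : Ω → ℝ → ℝ}
    (hy : ∀ x : Ω → ℝ, Measurable x → Measurable fun ω => y ω (x ω)) {V : Ω → ℝ} (hV : Measurable V)
    {T : Ω → ℕ} (hT : Measurable T) : Measurable fun ω => pay ε (y ω) (T ω) (V ω) := by
  have h0 : MeasurablePay fun ω => payInit (y ω) (V ω) :=
    ⟨measurable_const, hy _ hV, hV, measurable_const, measurable_const⟩
  have h1 : ∀ t : ℕ, Measurable fun ω => pay ε (y ω) t (V ω) := fun t => (h0.iterate hy t).paid
  have h2 : Measurable fun z : ℕ × Ω => pay ε (y z.2) z.1 (V z.2) :=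
    measurable_from_prod_countable_right h1
  have h3 : Measurable fun ω => (T ω, ω) := hT.prodMk measurable_id
  exact h2.comp h3

theorem measurable_payment {g : ℕ → ℝ → ℝ} (hg : IsScore g) (ε : ℝ) {R : Ω → ℕ → ℝ}
    (hR : ∀ i, Measurable fun ω => R ω i) (i : ℕ) : Measurable fun ω => E.payment g ε (R ω) i :=
  measurable_pay (fun _ hx => measurable_curve hg hR i hx) (hR i) (measurable_rounds (hR i))

end Measurability

/-! ### The mechanism -/

/-- Reports as a sequence; negative reports are replaced by `0`. -/
def reports {n : ℕ} (v : Fin n → ℝ) (i : ℕ) : ℝ := if h : i < n then max (v ⟨i, h⟩) 0 else 0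

theorem reports_nonneg {n : ℕ} (v : Fin n → ℝ) (i : ℕ) : 0 ≤ reports v i := by
  unfold reports; split_ifs <;> simp

theorem reports_fin {n : ℕ} {v : Fin n → ℝ} (i : Fin n) (hv : 0 ≤ v i) : reports v i = v i := by
  simp [reports, hv]

theorem reports_update {n : ℕ} (v : Fin n → ℝ) (i : Fin n) {x : ℝ} (hx : 0 ≤ x) :
    reports (Function.update v i x) = Function.update (reports v) i x := by
  funext k
  by_cases hk : k = i
  · subst hk; simp [reports, hx]
  · rw [Function.update_of_ne hk]
    unfold reports
    split_ifs with h
    · rw [Function.update_of_ne]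
      rintro rfl
      exact hk rfl
    · rfl

theorem measurable_reports {n : ℕ} (i : ℕ) : Measurable fun v : Fin n → ℝ => reports v i := by
  unfold reports
  split_ifs
  · exact (measurable_pi_apply _).max measurable_const
  · exact measurable_const

open Classical in
/-- The auction for the scores `g`: the compensated lottery over a uniformly random bucket, with
payments computed by bisection up to `ε`. -/
def mech (E : Market) (hp : ∀ i j, 0 ≤ E.p i j) (g : ℕ → ℝ → ℝ) (hg : IsScore g) (ε : ℝ) (hε : 0 < ε) :
    Mechanism E.n E.m E.K where
  q v χ := ∑ l ∈ Finset.range E.len,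
    if E.augAlloc (scores g (reports v)) l = χ then E.weight (scores g (reports v)) l else 0
  t v i := E.payment g ε (reports v) i
  q_nonneg v χ := Finset.sum_nonneg fun l _ => by
    split_ifs
    exacts [weight_nonneg hp _ _, le_rfl]
  q_sum v := by
    rw [Finset.sum_comm]
    simp [sum_weight]
  t_nonneg v i := (payment_spec hp hg hε _ _ (reports_nonneg v i)).1
  q_measurable χ := by
    have hs := fun i => measurable_scores hg (fun i => measurable_reports (n := E.n) i) i
    exact Finset.measurable_sum _ fun l _ =>
      Measurable.ite (measurableSet_augAlloc hs l χ) (measurable_weight hs l) measurable_const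
  t_measurable i := measurable_payment hg ε (fun i => measurable_reports i) i

section Mechanism

variable (hp : ∀ i j, 0 ≤ E.p i j) {g : ℕ → ℝ → ℝ} (hg : IsScore g) {ε : ℝ} (hε : 0 < ε)
  {q : Fin E.n → Fin E.m → ℝ} (hq : ∀ i j, q i j = E.p i j)

include hq

theorem mech_clickProb (v : Fin E.n → ℝ) (i : Fin E.n) :
    (E.mech hp g hg ε hε).clickProb q v i = E.clicks (scores g (reports v)) i := by
  rw [← sum_weight_mul_ctr hq]
  simp only [Mechanism.clickProb, mech, Finset.sum_mul, ite_mul, zero_mul]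
  rw [Finset.sum_comm]
  simp

theorem mech_isIR : (E.mech hp g hg ε hε).IsIR q := by
  intro i r x _ hx
  rw [Mechanism.utility, mech_clickProb hp hg hε hq, sub_nonneg]
  have := (payment_spec hp hg hε (reports (Function.update r i x)) i (reports_nonneg _ _)).2.1
  rwa [reports_fin i (by simpa using hx), Function.update_self] at this

/-- The payment at the true value exceeds the exact one by at most `ε`, and that for a misreport is at
least the exact one, under which truth is optimal. -/
theorem mech_isEpsIC (hp1 : ∀ i j, E.p i j ≤ 1) : (E.mech hp g hg ε hε).IsEpsIC q ε := by
  intro i r x hr hx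
  simp only [Mechanism.utility, mech_clickProb hp hg hε hq]
  have h1 := (payment_spec hp hg hε (reports r) i (reports_nonneg _ _)).2.2.1
  have h2 := (payment_spec hp hg hε (reports (Function.update r i x)) i (reports_nonneg _ _)).2.2.2
  have h3 : ε * E.clicks (scores g (reports (Function.update r i x))) i ≤ ε :=
    mul_le_of_le_one_right hε.le (clicks_le_one hp1 _ _)
  have h4 := exactPayment_ic (curve_monotoneOn hp hg (reports r) i) (reports_nonneg r i) hx
  rw [curve_self] at h4
  rw [reports_update r i hx, Function.update_self, curve_update] at h2
  rw [reports_update r i hx] at h3 ⊢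
  have h5 : E.curve g (reports r) i x = E.clicks (scores g (Function.update (reports r) i x)) i := rfl
  rw [h5] at h4
  have h6 : (E.mech hp g hg ε hε).t r i = E.payment g ε (reports r) i := rfl
  have h7 : (E.mech hp g hg ε hε).t (Function.update r i x) i =
      E.payment g ε (Function.update (reports r) i x) i := by
    rw [← reports_update r i hx]; rfl
  rw [h6, h7]
  linarith

end Mechanism

end Market

/-! ### Incentive compatible mechanisms -/

theorem ctr_mem {n m K : ℕ} {p : Fin n → Fin m → ℝ} (hp : ∀ i j, 0 ≤ p i j ∧ p i j ≤ 1)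
    (χ : AugAlloc n m K) (i : Fin n) : 0 ≤ ctr p χ i ∧ ctr p χ i ≤ 1 := by
  have hu0 : ∀ j, 0 ≤ ∑ i', ((χ.1.1 i' j : ℕ) : ℝ) * p i' j := fun j =>
    Finset.sum_nonneg fun i _ => mul_nonneg (Nat.cast_nonneg _) (hp _ _).1
  have hu1 : ∀ j, ∑ i', ((χ.1.1 i' j : ℕ) : ℝ) * p i' j ≤ 1 := fun j => by
    have h := χ.1.2.2.1 j
    have h' : ∑ i', ((χ.1.1 i' j : ℕ) : ℝ) ≤ 1 := by exact_mod_cast h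
    exact (Finset.sum_le_sum fun i _ => mul_le_of_le_one_right (Nat.cast_nonneg _) (hp _ _).2).trans h'
  have hD : ∀ j, 0 ≤ ∏ j' ∈ Finset.univ.filter (fun j' => χ.2 j' < χ.2 j),
      (1 - ∑ i', ((χ.1.1 i' j' : ℕ) : ℝ) * p i' j') ∧
      ∏ j' ∈ Finset.univ.filter (fun j' => χ.2 j' < χ.2 j),
      (1 - ∑ i', ((χ.1.1 i' j' : ℕ) : ℝ) * p i' j') ≤ 1 := fun j =>
    ⟨Finset.prod_nonneg fun k _ => by linarith [hu1 k],
      Finset.prod_le_one (fun k _ => by linarith [hu1 k]) fun k _ => by linarith [hu0 k]⟩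
  refine ⟨Finset.sum_nonneg fun j _ => mul_nonneg (mul_nonneg (Nat.cast_nonneg _) (hp _ _).1) (hD j).1, ?_⟩
  have h := χ.1.2.1 i
  have h' : ∑ j, ((χ.1.1 i j : ℕ) : ℝ) ≤ 1 := by exact_mod_cast h
  refine (Finset.sum_le_sum fun j _ => ?_).trans h'
  exact (mul_le_of_le_one_right (mul_nonneg (Nat.cast_nonneg _) (hp _ _).1) (hD j).2).trans
    (mul_le_of_le_one_right (Nat.cast_nonneg _) (hp _ _).2)

namespace Mechanism

variable {n m K : ℕ} (M : Mechanism n m K) {p : Fin n → Fin m → ℝ}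

theorem clickProb_mem (hp : ∀ i j, 0 ≤ p i j ∧ p i j ≤ 1) (v : Fin n → ℝ) (i : Fin n) :
    0 ≤ M.clickProb p v i ∧ M.clickProb p v i ≤ 1 := by
  refine ⟨Finset.sum_nonneg fun χ _ => mul_nonneg (M.q_nonneg v χ) (ctr_mem hp χ i).1, ?_⟩
  refine (Finset.sum_le_sum fun χ _ => mul_le_of_le_one_right (M.q_nonneg v χ)
    (ctr_mem hp χ i).2).trans (M.q_sum v).le

theorem measurable_clickProb (p : Fin n → Fin m → ℝ) (i : Fin n) :
    Measurable fun v => M.clickProb p v i :=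
  Finset.measurable_sum _ fun χ _ => (M.q_measurable χ).mul_const _

/-- A bound on every scored augmented allocation bounds every scored lottery. -/
theorem sum_score_clickProb_le {s : Fin n → ℝ} {b : ℝ}
    (h : ∀ χ : AugAlloc n m K, ∑ i, s i * ctr p χ i ≤ b) (v : Fin n → ℝ) :
    ∑ i, s i * M.clickProb p v i ≤ b := by
  calc ∑ i, s i * M.clickProb p v i = ∑ χ, M.q v χ * ∑ i, s i * ctr p χ i := by
        simp only [clickProb, Finset.mul_sum]
        rw [Finset.sum_comm]
        exact Finset.sum_congr rfl fun χ _ => Finset.sum_congr rfl fun i _ => by ring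
    _ ≤ ∑ χ, M.q v χ * b :=
        Finset.sum_le_sum fun χ _ => mul_le_mul_of_nonneg_left (h χ) (M.q_nonneg v χ)
    _ = b := by rw [← Finset.sum_mul, M.q_sum, one_mul]

end Mechanism

/-- If payments `t` make the allocation `y` incentive compatible and charge nothing at `0`, they are
at most the exact payments: over `[a, b]` both change by `(y b - y a)` times a number in `[a, b]`,
so that the errors over a fine partition sum up to almost nothing. -/
theorem payment_le_exactPayment {y t : ℝ → ℝ}
    (hic : ∀ z x, 0 ≤ z → 0 ≤ x → x * y z - t z ≤ x * y x - t x) (h0 : t 0 ≤ 0) :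
    MonotoneOn y (Set.Ici 0) ∧ ∀ x, 0 ≤ x → t x ≤ exactPayment y x := by
  have hy : MonotoneOn y (Set.Ici 0) := by
    intro a ha b hb hab
    rcases hab.eq_or_lt with rfl | hlt
    · exact le_rfl
    have h1 := hic a b ha hb
    have h2 := hic b a hb ha
    nlinarith
  refine ⟨hy, fun x hx => ?_⟩
  have hd : ∀ a b, 0 ≤ a → a ≤ b → (t b - exactPayment y b) - (t a - exactPayment y a) ≤
      (b - a) * (y b - y a) := by
    intro a b ha hab
    have h1 := hic a b ha (ha.trans hab)
    have h2 := (exactPayment_sub_mem hy ha hab).1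
    nlinarith
  have key : ∀ N : ℕ, t x - exactPayment y x ≤ x * (y x - y 0) / (N + 1) := by
    intro N
    have hN : (0 : ℝ) < N + 1 := by positivity
    have hk : ∀ k : ℕ, t (k * (x / (N + 1))) - exactPayment y (k * (x / (N + 1))) ≤
        x / (N + 1) * (y (k * (x / (N + 1))) - y 0) := by
      intro k
      induction k with
      | zero => simpa [exactPayment_zero] using h0
      | succ k ih =>
        have h3 : (0 : ℝ) ≤ k * (x / (N + 1)) := by positivity
        have h4 : (k : ℝ) * (x / (N + 1)) ≤ ((k + 1 : ℕ) : ℝ) * (x / (N + 1)) :=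
          mul_le_mul_of_nonneg_right (by push_cast; linarith) (by positivity)
        have h5 := hd _ _ h3 h4
        have h6 : ((k + 1 : ℕ) : ℝ) * (x / (N + 1)) - k * (x / (N + 1)) = x / (N + 1) := by
          push_cast; ring
        rw [h6] at h5
        linarith
    have h7 := hk (N + 1)
    have h8 : ((N + 1 : ℕ) : ℝ) * (x / (N + 1)) = x := by push_cast; field_simp
    rw [h8] at h7
    calc _ ≤ _ := h7
      _ = _ := by ring
  have hlim : Filter.Tendsto (fun N : ℕ => x * (y x - y 0) / ((N : ℝ) + 1)) Filter.atTop (nhds 0) :=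
    Filter.Tendsto.div_atTop tendsto_const_nhds
      (Filter.tendsto_atTop_add_const_right _ _ tendsto_natCast_atTop_atTop)
  have := ge_of_tendsto' hlim key
  linarith

/-- Incentive compatibility forces monotone click probabilities and bounds the payments by the exact
ones. -/
theorem Mechanism.payment_le {n m K : ℕ} {M : Mechanism n m K} {p : Fin n → Fin m → ℝ}
    (hic : M.IsIC p) (hir : M.IsIR p) (i : Fin n) {r : Fin n → ℝ} (hr : ∀ k, 0 ≤ r k) :
    MonotoneOn (fun x => M.clickProb p (Function.update r i x) i) (Set.Ici 0) ∧
    ∀ x, 0 ≤ x → M.t (Function.update r i x) i ≤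
      exactPayment (fun x => M.clickProb p (Function.update r i x) i) x := by
  refine payment_le_exactPayment (t := fun x => M.t (Function.update r i x) i) (fun z x hz hx => ?_) ?_
  · have hr' : ∀ k, 0 ≤ Function.update r i z k := by
      intro k
      rw [Function.update_apply]
      split_ifs
      exacts [hz, hr k]
    have := hic i (Function.update r i z) x hr' hx
    simpa [Mechanism.utility] using this
  · have := hir i r 0 hr le_rfl
    simpa [Mechanism.utility] using this

/-! ### Virtual values -/

namespace ValueDist

variable (D : ValueDist)

instance : IsProbabilityMeasure D.law :=
  ⟨by rw [law, withDensity_apply _ MeasurableSet.univ, setLIntegral_univ]; exact D.lintegral_pdf⟩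

theorem measurable_ofReal_pdf : Measurable fun x => ENNReal.ofReal (D.pdf x) :=
  D.pdf_measurable.ennreal_ofReal

theorem law_absolutelyContinuous : D.law ≪ volume := withDensity_absolutelyContinuous _ _

theorem integral_law (h : ℝ → ℝ) : ∫ x, h x ∂D.law = ∫ x, D.pdf x * h x := by
  rw [law, integral_withDensity_eq_integral_toReal_smul D.measurable_ofReal_pdf
    (Filter.Eventually.of_forall fun _ => ENNReal.ofReal_lt_top)]
  simp [ENNReal.toReal_ofReal (D.pdf_nonneg _)]

theorem integrable_law_iff (h : ℝ → ℝ) :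
    Integrable h D.law ↔ Integrable (fun x => D.pdf x * h x) volume := by
  rw [law, integrable_withDensity_iff_integrable_smul' D.measurable_ofReal_pdf
    (Filter.Eventually.of_forall fun _ => ENNReal.ofReal_lt_top)]
  simp [ENNReal.toReal_ofReal (D.pdf_nonneg _)]

theorem ae_pos_pdf : ∀ᵐ x ∂D.law, 0 < D.pdf x := by
  rw [law, ae_withDensity_iff D.measurable_ofReal_pdf]
  refine Filter.Eventually.of_forall fun x hx => ?_
  simpa using hx

theorem ae_nonneg : ∀ᵐ x ∂D.law, 0 ≤ x := by
  filter_upwards [D.ae_pos_pdf] with x hx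
  by_contra h
  rw [D.pdf_of_neg x (not_le.1 h)] at hx
  exact lt_irrefl _ hx

theorem one_sub_cdf (x : ℝ) : 1 - D.cdf x = D.law.real (Set.Ioi x) := by
  rw [cdf, ← Set.compl_Iic, measureReal_compl measurableSet_Iic]
  simp

theorem cdf_nonneg (x : ℝ) : 0 ≤ D.cdf x := measureReal_nonneg

theorem cdf_le_one (x : ℝ) : D.cdf x ≤ 1 := by
  have := D.one_sub_cdf x
  have h2 : 0 ≤ D.law.real (Set.Ioi x) := measureReal_nonneg
  linarith

theorem cdf_mono : Monotone D.cdf := fun _ _ h => measureReal_mono (Set.Iic_subset_Iic.2 h)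

theorem measurable_cdf : Measurable D.cdf := D.cdf_mono.measurable

theorem measurable_virtualValue : Measurable D.virtualValue :=
  measurable_id.sub ((measurable_const.sub D.measurable_cdf).div D.pdf_measurable)

variable {D}

/-- The layer formula `∫ (∫₀ˣ y) dF(x) = ∫₀^∞ y (1 - F)`. -/
theorem integral_primitive (hD : D.HasFiniteMean) {y : ℝ → ℝ} (hy : Monotone y) (h0 : ∀ x, 0 ≤ y x)
    (h1 : ∀ x, y x ≤ 1) :
    Integrable (fun x => ∫ z in (0 : ℝ)..x, y z) D.law ∧
    Integrable (fun z => (Set.Ioi (0 : ℝ)).indicator (fun z => y z * (1 - D.cdf z)) z) volume ∧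
    ∫ x, (∫ z in (0 : ℝ)..x, y z) ∂D.law =
      ∫ z, (Set.Ioi (0 : ℝ)).indicator (fun z => y z * (1 - D.cdf z)) z := by
  -- Both sides are iterated integrals of `f`.
  let f : ℝ → ℝ → ℝ := fun x z => if 0 < z ∧ z < x then y z else 0
  have hfm : Measurable (Function.uncurry f) := by
    refine Measurable.ite ?_ (hy.measurable.comp measurable_snd) measurable_const
    exact (measurableSet_lt measurable_const measurable_snd).inter
      (measurableSet_lt measurable_snd measurable_fst)
  have hind : ∀ x, f x = (Set.Ioo 0 x).indicator y := by
    intro x; funext z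
    simp only [f, Set.indicator_apply, Set.mem_Ioo]
  have hii : ∀ a b, IntervalIntegrable y volume a b := fun a b => hy.intervalIntegrable
  have hfx : ∀ x, Integrable (f x) volume := by
    intro x
    rw [hind, integrable_indicator_iff measurableSet_Ioo]
    exact (hii 0 x).1.mono_set Set.Ioo_subset_Ioc_self
  have hin : ∀ x, 0 ≤ x → ∫ z, f x z = ∫ z in (0 : ℝ)..x, y z := by
    intro x hx
    rw [hind, integral_indicator measurableSet_Ioo, intervalIntegral.integral_of_le hx,
      integral_Ioc_eq_integral_Ioo]
  have hnorm : ∀ x z, ‖f x z‖ = f x z := by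
    intro x z
    rw [Real.norm_of_nonneg]
    simp only [f]
    split_ifs
    exacts [h0 z, le_rfl]
  have hae : (fun x => ∫ z, f x z) =ᵐ[D.law] fun x => ∫ z in (0 : ℝ)..x, y z := by
    filter_upwards [D.ae_nonneg] with x hx using hin x hx
  have hint : Integrable (Function.uncurry f) (D.law.prod volume) := by
    rw [integrable_prod_iff hfm.aestronglyMeasurable]
    refine ⟨Filter.Eventually.of_forall hfx, ?_⟩
    simp only [Function.uncurry, hnorm]
    refine Integrable.mono hD
      (hfm.stronglyMeasurable.integral_prod_right (ν := volume)).aestronglyMeasurable ?_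
    filter_upwards [D.ae_nonneg] with x hx
    simp only [hin x hx]
    rw [Real.norm_of_nonneg (intervalIntegral.integral_nonneg hx fun z _ => h0 z),
      Real.norm_of_nonneg hx]
    have := intervalIntegral.integral_mono_on hx (hii 0 x) (by simp) (g := fun _ => (1 : ℝ))
      fun z _ => h1 z
    simpa using this
  have hR : ∀ z, ∫ x, f x z ∂D.law =
      (Set.Ioi (0 : ℝ)).indicator (fun z => y z * (1 - D.cdf z)) z := by
    intro z
    by_cases hz : 0 < z
    · have : (fun x => f x z) = (Set.Ioi z).indicator fun _ => y z := by
        funext x; simp [f, hz, Set.indicator_apply]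
      rw [this, integral_indicator measurableSet_Ioi, setIntegral_const,
        Set.indicator_of_mem (Set.mem_Ioi.2 hz), one_sub_cdf, smul_eq_mul, mul_comm]
    · have : (fun x => f x z) = fun _ => 0 := by
        funext x; simp [f, hz]
      rw [this, Set.indicator_of_notMem (by simpa using hz)]
      simp
  refine ⟨hint.integral_prod_left.congr hae, ?_, ?_⟩
  · have := hint.integral_prod_right
    simpa only [Function.uncurry, hR] using this
  · rw [← integral_congr_ae hae, integral_integral_swap hint]
    simp only [hR]

theorem integrable_virtualValue (hD : D.HasFiniteMean) : Integrable D.virtualValue D.law := by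
  rw [integrable_law_iff]
  have h1 : Integrable (fun x => D.pdf x * x) volume := (D.integrable_law_iff _).1 hD
  have h2 := (integral_primitive hD (y := fun _ => 1) monotone_const (fun _ => zero_le_one)
    fun _ => le_rfl).2.1
  refine (h1.norm.add h2.norm).mono (D.pdf_measurable.mul D.measurable_virtualValue).aestronglyMeasurable
    ?_
  have hne : ∀ᵐ x : ℝ, x ≠ 0 := by
    simp [ae_iff]
  filter_upwards [hne] with x hx0
  simp only [Pi.add_apply]
  rw [Real.norm_of_nonneg (add_nonneg (norm_nonneg (D.pdf x * x)) (norm_nonneg _))]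
  rcases (D.pdf_nonneg x).eq_or_lt with h | h
  · rw [← h]; simp
  · have hx : 0 < x := by
      rcases lt_or_gt_of_ne hx0 with h' | h'
      · rw [D.pdf_of_neg x h'] at h; exact absurd h (lt_irrefl _)
      · exact h'
    rw [Set.indicator_of_mem (Set.mem_Ioi.2 hx)]
    have : D.pdf x * D.virtualValue x = D.pdf x * x - 1 * (1 - D.cdf x) := by
      rw [virtualValue]; field_simp
    rw [this]
    exact norm_sub_le _ _

/-- Expected exact payments are expected virtual values, up to a loss where the density vanishes and
`F < 1`: there `y (1 - F)` lowers the payments, but no virtual value accounts for it. -/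
theorem integral_exactPayment (hD : D.HasFiniteMean) {y : ℝ → ℝ} (hy : Monotone y) (h0 : ∀ x, 0 ≤ y x)
    (h1 : ∀ x, y x ≤ 1) :
    Integrable (exactPayment y) D.law ∧
    ∫ x, exactPayment y x ∂D.law ≤ ∫ x, D.virtualValue x * y x ∂D.law ∧
    ((∀ x, 0 < x → D.pdf x = 0 → y x * (1 - D.cdf x) = 0) →
      ∫ x, exactPayment y x ∂D.law = ∫ x, D.virtualValue x * y x ∂D.law) := by
  obtain ⟨i1, i2, i3⟩ := integral_primitive hD hy h0 h1
  have hb : ∀ᵐ x ∂D.law, ‖y x‖ ≤ 1 := Filter.Eventually.of_forall fun x => by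
    rw [Real.norm_of_nonneg (h0 x)]; exact h1 x
  have i4 : Integrable (fun x => x * y x) D.law :=
    Integrable.mul_bdd hD hy.measurable.aestronglyMeasurable hb
  have i5 : Integrable (fun x => D.virtualValue x * y x) D.law :=
    Integrable.mul_bdd (integrable_virtualValue hD) hy.measurable.aestronglyMeasurable hb
  have i6 : Integrable (exactPayment y) D.law := i4.sub i1
  have e1 : ∫ x, exactPayment y x ∂D.law = ∫ x, (D.pdf x * (x * y x) -
      (Set.Ioi (0 : ℝ)).indicator (fun z => y z * (1 - D.cdf z)) x) := by
    unfold exactPayment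
    rw [integral_sub i4 i1, i3, integral_law, ← integral_sub ((D.integrable_law_iff _).1 i4) i2]
  have hcmp : ∀ x, x ≠ 0 → (D.pdf x * (x * y x) -
      (Set.Ioi (0 : ℝ)).indicator (fun z => y z * (1 - D.cdf z)) x ≤ D.pdf x * (D.virtualValue x * y x)) ∧
      ((∀ x, 0 < x → D.pdf x = 0 → y x * (1 - D.cdf x) = 0) → D.pdf x * (x * y x) -
      (Set.Ioi (0 : ℝ)).indicator (fun z => y z * (1 - D.cdf z)) x = D.pdf x * (D.virtualValue x * y x)) := by
    intro x hx0
    rcases lt_or_gt_of_ne hx0 with hx | hx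
    · rw [Set.indicator_of_notMem (by simpa using hx.le), D.pdf_of_neg x hx]
      simp
    rw [Set.indicator_of_mem (Set.mem_Ioi.2 hx)]
    rcases (D.pdf_nonneg x).eq_or_lt with h | h
    · rw [← h]
      have := mul_nonneg (h0 x) (sub_nonneg.2 (D.cdf_le_one x))
      refine ⟨by simpa using this, fun hz => ?_⟩
      rw [hz x hx h.symm]; simp
    · have : D.pdf x * (x * y x) - y x * (1 - D.cdf x) = D.pdf x * (D.virtualValue x * y x) := by
        rw [virtualValue]; field_simp
      exact ⟨this.le, fun _ => this⟩
  have hne : ∀ᵐ x : ℝ, x ≠ 0 := by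
    simp [ae_iff]
  refine ⟨i6, ?_, fun hz => ?_⟩
  · rw [e1, integral_law]
    refine integral_mono_ae (((D.integrable_law_iff _).1 i4).sub i2) ((D.integrable_law_iff _).1 i5) ?_
    filter_upwards [hne] with x hx using (hcmp x hx).1
  · rw [e1, integral_law]
    refine integral_congr_ae ?_
    filter_upwards [hne] with x hx using (hcmp x hx).2 hz

end ValueDist

/-! ### Resampling one value -/

section Joint

variable {n : ℕ} (D : Fin n → ValueDist)

instance : IsProbabilityMeasure (jointLaw D) := by unfold jointLaw; infer_instance

theorem ae_jointLaw {P : Fin n → ℝ → Prop} (h : ∀ i, ∀ᵐ x ∂(D i).law, P i x) :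
    ∀ᵐ v ∂(jointLaw D), ∀ i, P i (v i) :=
  Filter.eventually_all.2 fun i => Measure.tendsto_eval_ae_ae.eventually (h i)

/-- Replacing the value of `i` by an independent copy does not change the joint law. -/
theorem measurePreserving_update (i : Fin n) :
    MeasurePreserving (fun z : (Fin n → ℝ) × ℝ => Function.update z.1 i z.2)
      ((jointLaw D).prod (D i).law) (jointLaw D) := by
  have hm : Measurable fun z : (Fin n → ℝ) × ℝ => Function.update z.1 i z.2 := by
    refine measurable_pi_iff.2 fun k => ?_
    simp only [Function.update_apply]
    split_ifs
    · exact measurable_snd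
    · exact (measurable_pi_apply k).comp measurable_fst
  refine ⟨hm, (Measure.pi_eq fun s hs => ?_).symm⟩
  rw [Measure.map_apply hm (MeasurableSet.univ_pi hs)]
  have : (fun z : (Fin n → ℝ) × ℝ => Function.update z.1 i z.2) ⁻¹' Set.univ.pi s =
      (Set.univ.pi (Function.update s i Set.univ)) ×ˢ s i := by
    ext ⟨v, x⟩
    simp only [Set.mem_preimage, Set.mem_pi, Set.mem_univ, true_imp_iff, Set.mem_prod]
    constructor
    · intro h
      refine ⟨fun k => ?_, by simpa using h i⟩
      by_cases hk : k = i
      · subst hk; simp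
      · simpa [hk] using h k
    · rintro ⟨h1, h2⟩ k
      by_cases hk : k = i
      · subst hk; simpa using h2
      · simpa [hk] using h1 k
  rw [this, Measure.prod_prod, jointLaw, Measure.pi_pi,
    ← Finset.mul_prod_erase _ _ (Finset.mem_univ i), ← Finset.mul_prod_erase Finset.univ
    (fun i => (D i).law (s i)) (Finset.mem_univ i)]
  simp only [Function.update_self, measure_univ, one_mul]
  rw [mul_comm]
  congr 1
  refine Finset.prod_congr rfl fun k hk => ?_
  rw [Function.update_of_ne (Finset.ne_of_mem_erase hk)]

variable {D}

/-- If the conditional expectations given the other values are ordered, so are the expectations. -/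
theorem integral_jointLaw_mono (i : Fin n) {h h' : (Fin n → ℝ) → ℝ} (hh : Integrable h (jointLaw D))
    (hh' : Integrable h' (jointLaw D))
    (hle : ∀ v, (∀ k, 0 ≤ v k) → Integrable (fun x => h (Function.update v i x)) (D i).law →
      Integrable (fun x => h' (Function.update v i x)) (D i).law →
      ∫ x, h (Function.update v i x) ∂(D i).law ≤ ∫ x, h' (Function.update v i x) ∂(D i).law) :
    ∫ v, h v ∂(jointLaw D) ≤ ∫ v, h' v ∂(jointLaw D) := by
  have hΦ := measurePreserving_update D i
  have key : ∀ {f : (Fin n → ℝ) → ℝ}, Integrable f (jointLaw D) →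
      Integrable (fun z : (Fin n → ℝ) × ℝ => f (Function.update z.1 i z.2))
        ((jointLaw D).prod (D i).law) ∧
      ∫ v, f v ∂(jointLaw D) = ∫ v, ∫ x, f (Function.update v i x) ∂(D i).law ∂(jointLaw D) := by
    intro f hf
    have h1 : Integrable (fun z : (Fin n → ℝ) × ℝ => f (Function.update z.1 i z.2))
        ((jointLaw D).prod (D i).law) := hΦ.integrable_comp_of_integrable hf
    refine ⟨h1, ?_⟩
    have h2 : AEStronglyMeasurable f (Measure.map (fun z : (Fin n → ℝ) × ℝ => Function.update z.1 i z.2)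
        ((jointLaw D).prod (D i).law)) := by rw [hΦ.map_eq]; exact hf.aestronglyMeasurable
    rw [← integral_prod _ h1, ← integral_map hΦ.aemeasurable h2, hΦ.map_eq]
  obtain ⟨k1, k2⟩ := key hh
  obtain ⟨k1', k2'⟩ := key hh'
  rw [k2, k2']
  refine integral_mono_ae k1.integral_prod_left k1'.integral_prod_left ?_
  filter_upwards [ae_jointLaw D (fun i => (D i).ae_nonneg), k1.prod_right_ae, k1'.prod_right_ae]
    with v hv h3 h4 using hle v hv h3 h4

theorem integrable_eval (i : Fin n) {f : ℝ → ℝ} (hf : Integrable f (D i).law) :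
    Integrable (fun v => f (v i)) (jointLaw D) := by
  have : MeasurePreserving (Function.eval i) (jointLaw D) (D i).law := measurePreserving_eval _ i
  exact this.integrable_comp_of_integrable hf

end Joint

/-! ### The guarantees of the mechanism -/

namespace Market

variable {E : Market}

theorem sum_score_clicks_nonneg (hp : ∀ i j, 0 ≤ E.p i j) (s : ℕ → ℝ) :
    0 ≤ ∑ i : Fin E.n, s i * E.clicks s i := by
  refine Finset.sum_nonneg fun i _ => ?_
  rcases le_or_gt (s i) 0 with h | h
  · rw [clicks_eq_zero hp h, mul_zero]
  · exact mul_nonneg h.le (clicks_nonneg hp s i)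

/-- No mechanism has more than `50 ln (m + 1)` times the scored click probabilities. -/
theorem sum_score_clickProb_le_log (hp0 : ∀ i j, 0 ≤ E.p i j) (hp1 : ∀ i j, E.p i j ≤ 1)
    (hK : E.K ≤ E.m) {q : Fin E.n → Fin E.m → ℝ} (hq : ∀ i j, q i j = E.p i j)
    (M' : Mechanism E.n E.m E.K) (s : ℕ → ℝ) (v : Fin E.n → ℝ) :
    ∑ i : Fin E.n, s i * M'.clickProb q v i ≤
      50 * Real.log (E.m + 1) * ∑ i : Fin E.n, s i * E.clicks s i := by
  refine M'.sum_score_clickProb_le (s := fun i => s i) (fun χ => ?_) v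
  -- Without positions the logarithm vanishes, but so do the click probabilities.
  rcases Nat.eq_zero_or_pos E.m with h0 | h0
  · have : ∀ i, ctr q χ i = 0 := by
      intro i
      refine Finset.sum_eq_zero fun j _ => absurd j.2 ?_
      omega
    simp [this, h0]
  · refine (sum_score_ctr_le hp0 hp1 hK hq s χ).trans ?_
    have h1 := buckets_le_log h0
    have h2 := sum_score_clicks_nonneg hp0 s
    nlinarith

variable (hp : ∀ i j, 0 ≤ E.p i j) {g : ℕ → ℝ → ℝ} (hg : IsScore g) {ε : ℝ} (hε : 0 < ε)
  {q : Fin E.n → Fin E.m → ℝ} (hq : ∀ i j, q i j = E.p i j)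

theorem isScore_id : IsScore fun _ x => x :=
  ⟨fun _ => measurable_id, fun _ => le_rfl, fun _ _ _ _ h _ => h⟩

include hq in
theorem welfare_le (hp1 : ∀ i j, E.p i j ≤ 1) (hK : E.K ≤ E.m) (D : Fin E.n → ValueDist)
    (M' : Mechanism E.n E.m E.K) :
    welfare q D M' ≤ ENNReal.ofReal (50 * Real.log (E.m + 1)) *
      welfare q D (E.mech hp _ isScore_id ε hε) := by
  unfold welfare
  have hm : Measurable fun v : Fin E.n → ℝ => ENNReal.ofReal
      (∑ i, v i * (E.mech hp _ isScore_id ε hε).clickProb q v i) :=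
    (Finset.measurable_sum _ fun i _ =>
      (measurable_pi_apply i).mul ((E.mech hp _ isScore_id ε hε).measurable_clickProb q i)).ennreal_ofReal
  rw [← lintegral_const_mul _ hm]
  refine lintegral_mono_ae ?_
  filter_upwards [ae_jointLaw D fun i => (D i).ae_nonneg] with v hv
  have hC : 0 ≤ 50 * Real.log (E.m + 1) := by
    have := Real.log_nonneg (show (1 : ℝ) ≤ E.m + 1 by linarith [Nat.cast_nonneg (α := ℝ) E.m])
    linarith
  rw [← ENNReal.ofReal_mul hC]
  refine ENNReal.ofReal_le_ofReal ?_
  have h := sum_score_clickProb_le_log hp hp1 hK hq M' (scores (fun _ x => x) (reports v)) v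
  simp only [mech_clickProb hp isScore_id hε hq]
  simpa only [scores, reports_fin _ (hv _)] using h

end Market

/-! ### Scores from virtual values -/

/-- The score of report `x` of advertiser `i` according to the oracle `O`: `0` where `F` vanishes,
elsewhere the virtual value where the density is positive and `x` where it vanishes. For a regular
distribution this is `0` below the support and `x` above it. -/
def virtualScore (O : Oracle) (i : ℕ) (x : ℝ) : ℝ :=
  if O.cdf i x ≤ 0 then 0 else if O.pdf i x ≤ 0 then x else x - (1 - O.cdf i x) / O.pdf i x

namespace ValueDist

variable {D : ValueDist}

theorem exists_pdf_pos_of_cdf_pos {x : ℝ} (h : 0 < D.cdf x) : ∃ z ≤ x, 0 < D.pdf z := by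
  by_contra hc
  push Not at hc
  have : D.law (Set.Iic x) = 0 := by
    have h2 : ∀ᵐ z ∂D.law, z ∉ Set.Iic x := by
      filter_upwards [D.ae_pos_pdf] with z hz hzx
      exact absurd hz (not_lt.2 (hc z hzx))
    exact measure_eq_zero_iff_ae_notMem.2 h2
  rw [cdf, measureReal_def, this] at h
  simp at h

theorem exists_pdf_pos_of_cdf_lt {x : ℝ} (h : D.cdf x < 1) : ∃ z, x < z ∧ 0 < D.pdf z := by
  by_contra hc
  push Not at hc
  have : D.law (Set.Ioi x) = 0 := by
    have h2 : ∀ᵐ z ∂D.law, z ∉ Set.Ioi x := by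
      filter_upwards [D.ae_pos_pdf] with z hz hzx
      exact absurd hz (not_lt.2 (hc z hzx))
    exact measure_eq_zero_iff_ae_notMem.2 h2
  have h3 := D.one_sub_cdf x
  rw [measureReal_def, this] at h3
  simp at h3
  linarith

theorem cdf_zero : D.cdf 0 = 0 := by
  have h2 : ∀ᵐ z ∂D.law, z ∉ Set.Iic (0 : ℝ) := by
    have hne : ∀ᵐ x : ℝ, x ≠ 0 := by simp [ae_iff]
    have hne : ∀ᵐ x ∂D.law, x ≠ 0 := D.law_absolutelyContinuous.ae_le hne
    filter_upwards [D.ae_nonneg, hne] with z hz h0 hz'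
    exact h0 (le_antisymm hz' hz)
  rw [cdf, measureReal_def, measure_eq_zero_iff_ae_notMem.2 h2]
  rfl

/-- For a regular distribution the density vanishes only where `F = 0` or `F = 1`. -/
theorem IsRegular.cdf_eq_one (hD : D.IsRegular) {x : ℝ} (h0 : 0 < D.cdf x) (hf : D.pdf x ≤ 0) :
    D.cdf x = 1 := by
  by_contra hne
  obtain ⟨z, hz, hz'⟩ := exists_pdf_pos_of_cdf_pos h0
  obtain ⟨w, hw, hw'⟩ := exists_pdf_pos_of_cdf_lt (lt_of_le_of_ne (D.cdf_le_one x) hne)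
  exact absurd (hD.1.out hz' hw' ⟨hz, hw.le⟩) (not_lt.2 hf)

/-- Two points of positive density have an interval of positive mass between them, so that `F`
vanishes at one point of positive density at most. -/
theorem IsRegular.ae_cdf_pos (hD : D.IsRegular) : ∀ᵐ x ∂D.law, 0 < D.cdf x := by
  have hs : {x | 0 < D.pdf x ∧ D.cdf x ≤ 0}.Subsingleton := by
    have key : ∀ x x', x < x' → 0 < D.pdf x → 0 < D.pdf x' → 0 < D.cdf x' := by
      intro x x' hlt h h'
      by_contra hc
      have h0 : D.law (Set.Iic x') = 0 := by
        have := le_antisymm (not_lt.1 hc) (D.cdf_nonneg x')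
        rwa [cdf, measureReal_eq_zero_iff] at this
      have h1 : D.law (Set.Icc x x') = 0 := measure_mono_null Set.Icc_subset_Iic_self h0
      rw [law, withDensity_apply_eq_zero' D.measurable_ofReal_pdf.aemeasurable] at h1
      have h2 : {x | ENNReal.ofReal (D.pdf x) ≠ 0} ∩ Set.Icc x x' = Set.Icc x x' := by
        refine Set.inter_eq_right.2 fun z hz => ?_
        simpa using hD.1.out h h' hz
      rw [h2, Real.volume_Icc] at h1
      simp at h1
      linarith
    intro x hx x' hx'
    rcases lt_trichotomy x x' with h | h | h
    · exact absurd (key x x' h hx.1 hx'.1) (not_lt.2 hx'.2)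
    · exact h
    · exact absurd (key x' x h hx'.1 hx.1) (not_lt.2 hx.2)
  have h0 : D.law {x | 0 < D.pdf x ∧ D.cdf x ≤ 0} = 0 :=
    D.law_absolutelyContinuous (hs.measure_zero _)
  filter_upwards [D.ae_pos_pdf, measure_eq_zero_iff_ae_notMem.1 h0] with x hx hx'
  by_contra hc
  exact hx' ⟨hx, not_lt.1 hc⟩

end ValueDist

section VirtualScore

variable {n : ℕ} {D : Fin n → ValueDist}

theorem virtualScore_fin (i : Fin n) (x : ℝ) : virtualScore (Oracle.ofDist D) i x =
    if (D i).cdf x ≤ 0 then 0 else if (D i).pdf x ≤ 0 then x else (D i).virtualValue x := by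
  simp [virtualScore, Oracle.ofDist, ValueDist.virtualValue]

theorem virtualScore_of_le {i : ℕ} (h : n ≤ i) (x : ℝ) : virtualScore (Oracle.ofDist D) i x = 0 := by
  simp [virtualScore, Oracle.ofDist, not_lt.2 h]

/-- Virtual values do not exceed values, so that the scores do not drop at the upper end of
the support either. -/
theorem isScore_virtualScore (hD : ∀ i, (D i).IsRegular) :
    Market.IsScore (virtualScore (Oracle.ofDist D)) := by
  have hcase : ∀ i : ℕ, (∃ k : Fin n, (k : ℕ) = i) ∨ n ≤ i := fun i =>
    (lt_or_ge i n).imp (fun h => ⟨⟨i, h⟩, rfl⟩) id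
  refine ⟨fun i => ?_, fun i => ?_, fun i x x' hx h hs => ?_⟩ <;>
    rcases hcase i with ⟨k, rfl⟩ | hi
  · have : virtualScore (Oracle.ofDist D) k = fun x => if (D k).cdf x ≤ 0 then 0 else
        if (D k).pdf x ≤ 0 then x else (D k).virtualValue x := funext (virtualScore_fin k)
    rw [this]
    refine Measurable.ite (measurableSet_le (D k).measurable_cdf measurable_const) measurable_const ?_
    exact Measurable.ite (measurableSet_le (D k).pdf_measurable measurable_const) measurable_id
      (D k).measurable_virtualValue
  · have : virtualScore (Oracle.ofDist D) i = fun _ => 0 := funext (virtualScore_of_le hi)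
    rw [this]
    exact measurable_const
  · rw [virtualScore_fin, if_pos ValueDist.cdf_zero.le]
  · rw [virtualScore_of_le hi]
  · rw [virtualScore_fin] at hs ⊢
    rw [virtualScore_fin]
    have h0 : 0 < (D k).cdf x := by
      by_contra hc
      rw [if_pos (not_lt.1 hc)] at hs
      exact lt_irrefl _ hs
    have h0' : 0 < (D k).cdf x' := h0.trans_le ((D k).cdf_mono h)
    have hvle : ∀ z, 0 < (D k).pdf z → (D k).virtualValue z ≤ z := by
      intro z hz
      have := div_nonneg (sub_nonneg.2 ((D k).cdf_le_one z)) hz.le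
      unfold ValueDist.virtualValue
      linarith
    rw [if_neg (not_le.2 h0), if_neg (not_le.2 h0')]
    by_cases hf : (D k).pdf x ≤ 0
    · -- There is mass below `x`, so that the density stays zero above `x`.
      obtain ⟨z, hz, hz'⟩ := ValueDist.exists_pdf_pos_of_cdf_pos h0
      have hf' : (D k).pdf x' ≤ 0 := by
        by_contra hc
        exact absurd ((hD k).1.out hz' (not_le.1 hc) ⟨hz, h⟩) (not_lt.2 hf)
      rw [if_pos hf, if_pos hf']
      exact h
    · rw [if_neg hf]
      have hf := not_le.1 hf
      split_ifs with hf'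
      · exact (hvle x hf).trans h
      · exact (hD k).2 hf (not_le.1 hf') h
  · rw [virtualScore_of_le hi] at hs
    exact absurd hs (lt_irrefl _)

end VirtualScore

/-! ### Revenue -/

theorem exactPayment_congr {y y' : ℝ → ℝ} (h : ∀ x, 0 ≤ x → y x = y' x) {x : ℝ} (hx : 0 ≤ x) :
    exactPayment y x = exactPayment y' x := by
  unfold exactPayment
  rw [h x hx]
  congr 1
  refine intervalIntegral.integral_congr fun z hz => h z ?_
  rw [Set.uIcc_of_le hx] at hz
  exact hz.1

/-- The extension of `y : [0, ∞) → ℝ` by its value at `0`. -/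
def clamp (y : ℝ → ℝ) (x : ℝ) : ℝ := y (max x 0)

theorem clamp_of_nonneg (y : ℝ → ℝ) {x : ℝ} (hx : 0 ≤ x) : clamp y x = y x := by
  simp [clamp, hx]

theorem clamp_mono {y : ℝ → ℝ} (hy : MonotoneOn y (Set.Ici 0)) : Monotone (clamp y) := fun _ _ h =>
  hy (Set.mem_Ici.2 (le_max_right _ _)) (Set.mem_Ici.2 (le_max_right _ _)) (max_le_max_right 0 h)

section Revenue

variable {n m K : ℕ} {p : Fin n → Fin m → ℝ} {D : Fin n → ValueDist}

theorem integrable_virtualValue_clickProb (hp : ∀ i j, 0 ≤ p i j ∧ p i j ≤ 1)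
    (hD : ∀ i, (D i).HasFiniteMean) (M : Mechanism n m K) (i : Fin n) :
    Integrable (fun v => (D i).virtualValue (v i) * M.clickProb p v i) (jointLaw D) := by
  refine Integrable.mul_bdd (c := 1) (integrable_eval i (ValueDist.integrable_virtualValue (hD i)))
    (M.measurable_clickProb p i).aestronglyMeasurable (Filter.Eventually.of_forall fun v => ?_)
  rw [Real.norm_of_nonneg (M.clickProb_mem hp v i).1]
  exact (M.clickProb_mem hp v i).2

theorem integrable_payment (hp : ∀ i j, 0 ≤ p i j ∧ p i j ≤ 1)
    (hD : ∀ i, (D i).HasFiniteMean) {M : Mechanism n m K} (hir : M.IsIR p) (i : Fin n) :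
    Integrable (fun v => M.t v i) (jointLaw D) := by
  refine (integrable_eval i (hD i)).mono (M.t_measurable i).aestronglyMeasurable ?_
  filter_upwards [ae_jointLaw D fun i => (D i).ae_nonneg] with v hv
  rw [Real.norm_of_nonneg (M.t_nonneg v i), Real.norm_of_nonneg (hv i)]
  have h := hir i v (v i) hv (hv i)
  rw [Function.update_eq_self, Mechanism.utility] at h
  have h2 := mul_le_of_le_one_right (hv i) (M.clickProb_mem hp v i).2
  linarith

/-- Expected payments of an incentive compatible mechanism are at most expected virtual values. -/
theorem integral_payment_le (hp : ∀ i j, 0 ≤ p i j ∧ p i j ≤ 1)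
    (hD : ∀ i, (D i).HasFiniteMean) {M : Mechanism n m K} (hic : M.IsIC p) (hir : M.IsIR p) (i : Fin n) :
    ∫ v, M.t v i ∂(jointLaw D) ≤
      ∫ v, (D i).virtualValue (v i) * M.clickProb p v i ∂(jointLaw D) := by
  refine integral_jointLaw_mono i (integrable_payment hp hD hir i)
    (integrable_virtualValue_clickProb hp hD M i) fun v hv h1 h2 => ?_
  obtain ⟨hy, ht⟩ := Mechanism.payment_le hic hir i hv
  set y : ℝ → ℝ := fun x => M.clickProb p (Function.update v i x) i with hydef
  obtain ⟨e1, e2, -⟩ := ValueDist.integral_exactPayment (hD i) (clamp_mono hy)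
    (fun x => (M.clickProb_mem hp _ i).1) (fun x => (M.clickProb_mem hp _ i).2)
  refine (integral_mono_ae h1 e1 ?_).trans (e2.trans (integral_congr_ae ?_).le)
  · filter_upwards [(D i).ae_nonneg] with x hx
    rw [exactPayment_congr (fun z hz => clamp_of_nonneg y hz) hx]
    exact ht x hx
  · filter_upwards [(D i).ae_nonneg] with x hx
    rw [clamp_of_nonneg y hx, Function.update_self]

end Revenue

namespace Market

variable {E : Market} (hp : ∀ i j, 0 ≤ E.p i j) {ε : ℝ} (hε : 0 < ε)
  {q : Fin E.n → Fin E.m → ℝ} (hq : ∀ i j, q i j = E.p i j) {D : Fin E.n → ValueDist}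
  (hD : ∀ i, (D i).IsRegular ∧ (D i).HasFiniteMean)

include hq hD in
/-- Expected payments of the mechanism are at least expected virtual values: exact payments lose
nothing, as no clicks are won below the support and `F = 1` above it. -/
theorem le_integral_payment (hp1 : ∀ i j, E.p i j ≤ 1) (i : Fin E.n) :
    ∫ v, (D i).virtualValue (v i) * (E.mech hp _ (isScore_virtualScore fun i => (hD i).1) ε hε).clickProb
      q v i ∂(jointLaw D) ≤
    ∫ v, (E.mech hp _ (isScore_virtualScore fun i => (hD i).1) ε hε).t v i ∂(jointLaw D) := by
  have hg := isScore_virtualScore fun i => (hD i).1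
  have hpq : ∀ i j, 0 ≤ q i j ∧ q i j ≤ 1 := fun i j => by rw [hq]; exact ⟨hp _ _, hp1 _ _⟩
  refine integral_jointLaw_mono i (integrable_virtualValue_clickProb hpq (fun i => (hD i).2) _ i)
    (integrable_payment hpq (fun i => (hD i).2) (mech_isIR hp _ hε hq) i) fun v hv h1 h2 => ?_
  set y := E.curve (virtualScore (Oracle.ofDist D)) (reports v) i with hydef
  have hy : MonotoneOn y (Set.Ici 0) := curve_monotoneOn hp hg _ _
  have hyc : ∀ x, 0 ≤ x → (E.mech hp _ hg ε hε).clickProb q (Function.update v i x) i = y x := by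
    intro x hx
    rw [mech_clickProb hp hg hε hq, reports_update v i hx]
    rfl
  have hc0 : ∀ x, 0 ≤ clamp y x := fun x => clicks_nonneg hp _ _
  have hc1 : ∀ x, clamp y x ≤ 1 := fun x => clicks_le_one hp1 _ _
  obtain ⟨e1, -, e3⟩ := ValueDist.integral_exactPayment (hD i).2 (clamp_mono hy) hc0 hc1
  have e4 := e3 (by
    intro x hx hf
    rw [clamp_of_nonneg y hx.le]
    rcases ((D i).cdf_nonneg x).eq_or_lt with h0 | h0
    · have : y x = 0 := by
        refine clicks_eq_zero hp ?_
        simp [scores, virtualScore_fin, ← h0]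
      rw [this, zero_mul]
    · rw [(hD i).1.cdf_eq_one h0 hf.le, sub_self, mul_zero])
  refine ((integral_congr_ae ?_).trans e4.symm).le.trans (integral_mono_ae e1 h2 ?_)
  · filter_upwards [(D i).ae_nonneg] with x hx
    rw [clamp_of_nonneg y hx, Function.update_self, hyc x hx]
  · filter_upwards [(D i).ae_nonneg] with x hx
    rw [exactPayment_congr (fun z hz => clamp_of_nonneg y hz) hx]
    have := (payment_spec hp hg hε (reports (Function.update v i x)) i (reports_nonneg _ _)).2.2.1
    rw [reports_update v i hx, Function.update_self, curve_update, ← reports_update v i hx] at this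
    exact this

include hq in
/-- Revenue is bounded through expected virtual values on both sides; in between, the approximation
guarantee is applied to the virtual values, which almost surely are the scores. -/
theorem revenue_le (hp1 : ∀ i j, E.p i j ≤ 1) (hK : E.K ≤ E.m)
    (M' : Mechanism E.n E.m E.K) (hic : M'.IsIC q) (hir : M'.IsIR q) :
    revenue D M' ≤ ENNReal.ofReal (50 * Real.log (E.m + 1)) *
      revenue D (E.mech hp _ (isScore_virtualScore fun i => (hD i).1) ε hε) := by
  have hg := isScore_virtualScore fun i => (hD i).1
  have hpq : ∀ i j, 0 ≤ q i j ∧ q i j ≤ 1 := fun i j => by rw [hq]; exact ⟨hp _ _, hp1 _ _⟩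
  have hDm := fun i => (hD i).2
  set M := E.mech hp _ hg ε hε with hM
  have hirM : M.IsIR q := mech_isIR hp hg hε hq
  have hC : 0 ≤ 50 * Real.log (E.m + 1) := by
    have := Real.log_nonneg (show (1 : ℝ) ≤ E.m + 1 by linarith [Nat.cast_nonneg (α := ℝ) E.m])
    linarith
  have hrev : ∀ M : Mechanism E.n E.m E.K, M.IsIR q →
      revenue D M = ENNReal.ofReal (∑ i, ∫ v, M.t v i ∂(jointLaw D)) := by
    intro M hM
    rw [← integral_finsetSum _ fun i _ => integrable_payment hpq hDm hM i,
      ofReal_integral_eq_lintegral_ofReal (integrable_finsetSum _ fun i _ => integrable_payment hpq hDm hM i)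
        (Filter.Eventually.of_forall fun v => Finset.sum_nonneg fun i _ => M.t_nonneg v i)]
    rfl
  rw [hrev M' hir, hrev M hirM, ← ENNReal.ofReal_mul hC]
  refine ENNReal.ofReal_le_ofReal ?_
  calc ∑ i, ∫ v, M'.t v i ∂(jointLaw D)
      ≤ ∑ i, ∫ v, (D i).virtualValue (v i) * M'.clickProb q v i ∂(jointLaw D) :=
        Finset.sum_le_sum fun i _ => integral_payment_le hpq hDm hic hir i
    _ = ∫ v, ∑ i, (D i).virtualValue (v i) * M'.clickProb q v i ∂(jointLaw D) :=
        (integral_finsetSum _ fun i _ => integrable_virtualValue_clickProb hpq hDm M' i).symm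
    _ ≤ ∫ v, 50 * Real.log (E.m + 1) *
          ∑ i, (D i).virtualValue (v i) * M.clickProb q v i ∂(jointLaw D) := by
        refine integral_mono_ae
          (integrable_finsetSum _ fun i _ => integrable_virtualValue_clickProb hpq hDm M' i)
          ((integrable_finsetSum _ fun i _ => integrable_virtualValue_clickProb hpq hDm M i).const_mul _) ?_
        filter_upwards [ae_jointLaw D fun i => (D i).ae_nonneg, ae_jointLaw D fun i => (D i).ae_pos_pdf,
          ae_jointLaw D fun i => (hD i).1.ae_cdf_pos] with v h0 h1 h2
        have hs : ∀ i : Fin E.n, scores (virtualScore (Oracle.ofDist D)) (reports v) i =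
            (D i).virtualValue (v i) := by
          intro i
          rw [scores, reports_fin i (h0 i), virtualScore_fin, if_neg (not_le.2 (h2 i)),
            if_neg (not_le.2 (h1 i))]
        have h := sum_score_clickProb_le_log hp hp1 hK hq M'
          (scores (virtualScore (Oracle.ofDist D)) (reports v)) v
        simp only [hM, mech_clickProb hp hg hε hq]
        simpa only [hs] using h
    _ = 50 * Real.log (E.m + 1) *
          ∑ i, ∫ v, (D i).virtualValue (v i) * M.clickProb q v i ∂(jointLaw D) := by
        rw [integral_const_mul, integral_finsetSum _ fun i _ => integrable_virtualValue_clickProb hpq hDm M i]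
    _ ≤ 50 * Real.log (E.m + 1) * ∑ i, ∫ v, M.t v i ∂(jointLaw D) :=
        mul_le_mul_of_nonneg_left (Finset.sum_le_sum fun i _ => le_integral_payment hp hε hq hD hp1 i) hC

end Market

/-! ### The program: clicks at given reports -/

namespace Halts

variable {O : Oracle} {c c₁ c₂ : Prog} {s : Store} {N N₁ N₂ : ℕ} {Q : Store → Prop}

theorem setN_seq {a : ℕ} {i j e : NExpr}
    (h : Halts O c (s.setNat a (i.eval s) (j.eval s) (e.eval s)) N Q) :
    Halts O (.seq (.setN a i j e) c) s (N + 1) Q := by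
  have h1 : Halts O (.setN a i j e) s 1 (fun s' => s' = s.setNat a (i.eval s) (j.eval s) (e.eval s)) :=
    Halts.setN rfl
  exact (Halts.seq h1 (fun s' _ hs => hs ▸ h)).mono (by omega) fun _ h => h

theorem setR_seq {a : ℕ} {i j : NExpr} {e : RExpr}
    (h : Halts O c (s.setReal a (i.eval s) (j.eval s) (e.eval O s)) N Q) :
    Halts O (.seq (.setR a i j e) c) s (N + 1) Q := by
  have h1 : Halts O (.setR a i j e) s 1 (fun s' => s' = s.setReal a (i.eval s) (j.eval s) (e.eval O s)) :=
    Halts.setR rfl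
  exact (Halts.seq h1 (fun s' _ hs => hs ▸ h)).mono (by omega) fun _ h => h

theorem weaken (h : Halts O c s N₁ Q) (hN : N₁ ≤ N₂) : Halts O c s N₂ Q := h.mono hN fun _ h => h

end Halts

/-- The number `n` of advertisers in the input. -/
def nExpr : NExpr := .get 0 (.const 0) (.const 0)

/-- The number `m` of positions in the input. -/
def mExpr : NExpr := .get 0 (.const 0) (.const 1)

/-- The cap `K` in the input. -/
def kExpr : NExpr := .get 0 (.const 0) (.const 2)

/-- The memory holds the market `E`. -/
structure Holds (E : Market) (s : Store) : Prop where
  n : s.nat 0 0 0 = E.n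
  m : s.nat 0 0 1 = E.m
  K : s.nat 0 0 2 = E.K
  p : s.real 0 = E.p

theorem Holds.of_agree {E : Market} {c : Prog} {s s' : Store} (h : Holds E s) (ha : Agree c s s')
    (h1 : c.writesNat 0 = false) (h2 : c.writesReal 0 = false) : Holds E s' := by
  obtain ⟨a1, a2, a3, a4⟩ := h
  have e1 := ha.nat 0 h1
  have e2 := ha.real 0 h2
  exact ⟨by rw [e1, a1], by rw [e1, a2], by rw [e1, a3], by rw [e2, a4]⟩

/-- Rows `a` of the arrays `5` and `6` hold the matching `S`. -/
structure Rep (E : Market) (s : Store) (a : ℕ) (S : GState) : Prop where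
  asg : ∀ j < E.m, s.nat 5 a j = S.asg j
  pos : ∀ i < E.n, s.nat 6 a i = S.pos i

theorem Rep.congr {E : Market} {s s' : Store} {a : ℕ} {S : GState} (h : Rep E s a S)
    (h5 : s'.nat 5 a = s.nat 5 a) (h6 : s'.nat 6 a = s.nat 6 a) : Rep E s' a S :=
  ⟨fun j hj => by rw [h5, h.asg j hj], fun i hi => by rw [h6, h.pos i hi]⟩

/-! Variables of the program: the naturals `4` (number of buckets), `7` (current `2ᵃ`), `8` (`a`), `9`
(greedy round), `10` (advertiser), `11` (position), `12` and `13` (best pair), `14` (advertiser whose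
payment is computed), `15` (first position shown); the reals `8` (best weight), `9`–`12` (payment
state). The real arrays `5`, `6`, `7` hold reports, scores and click probabilities, the natural
arrays `5`, `6` the matchings. -/

/-- The weight of the current pair. -/
def pairWeight : RExpr := .mul (.get 6 (nvar 10) (.const 0)) (.get 0 (nvar 10) (nvar 11))

/-- The current pair is free and heavier than the best one so far. -/
def betterTest : BExpr :=
  .and (.and (.leN (.get 6 (nvar 8) (nvar 10)) (.const 0))
    (.and (.leN (.get 5 (nvar 8) (nvar 11)) (.const 0))
      (.leR (.mul (.get 0 (nvar 10) (nvar 11)) (.ofNat (nvar 7))) (.ofNat (.const 1)))))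
    (.neg (.leR pairWeight (rvar 8)))

/-- Search of the best pair. -/
def bestProg : Prog :=
  forN 10 nExpr (forN 11 mExpr (.ite betterTest
    (.seq (.setR 8 (.const 0) (.const 0) pairWeight)
      (.seq (.setN 12 (.const 0) (.const 0) (nvar 10)) (.setN 13 (.const 0) (.const 0) (nvar 11))))
    .skip))

/-- Time bound for `bestProg`. This and the time bounds built on it are stated over any commutative
semiring, in order to read them both as numbers and as polynomials. -/
def bestCost {R : Type*} [CommSemiring R] (n m : R) : R := n * (m * 6 + 2 + 2) + 2

/-- The memory holds the best pair `x`; its indices only matter if it has positive weight. -/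
def Found (s : Store) (x : ℝ × ℕ × ℕ) : Prop :=
  s.real 8 0 0 = x.1 ∧ (0 < x.1 → s.nat 12 0 0 = x.2.1 ∧ s.nat 13 0 0 = x.2.2)

theorem bestProg_halts {O : Oracle} {E : Market} {s : Store} {sc : ℕ → ℝ} {a b : ℕ} {S : GState}
    (hE : Holds E s) (hs : ∀ i < E.n, s.real 6 i 0 = sc i) (ha : s.nat 8 0 0 = a) (hS : Rep E s a S)
    (hb : s.nat 7 0 0 = b) (h0 : s.real 8 0 0 = 0) :
    Halts O bestProg s (bestCost E.n E.m) fun s' => Found s' (E.best sc b S) := by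
  refine (Halts.forN (B := E.n) (N := E.m * 6 + 2) (fun t s' => Found s'
      (forFold (fun i => forFold (fun j => E.better sc b S i j) E.m) t (0, 0, 0)))
    (by simp [Prog.writesNat]) ?_ ?_ ?_ ?_).mono le_rfl fun s' h => h.2
  · intro t s' x h
    simpa [Found, Store.setNat_nat] using h
  · intro s' h
    simp only [nExpr, NExpr.eval]
    rw [h.nat 0 (by simp [Prog.writesNat]), hE.n]
  · simp [Found, forFold, h0]
  · intro i s₁ hi hag hI hvar
    refine (Halts.forN (B := E.m) (N := 4) (fun t s' => Found s'
      (forFold (fun j => E.better sc b S i j) t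
        (forFold (fun i => forFold (fun j => E.better sc b S i j) E.m) i (0, 0, 0))))
      (by simp [Prog.writesNat]) ?_ ?_ hI ?_).mono le_rfl fun s' h => h.2
    · intro t s' x h
      simpa [Found, Store.setNat_nat] using h
    · intro s' h
      simp only [mExpr, NExpr.eval]
      rw [h.nat 0 (by simp [Prog.writesNat]), hag.nat 0 (by simp [Prog.writesNat]), hE.m]
    intro j s₂ hj hag' hI' hvar'
    have e5 : s₂.nat 5 = s.nat 5 := by
      rw [hag'.nat 5 (by simp [Prog.writesNat]), hag.nat 5 (by simp [Prog.writesNat])]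
    have e6 : s₂.nat 6 = s.nat 6 := by
      rw [hag'.nat 6 (by simp [Prog.writesNat]), hag.nat 6 (by simp [Prog.writesNat])]
    have e7 : s₂.nat 7 = s.nat 7 := by
      rw [hag'.nat 7 (by simp [Prog.writesNat]), hag.nat 7 (by simp [Prog.writesNat])]
    have e8 : s₂.nat 8 = s.nat 8 := by
      rw [hag'.nat 8 (by simp [Prog.writesNat]), hag.nat 8 (by simp [Prog.writesNat])]
    have e10 : s₂.nat 10 0 0 = i := by
      rw [hag'.nat 10 (by simp [Prog.writesNat]), hvar]
    have r0 : s₂.real 0 = E.p := by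
      rw [hag'.real 0 (by simp [Prog.writesReal]), hag.real 0 (by simp [Prog.writesReal]), hE.p]
    have r6 : s₂.real 6 i 0 = sc i := by
      rw [hag'.real 6 (by simp [Prog.writesReal]), hag.real 6 (by simp [Prog.writesReal]), hs i hi]
    simp only [forFold]
    generalize forFold (fun j => E.better sc b S i j) j
      (forFold (fun i => forFold (fun j => E.better sc b S i j) E.m) i (0, 0, 0)) = x at hI' ⊢
    have hw : pairWeight.eval O s₂ = sc i * E.p i j := by
      simp [pairWeight, RExpr.eval, e10, hvar', r0, r6, NExpr.eval]
    have htest : betterTest.Holds O s₂ ↔ E.Free b S i j ∧ x.1 < sc i * E.p i j := by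
      simp [betterTest, BExpr.Holds, NExpr.eval, RExpr.eval, hw, e10, hvar', e5, e6, e7, e8, ha, hb, r0,
        hS.asg j hj, hS.pos i hi, Market.Free, hI'.1]
    refine Halts.ite (fun hT => ?_) fun hT => ?_
    · rw [htest] at hT
      refine Halts.setR_seq (Halts.setN_seq (N := 1) (Halts.setN ?_))
      simp only [Market.better, if_pos hT]
      simp [Found, Store.setNat_nat, Store.setReal_real, NExpr.eval, hw, e10, hvar']
    · rw [htest] at hT
      refine (Halts.skip ?_).weaken (by omega)
      simp only [Market.better, if_neg hT]
      exact hI'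

/-- One greedy round in the current bucket. -/
def roundProg : Prog :=
  .seq (.setR 8 (.const 0) (.const 0) (.ofNat (.const 0)))
    (.seq bestProg
      (.ite (.neg (.leR (rvar 8) (.ofNat (.const 0))))
        (.seq (.setN 5 (nvar 8) (nvar 13) (.add (nvar 12) (.const 1)))
          (.seq (.setN 6 (nvar 8) (nvar 12) (.add (nvar 13) (.const 1)))
            (.setR 7 (nvar 12) (.const 0) (.add (.get 7 (nvar 12) (.const 0))
              (.div (.get 0 (nvar 12) (nvar 13)) (.mul (.ofNat (.const 2)) (.ofNat (nvar 4))))))))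
        .skip))

/-- The matching of bucket `a` has state `S`, the other rows are as in `s₀`, and the click
probabilities are those of `S` on top of `Y`. -/
structure BucketInv (E : Market) (s₀ : Store) (Y : ℕ → ℝ) (a : ℕ) (S : GState) (s : Store) : Prop where
  rep : Rep E s a S
  clicks : ∀ i < E.n, s.real 7 i 0 = Y i + S.rate E.p i / (2 * E.buckets)
  other5 : ∀ a' ≠ a, s.nat 5 a' = s₀.nat 5 a'
  other6 : ∀ a' ≠ a, s.nat 6 a' = s₀.nat 6 a'

theorem roundProg_halts {O : Oracle} {E : Market} {s₀ s : Store} {sc Y : ℕ → ℝ} {a b : ℕ} {S : GState}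
    (hE : Holds E s) (hs : ∀ i < E.n, s.real 6 i 0 = sc i) (ha : s.nat 8 0 0 = a)
    (hb : s.nat 7 0 0 = b) (hB : s.nat 4 0 0 = E.buckets) (hI : BucketInv E s₀ Y a S s) :
    Halts O roundProg s (bestCost E.n E.m + 5) (BucketInv E s₀ Y a (E.greedyStep sc b S)) := by
  refine Halts.setR_seq (Halts.seq (N₂ := 4) (bestProg_halts (sc := sc) (a := a) (b := b) (S := S)
    ?_ ?_ ?_ ?_ ?_ ?_) ?_)
  · exact ⟨hE.n, hE.m, hE.K, by rw [Store.setReal_real_of_ne _ _ _ _ (by decide), hE.p]⟩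
  · intro i hi
    rw [Store.setReal_real_of_ne _ _ _ _ (by decide), hs i hi]
  · exact ha
  · exact ⟨hI.rep.asg, hI.rep.pos⟩
  · exact hb
  · simp [Store.setReal_real, NExpr.eval, RExpr.eval]
  intro s' hag hF
  have n4 : s'.nat 4 0 0 = E.buckets := by
    rw [hag.nat 4 (by simp [bestProg, Prog.writesNat])]; exact hB
  have n5 : s'.nat 5 = s.nat 5 := hag.nat 5 (by simp [bestProg, Prog.writesNat])
  have n6 : s'.nat 6 = s.nat 6 := hag.nat 6 (by simp [bestProg, Prog.writesNat])
  have n8 : s'.nat 8 0 0 = a := by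
    rw [hag.nat 8 (by simp [bestProg, Prog.writesNat])]; exact ha
  have r7 : s'.real 7 = s.real 7 := by
    rw [hag.real 7 (by simp [bestProg, Prog.writesReal]), Store.setReal_real_of_ne _ _ _ _ (by decide)]
  have r0 : s'.real 0 = E.p := by
    rw [hag.real 0 (by simp [bestProg, Prog.writesReal]), Store.setReal_real_of_ne _ _ _ _ (by decide), hE.p]
  have hspec := Market.best_spec (E := E) sc b S
  have htest : (BExpr.neg (.leR (rvar 8) (.ofNat (.const 0)))).Holds O s' ↔ 0 < (E.best sc b S).1 := by
    simp [BExpr.Holds, RExpr.eval, NExpr.eval, hF.1]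
  refine Halts.ite (fun hT => ?_) fun hT => ?_
  · rw [htest] at hT
    obtain ⟨f1, f2⟩ := hF.2 hT
    obtain ⟨g1, g2, g3, -⟩ := hspec.2.1 hT
    rw [Market.greedyStep, if_pos hT]
    generalize (E.best sc b S).2.1 = bi at *
    generalize (E.best sc b S).2.2 = bj at *
    refine Halts.setN_seq (Halts.setN_seq (N := 1) (Halts.setR ?_))
    refine ⟨⟨fun j hj => ?_, fun i hi => ?_⟩, fun i hi => ?_, fun a' ha' => ?_, fun a' ha' => ?_⟩
    · simp only [Store.setReal_nat, Store.setNat_nat, nvar_eval, NExpr.eval, n8, f1, f2, GState.insert,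
        Function.update_apply, n5, hI.rep.asg j hj]
      simp
    · simp only [Store.setReal_nat, Store.setNat_nat, nvar_eval, NExpr.eval, n8, f1, f2, GState.insert,
        Function.update_apply, n6, hI.rep.pos i hi]
      simp
    · rw [Market.rate_insert]
      simp only [Store.setReal_real, Store.setNat_real, Store.setNat_nat, nvar_eval, NExpr.eval,
        RExpr.eval, n8, n4, f1, f2, r7, r0]
      by_cases h : i = bi
      · subst h
        have := hI.clicks i hi
        simp [this, GState.rate, g3.1]
      · simp [h, hI.clicks i hi]
    · funext j
      simp [Store.setNat_nat, NExpr.eval, n8, ha', n5, hI.other5 a' ha']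
    · funext j
      simp [Store.setNat_nat, NExpr.eval, n8, ha', n6, hI.other6 a' ha']
  · rw [htest] at hT
    rw [Market.greedyStep, if_neg hT]
    refine (Halts.skip ?_).weaken (by omega)
    refine ⟨hI.rep.congr (by rw [n5]) (by rw [n6]), fun i hi => ?_, fun a' h => ?_, fun a' h => ?_⟩
    · rw [r7, hI.clicks i hi]
    · rw [n5, hI.other5 a' h]
    · rw [n6, hI.other6 a' h]

/-- The greedy matching of the current bucket; the variable `7` is doubled for the next one. -/
def bucketProg : Prog :=
  .seq (forN 11 mExpr (.setN 5 (nvar 8) (nvar 11) (.const 0)))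
    (.seq (forN 10 nExpr (.setN 6 (nvar 8) (nvar 10) (.const 0)))
      (.seq (forN 9 kExpr (.ite (.neg (.leN (nvar 7) (nvar 9))) roundProg .skip))
        (.setN 7 (.const 0) (.const 0) (.add (nvar 7) (nvar 7)))))

/-- Time bound for `bucketProg`. -/
def bucketCost {R : Type*} [CommSemiring R] (n m K : R) : R :=
  (m * 3 + 2) + ((n * 3 + 2) + ((K * (bestCost n m + 6 + 2) + 2) + 1))

theorem bucketProg_halts {O : Oracle} {E : Market} {s : Store} {sc Y : ℕ → ℝ} {a b : ℕ}
    (hE : Holds E s) (hs : ∀ i < E.n, s.real 6 i 0 = sc i) (ha : s.nat 8 0 0 = a)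
    (hb : s.nat 7 0 0 = b) (hB : s.nat 4 0 0 = E.buckets) (hY : ∀ i < E.n, s.real 7 i 0 = Y i) :
    Halts O bucketProg s (bucketCost E.n E.m E.K) fun s' => s'.nat 7 0 0 = b + b ∧
      BucketInv E s Y a (E.greedy sc b E.K) s' := by
  refine Halts.seq (Halts.forN (B := E.m) (N := 1) (fun t s' => (∀ j < t, s'.nat 5 a j = 0) ∧
    ∀ a' ≠ a, s'.nat 5 a' = s.nat 5 a') (by simp [Prog.writesNat]) ?_ ?_ ?_ ?_) ?_
  · intro t s' x h
    simpa [Store.setNat_nat, Store.setNat_nat_of_ne] using h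
  · intro s' h
    simp only [mExpr, NExpr.eval]
    rw [h.nat 0 (by simp [Prog.writesNat]), hE.m]
  · simp
  · intro t s' ht hag hI hvar
    have n8 : s'.nat 8 0 0 = a := by rw [hag.nat 8 (by simp [Prog.writesNat]), ha]
    refine Halts.setN ⟨fun j hj => ?_, fun a' h => ?_⟩
    · simp only [Store.setNat_nat, nvar_eval, NExpr.eval, n8, hvar]
      rcases Nat.lt_succ_iff_lt_or_eq.1 hj with h | rfl
      · simp [hI.1 j h]
      · simp
    · funext j
      simp [Store.setNat_nat, n8, h, hI.2 a' h]
  rintro s₁ - ⟨hag₁, h5, h5'⟩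
  refine Halts.seq (Halts.forN (B := E.n) (N := 1) (fun t s' => (∀ j < t, s'.nat 6 a j = 0) ∧
    ∀ a' ≠ a, s'.nat 6 a' = s₁.nat 6 a') (by simp [Prog.writesNat]) ?_ ?_ ?_ ?_) ?_
  · intro t s' x h
    simpa [Store.setNat_nat, Store.setNat_nat_of_ne] using h
  · intro s' h
    simp only [nExpr, NExpr.eval]
    rw [h.nat 0 (by simp [Prog.writesNat]), hag₁.nat 0 (by simp [Prog.writesNat]), hE.n]
  · simp
  · intro t s' ht hag hI hvar
    have n8 : s'.nat 8 0 0 = a := by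
      rw [hag.nat 8 (by simp [Prog.writesNat]), hag₁.nat 8 (by simp [Prog.writesNat]), ha]
    refine Halts.setN ⟨fun j hj => ?_, fun a' h => ?_⟩
    · simp only [Store.setNat_nat, nvar_eval, NExpr.eval, n8, hvar]
      rcases Nat.lt_succ_iff_lt_or_eq.1 hj with h | rfl
      · simp [hI.1 j h]
      · simp
    · funext j
      simp [Store.setNat_nat, n8, h, hI.2 a' h]
  rintro s₂ - ⟨hag₂, h6, h6'⟩
  have hN : ∀ k, k ≠ 5 → k ≠ 6 → k ≠ 10 → k ≠ 11 → s₂.nat k = s.nat k := by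
    intro k k5 k6 k10 k11
    rw [hag₂.nat k (by simp [Prog.writesNat, k6, k10]), hag₁.nat k (by simp [Prog.writesNat, k5, k11])]
  have hR : ∀ k, s₂.real k = s.real k := by
    intro k
    rw [hag₂.real k (by simp [Prog.writesReal]), hag₁.real k (by simp [Prog.writesReal])]
  have h25 : s₂.nat 5 = s₁.nat 5 := hag₂.nat 5 (by simp [Prog.writesNat])
  have h16 : s₁.nat 6 = s.nat 6 := hag₁.nat 6 (by simp [Prog.writesNat])
  have hE₂ : Holds E s₂ := by
    have e := hN 0 (by decide) (by decide) (by decide) (by decide)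
    exact ⟨by rw [e, hE.n], by rw [e, hE.m], by rw [e, hE.K], by rw [hR, hE.p]⟩
  refine Halts.seq (Halts.forN (B := E.K) (N := bestCost E.n E.m + 6)
    (fun t s' => BucketInv E s Y a (E.greedy sc b t) s') (by simp [Prog.writesNat, roundProg, bestProg])
      ?_ ?_ ?_ ?_) ?_
  · rintro t s' x ⟨i1, i2, i3, i4⟩
    refine ⟨i1.congr ?_ ?_, i2, fun a' h => ?_, fun a' h => ?_⟩
    · rw [Store.setNat_nat_of_ne _ _ _ _ (by decide)]
    · rw [Store.setNat_nat_of_ne _ _ _ _ (by decide)]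
    · rw [Store.setNat_nat_of_ne _ _ _ _ (by decide), i3 a' h]
    · rw [Store.setNat_nat_of_ne _ _ _ _ (by decide), i4 a' h]
  · intro s' h
    simp only [kExpr, NExpr.eval]
    rw [h.nat 0 (by simp [Prog.writesNat, roundProg, bestProg]), hE₂.K]
  · refine ⟨⟨fun j hj => ?_, fun i hi => ?_⟩, fun i hi => ?_, fun a' h => ?_, fun a' h => ?_⟩
    · rw [h25, h5 j hj]; rfl
    · rw [h6 i hi]; rfl
    · rw [hR, hY i hi]; simp [Market.greedy, forFold, GState.rate]
    · rw [h25, h5' a' h]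
    · rw [h6' a' h, h16]
  · intro t s' ht hag hI hvar
    have hE' : Holds E s' := hE₂.of_agree hag (by simp [Prog.writesNat, roundProg, bestProg])
      (by simp [Prog.writesReal, roundProg, bestProg])
    have e7 : s'.nat 7 0 0 = b := by
      rw [hag.nat 7 (by simp [Prog.writesNat, roundProg, bestProg]),
        hN 7 (by decide) (by decide) (by decide) (by decide), hb]
    have e8 : s'.nat 8 0 0 = a := by
      rw [hag.nat 8 (by simp [Prog.writesNat, roundProg, bestProg]),
        hN 8 (by decide) (by decide) (by decide) (by decide), ha]
    have e4 : s'.nat 4 0 0 = E.buckets := by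
      rw [hag.nat 4 (by simp [Prog.writesNat, roundProg, bestProg]),
        hN 4 (by decide) (by decide) (by decide) (by decide), hB]
    have e6 : ∀ i < E.n, s'.real 6 i 0 = sc i := by
      intro i hi
      rw [hag.real 6 (by simp [Prog.writesReal, roundProg, bestProg]), hR, hs i hi]
    have htest : (BExpr.neg (.leN (nvar 7) (nvar 9))).Holds O s' ↔ t < b := by
      simp [BExpr.Holds, e7, hvar]
    refine Halts.ite (fun hT => ?_) fun hT => ?_
    · have hT' := htest.1 hT
      have : E.greedy sc b (t + 1) = E.greedyStep sc b (E.greedy sc b t) := by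
        simp only [Market.greedy, forFold, if_pos hT']
      rw [this]
      exact roundProg_halts hE' e6 e8 e7 e4 hI
    · have hT' := fun h => hT (htest.2 h)
      have : E.greedy sc b (t + 1) = E.greedy sc b t := by
        simp only [Market.greedy, forFold, if_neg hT']
      rw [this]
      exact (Halts.skip hI).weaken (by omega)
  rintro s₃ - ⟨hag₃, hI⟩
  refine Halts.setN ⟨?_, ?_⟩
  · have e7 : s₃.nat 7 0 0 = b := by
      rw [hag₃.nat 7 (by simp [Prog.writesNat, roundProg, bestProg]),
        hN 7 (by decide) (by decide) (by decide) (by decide), hb]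
    simp [Store.setNat_nat, NExpr.eval, e7]
  · obtain ⟨i1, i2, i3, i4⟩ := hI
    refine ⟨i1.congr ?_ ?_, i2, fun a' h => ?_, fun a' h => ?_⟩
    · rw [Store.setNat_nat_of_ne _ _ _ _ (by decide)]
    · rw [Store.setNat_nat_of_ne _ _ _ _ (by decide)]
    · rw [Store.setNat_nat_of_ne _ _ _ _ (by decide), i3 a' h]
    · rw [Store.setNat_nat_of_ne _ _ _ _ (by decide), i4 a' h]

/-- The program `c` computes the scores `g`: started with an advertiser in the natural variable `10`, it
writes the score of its report to array `6`, and nothing else. -/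
structure ScoreProg (O : Oracle) (g : ℕ → ℝ → ℝ) (c : Prog) : Prop where
  writesNat : ∀ a, c.writesNat a = false
  writesReal : ∀ a, c.writesReal a = decide (a = 6)
  halts : ∀ s : Store, Halts O c s 3 fun s' =>
    s'.real 6 (s.nat 10 0 0) 0 = g (s.nat 10 0 0) (s.real 5 (s.nat 10 0 0) 0) ∧
    ∀ i ≠ s.nat 10 0 0, s'.real 6 i = s.real 6 i

/-- The matchings of all buckets and the click probabilities, for the reports in array `5`. -/
def clicksProg (c : Prog) : Prog :=
  .seq (.setN 7 (.const 0) (.const 0) (.const 1))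
    (.seq (forN 10 nExpr (.seq c (.setR 7 (nvar 10) (.const 0) (.ofNat (.const 0)))))
      (forN 8 (nvar 4) bucketProg))

/-- Time bound for `clicksProg`. -/
def clicksCost {R : Type*} [CommSemiring R] (n m K B : R) : R :=
  (n * (4 + 2) + 2) + (B * (bucketCost n m K + 2) + 2) + 1

theorem clicksProg_writesNat {O : Oracle} {g : ℕ → ℝ → ℝ} {c : Prog} (hc : ScoreProg O g c) {a : ℕ}
    (h : a < 5 ∨ 13 < a) : (clicksProg c).writesNat a = false := by
  simp [clicksProg, bucketProg, roundProg, bestProg, Prog.writesNat, hc.writesNat]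
  omega

theorem clicksProg_writesReal {O : Oracle} {g : ℕ → ℝ → ℝ} {c : Prog} (hc : ScoreProg O g c) {a : ℕ}
    (h : a < 6 ∨ 8 < a) : (clicksProg c).writesReal a = false := by
  simp [clicksProg, bucketProg, roundProg, bestProg, Prog.writesReal, hc.writesReal]
  omega

theorem clicksProg_halts {O : Oracle} {g : ℕ → ℝ → ℝ} {c : Prog} (hc : ScoreProg O g c) {E : Market}
    {s : Store} {R : ℕ → ℝ} (hE : Holds E s) (hB : s.nat 4 0 0 = E.buckets)
    (hR : ∀ i < E.n, s.real 5 i 0 = R i) :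
    Halts O (clicksProg c) s (clicksCost E.n E.m E.K E.buckets) fun s' =>
      (∀ a < E.buckets, Rep E s' a (E.bucket (Market.scores g R) a)) ∧
      ∀ i < E.n, s'.real 7 i 0 = E.clicks (Market.scores g R) i := by
  refine Halts.setN_seq (Halts.seq (Halts.forN (B := E.n) (N := 4)
    (fun t s' => ∀ i < t, s'.real 6 i 0 = Market.scores g R i ∧ s'.real 7 i 0 = 0)
    (by simp [Prog.writesNat, hc.writesNat]) (fun t s' x h => h) ?_ (by simp) ?_) ?_)
  · intro s' h
    simp only [nExpr, NExpr.eval]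
    rw [h.nat 0 (by simp [Prog.writesNat, hc.writesNat])]
    exact hE.n
  · intro t s' ht hag hI hvar
    refine Halts.seq (hc.halts s') (N₂ := 1) fun s'' hag' h => Halts.setR ?_
    have e10 : s''.nat 10 0 0 = t := by rw [hag'.nat 10 (hc.writesNat _), hvar]
    have e5 : s'.real 5 t 0 = R t := by
      rw [hag.real 5 (by simp [Prog.writesReal, hc.writesReal])]
      exact hR t ht
    have e7 : s''.real 7 = s'.real 7 := hag'.real 7 (by simp [hc.writesReal])
    rw [hvar, e5] at h
    intro i hi
    simp only [Store.setReal_real, nvar_eval, NExpr.eval, RExpr.eval, e10]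
    rcases Nat.lt_succ_iff_lt_or_eq.1 hi with h' | rfl
    · simp [h.2 i h'.ne, hI i h', h'.ne, e7]
    · simp [h.1, Market.scores]
  rintro s₁ - ⟨hag₁, h1⟩
  have hE₁ : Holds E s₁ := Holds.of_agree (s := s.setNat 7 0 0 1) ⟨hE.n, hE.m, hE.K, hE.p⟩ hag₁
    (by simp [Prog.writesNat, hc.writesNat]) (by simp [Prog.writesReal, hc.writesReal])
  have hB₁ : s₁.nat 4 0 0 = E.buckets := by
    rw [hag₁.nat 4 (by simp [Prog.writesNat, hc.writesNat])]; exact hB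
  have h7 : s₁.nat 7 0 0 = 1 := by
    rw [hag₁.nat 7 (by simp [Prog.writesNat, hc.writesNat])]; simp [Store.setNat_nat, NExpr.eval]
  refine (Halts.forN (B := E.buckets) (N := bucketCost E.n E.m E.K) (fun t s' => s'.nat 7 0 0 = 2 ^ t ∧
    (∀ a < t, Rep E s' a (E.bucket (Market.scores g R) a)) ∧ ∀ i < E.n, s'.real 7 i 0 =
      ∑ a ∈ Finset.range t, (E.bucket (Market.scores g R) a).rate E.p i / (2 * E.buckets))
    (by simp [bucketProg, roundProg, bestProg, Prog.writesNat]) ?_ ?_ ?_ ?_).mono le_rfl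
      fun s' h => h.2.2
  · rintro t s' x ⟨i1, i2, i3⟩
    refine ⟨?_, fun a ha => (i2 a ha).congr ?_ ?_, i3⟩
    · rw [Store.setNat_nat_of_ne _ _ _ _ (by decide), i1]
    · rw [Store.setNat_nat_of_ne _ _ _ _ (by decide)]
    · rw [Store.setNat_nat_of_ne _ _ _ _ (by decide)]
  · intro s' h
    rw [nvar_eval, h.nat 4 (by simp [bucketProg, roundProg, bestProg, Prog.writesNat]), hB₁]
  · refine ⟨by simpa using h7, by simp, fun i hi => ?_⟩
    simp [(h1 i hi).2]
  · rintro t s' ht hag ⟨i1, i2, i3⟩ hvar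
    have hE' : Holds E s' := hE₁.of_agree hag
      (by simp [bucketProg, roundProg, bestProg, Prog.writesNat])
      (by simp [bucketProg, roundProg, bestProg, Prog.writesReal])
    have hs' : ∀ i < E.n, s'.real 6 i 0 = Market.scores g R i := by
      intro i hi
      rw [hag.real 6 (by simp [bucketProg, roundProg, bestProg, Prog.writesReal]), (h1 i hi).1]
    have hB' : s'.nat 4 0 0 = E.buckets := by
      rw [hag.nat 4 (by simp [bucketProg, roundProg, bestProg, Prog.writesNat]), hB₁]
    refine (bucketProg_halts hE' hs' hvar i1 hB' i3).mono le_rfl ?_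
    rintro s'' ⟨j1, j2⟩
    refine ⟨by rw [j1, pow_succ]; ring, fun a ha => ?_, fun i hi => ?_⟩
    · rcases Nat.lt_succ_iff_lt_or_eq.1 ha with h' | rfl
      · exact (i2 a h').congr (j2.other5 a h'.ne) (j2.other6 a h'.ne)
      · exact j2.rep
    · rw [j2.clicks i hi, Finset.sum_range_succ]
      rfl

/-! ### The program: the lottery -/

/-- The weight of the current entry of the lottery. -/
def weightProg : Prog :=
  .ite (.leN (nvar 15) (.const 0))
    (.setR 3 (nvar 1) (.const 0) (.div (.ofNat (.const 1)) (.mul (.ofNat (.const 2)) (.ofNat (nvar 4)))))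
    (.ite (.leN (.get 5 (nvar 8) (.sub (nvar 15) (.const 1))) (.const 0))
      (.setR 3 (nvar 1) (.const 0) (.ofNat (.const 0)))
      (.setR 3 (nvar 1) (.const 0)
        (.div (.get 0 (.sub (.get 5 (nvar 8) (.sub (nvar 15) (.const 1))) (.const 1))
          (.sub (nvar 15) (.const 1))) (.mul (.ofNat (.const 2)) (.ofNat (nvar 4))))))

/-- One entry of the lottery; its weight is subtracted from that of the empty allocation in
entry `0`. -/
def entryProg : Prog :=
  .seq weightProg
    (.seq (.setR 3 (.const 0) (.const 0) (.sub (.get 3 (.const 0) (.const 0)) (.get 3 (nvar 1) (.const 0))))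
      (.seq (forN 11 mExpr (.seq (.ite (.leN (nvar 15) (nvar 11))
          (.setN 2 (nvar 1) (nvar 11) (.get 5 (nvar 8) (nvar 11)))
          (.setN 2 (nvar 1) (nvar 11) (.const 0)))
          (.setN 3 (nvar 1) (nvar 11) (nvar 11))))
        (.setN 1 (.const 0) (.const 0) (.add (nvar 1) (.const 1)))))

/-- The lottery: the empty allocation, followed by all suffixes of the matchings of all buckets. -/
def lotteryProg : Prog :=
  .seq (.setR 3 (.const 0) (.const 0) (.ofNat (.const 1)))
    (.seq (.setN 1 (.const 0) (.const 0) (.const 1))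
      (.seq (forN 11 mExpr (.seq (.setN 2 (.const 0) (nvar 11) (.const 0))
        (.setN 3 (.const 0) (nvar 11) (nvar 11))))
      (forN 8 (nvar 4) (forN 15 (.add mExpr (.const 1)) entryProg))))

/-- Time bound for `entryProg`. -/
def entryCost {R : Type*} [CommSemiring R] (m : R) : R := 3 + ((m * 5 + 2) + 1 + 1)

/-- Time bound for `lotteryProg`. -/
def lotteryCost {R : Type*} [CommSemiring R] (m B : R) : R :=
  (m * 4 + 2) + (B * (((m + 1) * (entryCost m + 2) + 2) + 2) + 2) + 1 + 1

/-- The first `t + 1` entries of the lottery are in place. -/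
structure LotteryInv (E : Market) (sc : ℕ → ℝ) (t : ℕ) (s : Store) : Prop where
  len : s.nat 1 0 0 = t + 1
  entry : ∀ l ≤ t, ∀ j < E.m, s.nat 2 l j = E.entry sc l j
  order : ∀ l ≤ t, ∀ j < E.m, s.nat 3 l j = j
  weight : ∀ l < t, s.real 3 (l + 1) 0 = E.weight sc (l + 1)
  rest : s.real 3 0 0 = 1 - ∑ l ∈ Finset.range t, E.weight sc (l + 1)

theorem LotteryInv.congr {E : Market} {sc : ℕ → ℝ} {t : ℕ} {s s' : Store} (h : LotteryInv E sc t s)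
    (h1 : s'.nat 1 = s.nat 1) (h2 : s'.nat 2 = s.nat 2) (h3 : s'.nat 3 = s.nat 3)
    (h4 : s'.real 3 = s.real 3) : LotteryInv E sc t s' := by
  obtain ⟨i1, i2, i3, i4, i5⟩ := h
  exact ⟨by rw [h1, i1], by rwa [h2], by rwa [h3], by rwa [h4], by rw [h4, i5]⟩

theorem entryProg_halts {O : Oracle} {E : Market} {s : Store} {sc : ℕ → ℝ} {t : ℕ} (hE : Holds E s)
    (hB : s.nat 4 0 0 = E.buckets) (ha : s.nat 8 0 0 = t / (E.m + 1))
    (hk : s.nat 15 0 0 = t % (E.m + 1)) (hrep : Rep E s (t / (E.m + 1)) (E.bucket sc (t / (E.m + 1))))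
    (hI : LotteryInv E sc t s) :
    Halts O entryProg s (entryCost E.m) (LotteryInv E sc (t + 1)) := by
  have hklt : t % (E.m + 1) < E.m + 1 := Nat.mod_lt _ (Nat.succ_pos _)
  generalize hka : t / (E.m + 1) = a at *
  generalize hkk : t % (E.m + 1) = k at *
  have hw : E.weight sc (t + 1) = E.bucketWeight sc a k := by rw [Market.weight, hka, hkk]
  have he : ∀ j, E.entry sc (t + 1) j = if k ≤ j then (E.bucket sc a).asg j else 0 := by
    intro j; rw [Market.entry, hka, hkk]
  refine Halts.seq (Q₁ := fun s' => s' = s.setReal 3 (t + 1) 0 (E.weight sc (t + 1))) ?_ ?_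
  · have hb : (BExpr.leN (nvar 15) (.const 0)).Holds O s ↔ k = 0 := by
      simp [BExpr.Holds, hk, NExpr.eval]
    refine Halts.ite (fun hT => ?_) fun hT => ?_
    · rw [hb] at hT
      refine (Halts.setR ?_).weaken (by omega)
      simp [NExpr.eval, RExpr.eval, hI.len, hB, hw, Market.bucketWeight, hT]
    · rw [hb] at hT
      have hasg : s.nat 5 a (k - 1) = (E.bucket sc a).asg (k - 1) := hrep.asg _ (by omega)
      refine Halts.ite (fun hT' => ?_) fun hT' => ?_
      · have h0 : (E.bucket sc a).asg (k - 1) = 0 := by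
          simpa [BExpr.Holds, NExpr.eval, ha, hk, hasg] using hT'
        refine Halts.setR ?_
        simp [NExpr.eval, RExpr.eval, hI.len, hw, Market.bucketWeight, hT, GState.posRate, h0]
      · have h0 : (E.bucket sc a).asg (k - 1) ≠ 0 := by
          simpa [BExpr.Holds, NExpr.eval, ha, hk, hasg] using hT'
        refine Halts.setR ?_
        simp [NExpr.eval, RExpr.eval, hI.len, hw, Market.bucketWeight, hT, GState.posRate, h0, ha, hk,
          hasg, hB, hE.p]
  rintro s₁ - rfl
  refine Halts.setR_seq (Halts.seq (Halts.forN (B := E.m) (N := 3) (fun j' s' =>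
      (∀ l ≤ t, ∀ j < E.m, s'.nat 2 l j = E.entry sc l j) ∧ (∀ l ≤ t, ∀ j < E.m, s'.nat 3 l j = j) ∧
      ∀ j < j', s'.nat 2 (t + 1) j = E.entry sc (t + 1) j ∧ s'.nat 3 (t + 1) j = j)
      (by simp [Prog.writesNat]) ?_ ?_ ?_ ?_) ?_)
  · intro j' s' x h
    simpa [Store.setNat_nat] using h
  · intro s' h
    simp only [mExpr, NExpr.eval]
    rw [h.nat 0 (by simp [Prog.writesNat])]
    exact hE.m
  · exact ⟨hI.entry, hI.order, by simp⟩
  · rintro j s' hj hag ⟨i1, i2, i3⟩ hvar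
    have e1 : s'.nat 1 0 0 = t + 1 := by rw [hag.nat 1 (by simp [Prog.writesNat])]; exact hI.len
    have e5 : s'.nat 5 a j = (E.bucket sc a).asg j := by
      rw [hag.nat 5 (by simp [Prog.writesNat])]; exact hrep.asg j hj
    have e8 : s'.nat 8 0 0 = a := by rw [hag.nat 8 (by simp [Prog.writesNat])]; exact ha
    have e15 : s'.nat 15 0 0 = k := by rw [hag.nat 15 (by simp [Prog.writesNat])]; exact hk
    refine Halts.seq (N₁ := 2) (N₂ := 1) (Q₁ := fun s'' => s'' = s'.setNat 2 (t + 1) j (E.entry sc (t + 1) j))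
      (Halts.ite (fun hT => ?_) fun hT => ?_) ?_
    · have hT : k ≤ j := by simpa [BExpr.Holds, e15, hvar] using hT
      refine Halts.setN ?_
      simp [NExpr.eval, e1, e8, hvar, e5, he, hT]
    · have hT : ¬ k ≤ j := by simpa [BExpr.Holds, e15, hvar] using hT
      refine Halts.setN ?_
      simp [NExpr.eval, e1, hvar, he, hT]
    · rintro s'' - rfl
      have hv1 : (nvar 1).eval (s'.setNat 2 (t + 1) j (E.entry sc (t + 1) j)) = t + 1 := by
        simp [Store.setNat_nat, e1]
      have hv11 : (nvar 11).eval (s'.setNat 2 (t + 1) j (E.entry sc (t + 1) j)) = j := by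
        simp [Store.setNat_nat, hvar]
      refine Halts.setN ?_
      rw [hv1, hv11]
      refine ⟨fun l hl j' hj' => ?_, fun l hl j' hj' => ?_, fun j' hj' => ?_⟩
      · have : l ≠ t + 1 := by omega
        simp [Store.setNat_nat, this, i1 l hl j' hj']
      · have : l ≠ t + 1 := by omega
        simp [Store.setNat_nat, this, i2 l hl j' hj']
      · rcases Nat.lt_succ_iff_lt_or_eq.1 hj' with h | rfl
        · simp [Store.setNat_nat, h.ne, i3 j' h]
        · simp [Store.setNat_nat]
  rintro s₂ - ⟨hag, i1, i2, i3⟩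
  have e1 : s₂.nat 1 0 0 = t + 1 := by rw [hag.nat 1 (by simp [Prog.writesNat])]; exact hI.len
  have r3 := hag.real 3 (by simp [Prog.writesReal])
  refine Halts.setN ⟨?_, fun l hl j hj => ?_, fun l hl j hj => ?_, fun l hl => ?_, ?_⟩
  · simp [Store.setNat_nat, NExpr.eval, e1]
  · rw [Store.setNat_nat_of_ne _ _ _ _ (by decide)]
    rcases Nat.le_succ_iff.1 hl with h | rfl
    · exact i1 l h j hj
    · exact (i3 j hj).1
  · rw [Store.setNat_nat_of_ne _ _ _ _ (by decide)]
    rcases Nat.le_succ_iff.1 hl with h | rfl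
    · exact i2 l h j hj
    · exact (i3 j hj).2
  · rw [Store.setNat_real, r3]
    simp only [Store.setReal_real, NExpr.eval]
    rcases Nat.lt_succ_iff_lt_or_eq.1 hl with h | rfl
    · simp [h.ne, hI.weight l h]
    · simp
  · rw [Store.setNat_real, r3, Finset.sum_range_succ]
    have hv1 : ∀ x, (nvar 1).eval (s.setReal 3 (t + 1) 0 x) = t + 1 := fun x => hI.len
    simp only [Store.setReal_real, NExpr.eval, RExpr.eval, hv1]
    simp [hI.rest]
    ring

theorem lotteryProg_writesNat {a : ℕ} (h : a = 0 ∨ a = 4 ∨ a = 14) : lotteryProg.writesNat a = false := by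
  simp [lotteryProg, entryProg, weightProg, Prog.writesNat]
  omega

theorem lotteryProg_writesReal {a : ℕ} (h : a ≠ 3) : lotteryProg.writesReal a = false := by
  simp [lotteryProg, entryProg, weightProg, Prog.writesReal, h]

theorem lotteryProg_halts {O : Oracle} {E : Market} {s : Store} {sc : ℕ → ℝ} (hE : Holds E s)
    (hB : s.nat 4 0 0 = E.buckets) (hrep : ∀ a < E.buckets, Rep E s a (E.bucket sc a)) :
    Halts O lotteryProg s (lotteryCost E.m E.buckets)
      (LotteryInv E sc (E.buckets * (E.m + 1))) := by
  refine Halts.setR_seq (Halts.setN_seq (Halts.seq (Halts.forN (B := E.m) (N := 2) (fun j' s' =>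
      ∀ j < j', s'.nat 2 0 j = 0 ∧ s'.nat 3 0 j = j) (by simp [Prog.writesNat]) ?_ ?_ ?_ ?_) ?_))
  · intro j' s' x h
    simpa [Store.setNat_nat] using h
  · intro s' h
    simp only [mExpr, NExpr.eval]
    rw [h.nat 0 (by simp [Prog.writesNat])]
    exact hE.m
  · simp
  · intro j s' hj hag hI hvar
    refine Halts.setN_seq (N := 1) (Halts.setN fun j' hj' => ?_)
    rcases Nat.lt_succ_iff_lt_or_eq.1 hj' with h | rfl
    · simp [Store.setNat_nat, NExpr.eval, hvar, h.ne, hI j' h]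
    · simp [Store.setNat_nat, NExpr.eval, hvar]
  rintro s₁ - ⟨hag, h1⟩
  have hN : ∀ k, k ≠ 1 → k ≠ 2 → k ≠ 3 → k ≠ 11 → s₁.nat k = s.nat k := by
    intro k k1 k2 k3 k11
    rw [hag.nat k (by simp [Prog.writesNat, k2, k3, k11]), Store.setNat_nat_of_ne _ _ _ _ k1]
    rfl
  have hE₁ : Holds E s₁ := by
    have e := hN 0 (by decide) (by decide) (by decide) (by decide)
    refine ⟨by rw [e, hE.n], by rw [e, hE.m], by rw [e, hE.K], ?_⟩
    rw [hag.real 0 (by simp [Prog.writesReal]), Store.setNat_real,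
      Store.setReal_real_of_ne _ _ _ _ (by decide), hE.p]
  have hB₁ : s₁.nat 4 0 0 = E.buckets := by
    rw [hN 4 (by decide) (by decide) (by decide) (by decide), hB]
  have hrep₁ : ∀ a < E.buckets, Rep E s₁ a (E.bucket sc a) := fun a ha => (hrep a ha).congr
    (by rw [hN 5 (by decide) (by decide) (by decide) (by decide)])
    (by rw [hN 6 (by decide) (by decide) (by decide) (by decide)])
  have hI₁ : LotteryInv E sc 0 s₁ := by
    refine ⟨?_, fun l hl j hj => ?_, fun l hl j hj => ?_, by simp, ?_⟩
    · rw [hag.nat 1 (by simp [Prog.writesNat])]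
      simp [Store.setNat_nat, NExpr.eval]
    · obtain rfl : l = 0 := by omega
      rw [(h1 j hj).1, Market.entry]
    · obtain rfl : l = 0 := by omega
      rw [(h1 j hj).2]
    · rw [hag.real 3 (by simp [Prog.writesReal])]
      simp [Store.setReal_real, NExpr.eval, RExpr.eval]
  refine (Halts.forN (B := E.buckets) (N := (E.m + 1) * (entryCost E.m + 2) + 2)
    (fun a s' => LotteryInv E sc (a * (E.m + 1)) s')
    (by simp [entryProg, weightProg, Prog.writesNat]) ?_ ?_ (by simpa using hI₁) ?_).mono le_rfl
      fun s' h => h.2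
  · intro t s' x h
    exact h.congr (Store.setNat_nat_of_ne _ _ _ _ (by decide)) (Store.setNat_nat_of_ne _ _ _ _ (by decide))
      (Store.setNat_nat_of_ne _ _ _ _ (by decide)) rfl
  · intro s' h
    rw [nvar_eval, h.nat 4 (by simp [entryProg, weightProg, Prog.writesNat]), hB₁]
  intro a s₂ ha hag₂ hI₂ hvar
  refine (Halts.forN (B := E.m + 1) (N := entryCost E.m)
    (fun k s' => LotteryInv E sc (a * (E.m + 1) + k) s')
    (by simp [entryProg, weightProg, Prog.writesNat]) ?_ ?_ (by simpa using hI₂) ?_).mono le_rfl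
      fun s' h => ?_
  · intro t s' x h
    exact h.congr (Store.setNat_nat_of_ne _ _ _ _ (by decide)) (Store.setNat_nat_of_ne _ _ _ _ (by decide))
      (Store.setNat_nat_of_ne _ _ _ _ (by decide)) rfl
  · intro s' h
    simp only [mExpr, NExpr.eval]
    rw [h.nat 0 (by simp [entryProg, weightProg, Prog.writesNat]),
      hag₂.nat 0 (by simp [entryProg, weightProg, Prog.writesNat]), hE₁.m]
  · intro k s₃ hk hag₃ hI₃ hvar'
    have hN₃ : ∀ x, x ≠ 1 → x ≠ 2 → x ≠ 3 → x ≠ 11 → x ≠ 15 → x ≠ 8 → s₃.nat x = s₁.nat x := by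
      intro x x1 x2 x3 x11 x15 x8
      rw [hag₃.nat x (by simp [entryProg, weightProg, Prog.writesNat, x1, x2, x3, x11, x15]),
        hag₂.nat x (by simp [entryProg, weightProg, Prog.writesNat, x1, x2, x3, x11, x15, x8])]
    have hdiv : (a * (E.m + 1) + k) / (E.m + 1) = a := by
      rw [mul_comm, Nat.mul_add_div (Nat.succ_pos _), Nat.div_eq_of_lt hk, add_zero]
    have hmod : (a * (E.m + 1) + k) % (E.m + 1) = k := by
      rw [mul_comm, Nat.mul_add_mod, Nat.mod_eq_of_lt hk]
    refine entryProg_halts (t := a * (E.m + 1) + k) ?_ ?_ ?_ ?_ ?_ hI₃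
    · have e := hN₃ 0 (by decide) (by decide) (by decide) (by decide) (by decide) (by decide)
      refine ⟨by rw [e, hE₁.n], by rw [e, hE₁.m], by rw [e, hE₁.K], ?_⟩
      rw [hag₃.real 0 (by simp [entryProg, weightProg, Prog.writesReal]),
        hag₂.real 0 (by simp [entryProg, weightProg, Prog.writesReal]), hE₁.p]
    · rw [hN₃ 4 (by decide) (by decide) (by decide) (by decide) (by decide) (by decide), hB₁]
    · rw [hag₃.nat 8 (by simp [entryProg, weightProg, Prog.writesNat]), hvar, hdiv]
    · rw [hvar', hmod]
    · rw [hdiv]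
      exact (hrep₁ a ha).congr
        (by rw [hN₃ 5 (by decide) (by decide) (by decide) (by decide) (by decide) (by decide)])
        (by rw [hN₃ 6 (by decide) (by decide) (by decide) (by decide) (by decide) (by decide)])
  · rw [Nat.succ_mul]; exact h.2

/-! ### The program: the payments -/

/-- One round of the payment computation for the current advertiser. -/
def payStepProg (c : Prog) : Prog :=
  .ite (.leR (.sub (rvar 10) (rvar 11)) (.get 2 (.const 0) (.const 0)))
    (.seq (.setR 4 (nvar 14) (.const 0)
        (.add (.get 4 (nvar 14) (.const 0)) (.mul (.sub (rvar 9) (rvar 12)) (rvar 10))))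
      (.seq (.setR 9 (.const 0) (.const 0) (rvar 12))
        (.seq (.setR 10 (.const 0) (.const 0) (rvar 11))
          (.seq (.setR 11 (.const 0) (.const 0) (.ofNat (.const 0)))
            (.setR 12 (.const 0) (.const 0) (.ofNat (.const 0)))))))
    (.seq (.setR 5 (nvar 14) (.const 0) (.div (.add (rvar 11) (rvar 10)) (.ofNat (.const 2))))
      (.seq (clicksProg c)
        (.ite (.leR (rvar 9) (.get 7 (nvar 14) (.const 0)))
          (.setR 10 (.const 0) (.const 0) (.get 5 (nvar 14) (.const 0)))
          (.seq (.setR 11 (.const 0) (.const 0) (.get 5 (nvar 14) (.const 0)))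
            (.setR 12 (.const 0) (.const 0) (.get 7 (nvar 14) (.const 0)))))))

/-- The payments of all advertisers. Array `5` holds the hypothetical reports at which click
probabilities are computed; it is restored after each advertiser. -/
def payProg (c : Prog) : Prog :=
  forN 14 nExpr
    (.seq (clicksProg c)
      (.seq (.setR 9 (.const 0) (.const 0) (.get 7 (nvar 14) (.const 0)))
        (.seq (.setR 10 (.const 0) (.const 0) (.get 1 (nvar 14) (.const 0)))
          (.seq (.setR 11 (.const 0) (.const 0) (.ofNat (.const 0)))
            (.seq (.setR 12 (.const 0) (.const 0) (.ofNat (.const 0)))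
              (.seq (.setR 4 (nvar 14) (.const 0) (.ofNat (.const 0)))
                (.seq (.loop (.neg (.leR (rvar 9) (.ofNat (.const 0)))) (payStepProg c))
                  (.setR 5 (nvar 14) (.const 0) (.get 1 (nvar 14) (.const 0))))))))))

/-- Time bound for `payProg`, if the numbers `⌈v i / ε⌉` have at most `β` digits. -/
def payCost {R : Type*} [CommSemiring R] (n m K B β : R) : R :=
  n * ((clicksCost n m K B + (((B * m + 1) * (β + 1) * (clicksCost n m K B + 5 + 1 + 1) + 1) + 1 + 1 + 1
    + 1 + 1 + 1)) + 2) + 2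

/-- The memory holds the state `P` of the payment computation for advertiser `i` at reports `R`; the
payments of the other advertisers are those in `s₀`. -/
structure PayRel (E : Market) (ε : ℝ) (R : ℕ → ℝ) (i : ℕ) (s₀ : Store) (P : PayState) (s : Store) :
    Prop where
  holds : Holds E s
  buckets : s.nat 4 0 0 = E.buckets
  agent : s.nat 14 0 0 = i
  accuracy : s.real 2 0 0 = ε
  input : s.real 1 = s₀.real 1
  reports : ∀ k < E.n, k ≠ i → s.real 5 k 0 = R k
  paid : s.real 4 i 0 = P.paid
  other : ∀ k ≠ i, s.real 4 k = s₀.real 4 k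
  a : s.real 9 0 0 = P.a
  hi : s.real 10 0 0 = P.hi
  lo : s.real 11 0 0 = P.lo
  ylo : s.real 12 0 0 = P.ylo

theorem payStepProg_halts {O : Oracle} {g : ℕ → ℝ → ℝ} {c : Prog} (hc : ScoreProg O g c) {E : Market}
    {ε : ℝ} {R : ℕ → ℝ} {i : ℕ} (hi : i < E.n) {s₀ s : Store} {P : PayState} (hP : ¬ P.a ≤ 0)
    (h : PayRel E ε R i s₀ P s) :
    Halts O (payStepProg c) s (clicksCost E.n E.m E.K E.buckets + 5 + 1)
      (PayRel E ε R i s₀ (payStep ε (E.curve g R i) P)) := by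
  have htest : (BExpr.leR (.sub (rvar 10) (rvar 11)) (.get 2 (.const 0) (.const 0))).Holds O s ↔
      P.hi - P.lo ≤ ε := by
    simp [BExpr.Holds, RExpr.eval, NExpr.eval, h.hi, h.lo, h.accuracy]
  refine Halts.ite (fun hT => ?_) fun hT => ?_
  · rw [htest] at hT
    rw [payStep, if_neg hP, if_pos hT]
    refine (Halts.setR_seq (Halts.setR_seq (Halts.setR_seq (Halts.setR_seq (N := 1)
      (Halts.setR ?_))))).weaken (by omega)
    refine ⟨⟨h.holds.n, h.holds.m, h.holds.K, ?_⟩, h.buckets, h.agent, ?_, ?_, fun k hk hki => ?_, ?_,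
      fun k hk => ?_, ?_, ?_, ?_, ?_⟩
    · simp [Store.setReal_real_of_ne, h.holds.p]
    · simp [Store.setReal_real_of_ne, h.accuracy]
    · simp [Store.setReal_real_of_ne, h.input]
    · simp [Store.setReal_real_of_ne, h.reports k hk hki]
    · simp [Store.setReal_real, RExpr.eval, NExpr.eval, h.agent, h.paid, h.a, h.ylo, h.hi]
    · funext j
      simp [Store.setReal_real, NExpr.eval, h.agent, hk, h.other k hk]
    · simp [Store.setReal_real, RExpr.eval, NExpr.eval, h.ylo]
    · simp [Store.setReal_real, RExpr.eval, NExpr.eval, h.lo]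
    · simp [Store.setReal_real, RExpr.eval, NExpr.eval]
    · simp [Store.setReal_real, RExpr.eval, NExpr.eval]
  · rw [htest] at hT
    rw [payStep, if_neg hP, if_neg hT]
    refine (Halts.setR_seq (N := clicksCost E.n E.m E.K E.buckets + 3) (Halts.seq (N₂ := 3)
      (clicksProg_halts hc (E := E) (R := Function.update R i ((P.lo + P.hi) / 2)) ?_ ?_ ?_) ?_)).weaken
        (by omega)
    · exact ⟨h.holds.n, h.holds.m, h.holds.K, by simp [Store.setReal_real_of_ne, h.holds.p]⟩
    · exact h.buckets
    · intro k hk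
      simp only [Store.setReal_real, RExpr.eval, NExpr.eval, nvar_eval, rvar_eval, h.agent, h.lo, h.hi,
        Function.update_apply]
      by_cases hki : k = i
      · simp [hki]
      · simp [hki, h.reports k hk hki]
    rintro s₁ hag ⟨-, hcl⟩
    have hcurve : s₁.real 7 i 0 = E.curve g R i ((P.lo + P.hi) / 2) := hcl i hi
    have w : ∀ k, k < 5 ∨ 13 < k → s₁.nat k = s.nat k := fun k hk =>
      (hag.nat k (clicksProg_writesNat hc hk)).trans rfl
    have wr : ∀ k, (k < 6 ∨ 8 < k) → k ≠ 5 → s₁.real k = s.real k := fun k hk h5 =>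
      (hag.real k (clicksProg_writesReal hc hk)).trans (Store.setReal_real_of_ne _ _ _ _ h5)
    have w5 : ∀ k, s₁.real 5 k 0 = if k = i then (P.lo + P.hi) / 2 else s.real 5 k 0 := by
      intro k
      rw [hag.real 5 (clicksProg_writesReal hc (by omega))]
      simp [Store.setReal_real, RExpr.eval, NExpr.eval, h.agent, h.lo, h.hi]
    have e14 : s₁.nat 14 0 0 = i := by rw [w 14 (by omega), h.agent]
    have e9 : s₁.real 9 0 0 = P.a := by rw [wr 9 (by omega) (by omega), h.a]
    have base : PayRel E ε R i s₀ P s₁ := by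
      refine ⟨⟨?_, ?_, ?_, ?_⟩, ?_, e14, ?_, ?_, fun k hk hki => ?_, ?_, fun k hk => ?_, e9, ?_, ?_, ?_⟩
      · rw [w 0 (by omega), h.holds.n]
      · rw [w 0 (by omega), h.holds.m]
      · rw [w 0 (by omega), h.holds.K]
      · rw [wr 0 (by omega) (by omega), h.holds.p]
      · rw [w 4 (by omega), h.buckets]
      · rw [wr 2 (by omega) (by omega), h.accuracy]
      · rw [wr 1 (by omega) (by omega), h.input]
      · rw [w5, if_neg hki, h.reports k hk hki]
      · rw [wr 4 (by omega) (by omega), h.paid]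
      · rw [wr 4 (by omega) (by omega), h.other k hk]
      · rw [wr 10 (by omega) (by omega), h.hi]
      · rw [wr 11 (by omega) (by omega), h.lo]
      · rw [wr 12 (by omega) (by omega), h.ylo]
    have e5 : s₁.real 5 i 0 = (P.lo + P.hi) / 2 := by rw [w5, if_pos rfl]
    have htest' : (BExpr.leR (rvar 9) (.get 7 (nvar 14) (.const 0))).Holds O s₁ ↔
        P.a ≤ E.curve g R i ((P.lo + P.hi) / 2) := by
      simp [BExpr.Holds, RExpr.eval, NExpr.eval, e9, e14, hcurve]
    refine Halts.ite (fun hT' => ?_) fun hT' => ?_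
    · rw [htest'] at hT'
      rw [if_pos hT']
      refine (Halts.setR ?_).weaken (by omega)
      obtain ⟨⟨b1, b2, b3, b4⟩, b5, b6, b7, b8, b9, b10, b11, b12, b13, b14, b15⟩ := base
      refine ⟨⟨b1, b2, b3, ?_⟩, b5, b6, ?_, ?_, fun k hk hki => ?_, ?_, fun k hk => ?_, ?_, ?_, ?_, ?_⟩
      · simp [Store.setReal_real_of_ne, b4]
      · simp [Store.setReal_real_of_ne, b7]
      · simp [Store.setReal_real_of_ne, b8]
      · simp [Store.setReal_real_of_ne, b9 k hk hki]
      · simp [Store.setReal_real_of_ne, b10]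
      · simp [Store.setReal_real_of_ne, b11 k hk]
      · simp [Store.setReal_real_of_ne, b12]
      · simp [Store.setReal_real, RExpr.eval, NExpr.eval, e14, e5]
      · simp [Store.setReal_real_of_ne, b14]
      · simp [Store.setReal_real_of_ne, b15]
    · rw [htest'] at hT'
      rw [if_neg hT']
      refine Halts.setR_seq (N := 1) (Halts.setR ?_)
      obtain ⟨⟨b1, b2, b3, b4⟩, b5, b6, b7, b8, b9, b10, b11, b12, b13, b14, b15⟩ := base
      refine ⟨⟨b1, b2, b3, ?_⟩, b5, b6, ?_, ?_, fun k hk hki => ?_, ?_, fun k hk => ?_, ?_, ?_, ?_, ?_⟩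
      · simp [Store.setReal_real_of_ne, b4]
      · simp [Store.setReal_real_of_ne, b7]
      · simp [Store.setReal_real_of_ne, b8]
      · simp [Store.setReal_real_of_ne, b9 k hk hki]
      · simp [Store.setReal_real_of_ne, b10]
      · simp [Store.setReal_real_of_ne, b11 k hk]
      · simp [Store.setReal_real_of_ne, b12]
      · simp [Store.setReal_real_of_ne, b13]
      · simp [Store.setReal_real, RExpr.eval, NExpr.eval, e14, e5]
      · simp [Store.setReal_real, RExpr.eval, NExpr.eval, e14, hcurve]

theorem payStepProg_writesNat {O : Oracle} {g : ℕ → ℝ → ℝ} {c : Prog} (hc : ScoreProg O g c) {a : ℕ}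
    (h : a < 5 ∨ 13 < a) : (payStepProg c).writesNat a = false := by
  simp [payStepProg, Prog.writesNat, clicksProg_writesNat hc h]

theorem payProg_writesNat {O : Oracle} {g : ℕ → ℝ → ℝ} {c : Prog} (hc : ScoreProg O g c) {a : ℕ}
    (h : a < 5 ∨ 14 < a) : (payProg c).writesNat a = false := by
  have h' : a < 5 ∨ 13 < a := by omega
  simp [payProg, Prog.writesNat, clicksProg_writesNat hc h', payStepProg_writesNat hc h']
  omega

theorem payProg_writesReal {O : Oracle} {g : ℕ → ℝ → ℝ} {c : Prog} (hc : ScoreProg O g c) {a : ℕ}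
    (h : a < 4 ∨ 12 < a) : (payProg c).writesReal a = false := by
  have h' : a < 6 ∨ 8 < a := by omega
  simp [payProg, payStepProg, Prog.writesReal, clicksProg_writesReal hc h']
  omega

theorem payProg_halts {O : Oracle} {g : ℕ → ℝ → ℝ} {c : Prog} (hc : ScoreProg O g c) {E : Market}
    (hp : ∀ i j, 0 ≤ E.p i j) (hg : Market.IsScore g) {ε : ℝ} (hε : 0 < ε) {R : ℕ → ℝ} {β : ℕ}
    (hβ : ∀ i < E.n, Nat.size ⌈R i / ε⌉₊ ≤ β) (hR0 : ∀ i, 0 ≤ R i) {s : Store} (hE : Holds E s)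
    (hB : s.nat 4 0 0 = E.buckets) (hε' : s.real 2 0 0 = ε) (h1 : ∀ i < E.n, s.real 1 i 0 = R i)
    (h5 : ∀ i < E.n, s.real 5 i 0 = R i) :
    Halts O (payProg c) s (payCost E.n E.m E.K E.buckets β) fun s' =>
      ∀ i < E.n, s'.real 4 i 0 = E.payment g ε R i := by
  have hcN : ∀ {k}, (k < 5 ∨ 14 < k) → (payProg c).writesNat k = false := payProg_writesNat hc
  have hcR : ∀ {k}, (k < 4 ∨ 12 < k) → (payProg c).writesReal k = false := payProg_writesReal hc
  refine (Halts.forN (B := E.n) (N := clicksCost E.n E.m E.K E.buckets +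
      (((E.buckets * E.m + 1) * (β + 1) * (clicksCost E.n E.m E.K E.buckets + 5 + 1 + 1) + 1) + 1 + 1 + 1
        + 1 + 1 + 1))
    (fun t s' => (∀ k < E.n, s'.real 5 k 0 = R k) ∧ ∀ i < t, s'.real 4 i 0 = E.payment g ε R i)
    ?_ (fun t s' x h => h) ?_ ⟨h5, by simp⟩ ?_).mono le_rfl fun s' h => h.2.2
  · simp [Prog.writesNat, clicksProg_writesNat hc (show 14 < 5 ∨ 13 < 14 by omega),
      payStepProg_writesNat hc (show 14 < 5 ∨ 13 < 14 by omega)]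
  · intro s' h
    simp only [nExpr, NExpr.eval]
    rw [h.nat 0 (hcN (by omega)), hE.n]
  rintro i s₁ hi hag ⟨hR, hpaid⟩ hvar
  have hE₁ : Holds E s₁ := hE.of_agree hag (hcN (by omega)) (hcR (by omega))
  have hB₁ : s₁.nat 4 0 0 = E.buckets := by rw [hag.nat 4 (hcN (by omega)), hB]
  refine Halts.seq (clicksProg_halts hc hE₁ hB₁ hR) ?_
  rintro s₂ hag₂ ⟨-, hcl⟩
  have w : ∀ k, k < 5 ∨ 13 < k → s₂.nat k = s₁.nat k := fun k hk =>
    hag₂.nat k (clicksProg_writesNat hc hk)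
  have wr : ∀ k, (k < 6 ∨ 8 < k) → s₂.real k = s₁.real k := fun k hk =>
    hag₂.real k (clicksProg_writesReal hc hk)
  have e14 : s₂.nat 14 0 0 = i := by rw [w 14 (by omega), hvar]
  have e1 : s₂.real 1 i 0 = R i := by
    rw [wr 1 (by omega), hag.real 1 (hcR (by omega)), h1 i hi]
  refine Halts.setR_seq (Halts.setR_seq (Halts.setR_seq (Halts.setR_seq (Halts.setR_seq
    (Halts.seq (N₂ := 1) ((Halts.loop (PayRel E ε R i s₂) (fun P => P.a ≤ 0) (payStep ε (E.curve g R i))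
      ?_ (fun P hP => payStep_done _ _ _ hP) (fun P s' hP h => payStepProg_halts hc hi hP h)
      (E.rounds ε (R i)) (payInit (E.curve g R i) (R i)) _ (Market.pay_rounds_done hp hg hε R i (hR0 i))
      ?_).weaken ?_) ?_)))))
  · intro P s' h
    simp [BExpr.Holds, RExpr.eval, NExpr.eval, h.a]
  · refine ⟨⟨?_, ?_, ?_, ?_⟩, ?_, e14, ?_, ?_, fun k hk hki => ?_, ?_, fun k hk => ?_, ?_, ?_, ?_, ?_⟩
    · simp [w 0 (by omega), hE₁.n]
    · simp [w 0 (by omega), hE₁.m]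
    · simp [w 0 (by omega), hE₁.K]
    · simp [Store.setReal_real_of_ne, wr 0 (by omega), hE₁.p]
    · simp [w 4 (by omega), hB₁]
    · simp [Store.setReal_real_of_ne, wr 2 (by omega), hag.real 2 (hcR (by omega)), hε']
    · simp [Store.setReal_real_of_ne]
    · simp [Store.setReal_real_of_ne, wr 5 (by omega), hR k hk]
    · simp [Store.setReal_real, NExpr.eval, RExpr.eval, e14, payInit]
    · funext j
      simp [Store.setReal_real, NExpr.eval, e14, hk]
    · simp [Store.setReal_real, NExpr.eval, RExpr.eval, e14, payInit, hcl i hi, Market.curve_self]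
    · simp [Store.setReal_real, NExpr.eval, RExpr.eval, e14, payInit, e1]
    · simp [Store.setReal_real, NExpr.eval, RExpr.eval, payInit]
    · simp [Store.setReal_real, NExpr.eval, RExpr.eval, payInit]
  · refine Nat.add_le_add_right (Nat.mul_le_mul_right _ (Nat.mul_le_mul_left _ ?_)) 1
    exact Nat.succ_le_succ (hβ i hi)
  rintro s₃ - h
  refine Halts.setR ⟨fun k hk => ?_, fun k hk => ?_⟩
  · simp only [Store.setReal_real, RExpr.eval, NExpr.eval, nvar_eval, h.agent, h.input, e1]
    by_cases hki : k = i
    · simp [hki]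
    · simp [hki, h.reports k hk hki]
  · rw [Store.setReal_real_of_ne _ _ _ _ (by decide)]
    rcases Nat.lt_succ_iff_lt_or_eq.1 hk with h' | rfl
    · rw [h.other k h'.ne, wr 4 (by omega), hpaid k h']
    · exact h.paid

/-! ### The program: initialization and the whole auction -/

/-- The number of buckets: the natural variable `7` runs through the powers of two up to the first one
that exceeds `m`. -/
def initProg : Prog :=
  .seq (.setN 7 (.const 0) (.const 0) (.const 1))
    (.seq (.setN 4 (.const 0) (.const 0) (.const 1))
      (forN 11 mExpr (.ite (.leN (nvar 7) mExpr)
        (.seq (.setN 7 (.const 0) (.const 0) (.add (nvar 7) (nvar 7)))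
          (.setN 4 (.const 0) (.const 0) (.add (nvar 4) (.const 1))))
        .skip)))

/-- Time bound for `initProg`. -/
def initCost {R : Type*} [CommSemiring R] (m : R) : R := m * (3 + 2) + 2 + 1 + 1

theorem initProg_halts {O : Oracle} {E : Market} {s : Store} (hE : Holds E s) :
    Halts O initProg s (initCost E.m) fun s' => s'.nat 4 0 0 = E.buckets := by
  refine Halts.setN_seq (Halts.setN_seq ((Halts.forN (B := E.m) (N := 3) (fun t s' =>
    s'.nat 4 0 0 = min t (Nat.size E.m) + 1 ∧ s'.nat 7 0 0 = 2 ^ min t (Nat.size E.m))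
      (by simp [Prog.writesNat]) ?_ ?_ ?_ ?_).mono le_rfl fun s' h => ?_))
  · intro t s' x h
    simpa [Store.setNat_nat_of_ne] using h
  · intro s' h
    simp only [mExpr, NExpr.eval]
    rw [h.nat 0 (by simp [Prog.writesNat])]
    exact hE.m
  · simp [Store.setNat_nat, NExpr.eval]
  · rintro t s' - hag ⟨h4, h7⟩ -
    have e0 : s'.nat 0 0 1 = E.m := by
      rw [hag.nat 0 (by simp [Prog.writesNat])]
      exact hE.m
    refine Halts.ite (N := 2) (fun hT => ?_) fun hT => ?_
    · have hlt : t < Nat.size E.m := by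
        by_contra hc
        simp only [BExpr.Holds, nvar_eval, mExpr, NExpr.eval, e0, h7, min_eq_right (not_lt.1 hc)] at hT
        exact absurd hT (not_le.2 (Nat.lt_size_self E.m))
      rw [min_eq_left hlt.le] at h4 h7
      refine Halts.setN_seq (N := 1) (Halts.setN ?_)
      rw [min_eq_left hlt]
      simp [Store.setNat_nat, NExpr.eval, h4, h7, pow_succ, mul_two]
    · have hle : Nat.size E.m ≤ t := by
        by_contra hc
        refine hT ?_
        simp only [BExpr.Holds, nvar_eval, mExpr, NExpr.eval, e0, h7, min_eq_left (not_le.1 hc).le]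
        exact Nat.lt_size.1 (not_le.1 hc)
      refine (Halts.skip ?_).weaken (by omega)
      rw [min_eq_right (hle.trans t.le_succ)]
      rw [min_eq_right hle] at h4 h7
      exact ⟨h4, h7⟩
  · rw [h.2.1, min_eq_right (Nat.size_le.2 Nat.lt_two_pow_self), Market.buckets]

/-- The reports are copied to array `5`, where the payment computation changes them. -/
def copyProg : Prog := forN 10 nExpr (.setR 5 (nvar 10) (.const 0) (.get 1 (nvar 10) (.const 0)))

theorem copyProg_halts {O : Oracle} {E : Market} {s : Store} (hE : Holds E s) :
    Halts O copyProg s (E.n * 3 + 2) fun s' => ∀ i < E.n, s'.real 5 i 0 = s.real 1 i 0 := by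
  refine (Halts.forN (B := E.n) (N := 1) (fun t s' => ∀ i < t, s'.real 5 i 0 = s.real 1 i 0)
    (by simp [Prog.writesNat]) (fun t s' x h => h) ?_ (by simp) ?_).mono le_rfl fun s' h => h.2
  · intro s' h
    simp only [nExpr, NExpr.eval]
    rw [h.nat 0 (by simp [Prog.writesNat]), hE.n]
  · intro t s' ht hag hI hvar
    refine Halts.setR fun i hi => ?_
    have e1 : s'.real 1 = s.real 1 := hag.real 1 (by simp [Prog.writesReal])
    rcases Nat.lt_succ_iff_lt_or_eq.1 hi with h | rfl
    · simp [Store.setReal_real, NExpr.eval, hvar, h.ne, hI i h]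
    · simp [Store.setReal_real, NExpr.eval, RExpr.eval, hvar, e1]

/-- The auction whose scores are computed by `c`. -/
def auctionProg (c : Prog) : Prog :=
  .seq initProg (.seq copyProg (.seq (clicksProg c) (.seq lotteryProg (payProg c))))

/-- Time bound for `auctionProg`, if the numbers `⌈v i / ε⌉` have at most `β` digits. -/
def auctionCost {R : Type*} [CommSemiring R] (n m K B β : R) : R :=
  initCost m + ((n * 3 + 2) + (clicksCost n m K B + (lotteryCost m B + payCost n m K B β)))

theorem auctionProg_halts {O : Oracle} {g : ℕ → ℝ → ℝ} {c : Prog} (hc : ScoreProg O g c) {E : Market}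
    (hp : ∀ i j, 0 ≤ E.p i j) (hg : Market.IsScore g) {ε : ℝ} (hε : 0 < ε) {R : ℕ → ℝ} {β : ℕ}
    (hβ : ∀ i < E.n, Nat.size ⌈R i / ε⌉₊ ≤ β) (hR0 : ∀ i, 0 ≤ R i) {s : Store} (hE : Holds E s)
    (hε' : s.real 2 0 0 = ε) (h1 : ∀ i < E.n, s.real 1 i 0 = R i) :
    Halts O (auctionProg c) s (auctionCost E.n E.m E.K E.buckets β) fun s' =>
      LotteryInv E (Market.scores g R) (E.buckets * (E.m + 1)) s' ∧
      ∀ i < E.n, s'.real 4 i 0 = E.payment g ε R i := by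
  refine Halts.seq (initProg_halts hE) fun s₁ a₁ hB₁ => ?_
  have hE₁ := hE.of_agree a₁ (by simp [initProg, Prog.writesNat]) (by simp [initProg, Prog.writesReal])
  have r₁ : s₁.real = s.real := funext fun k => a₁.real k (by simp [initProg, Prog.writesReal])
  refine Halts.seq (copyProg_halts hE₁) fun s₂ a₂ h5₂ => ?_
  have hE₂ := hE₁.of_agree a₂ (by simp [copyProg, Prog.writesNat]) (by simp [copyProg, Prog.writesReal])
  have hB₂ : s₂.nat 4 0 0 = E.buckets := by rw [a₂.nat 4 (by simp [copyProg, Prog.writesNat]), hB₁]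
  have r₂ : ∀ k ≠ 5, s₂.real k = s.real k := fun k hk => by
    rw [a₂.real k (by simp [copyProg, Prog.writesReal, hk]), r₁]
  have h5R : ∀ i < E.n, s₂.real 5 i 0 = R i := fun i hi => by rw [h5₂ i hi, r₁, h1 i hi]
  refine Halts.seq (clicksProg_halts hc hE₂ hB₂ h5R) fun s₃ a₃ h₃ => ?_
  have n₃ : ∀ k < 5, s₃.nat k = s₂.nat k := fun k hk =>
    a₃.nat k (clicksProg_writesNat hc (Or.inl hk))
  have r₃ : ∀ k < 6, s₃.real k = s₂.real k := fun k hk =>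
    a₃.real k (clicksProg_writesReal hc (Or.inl hk))
  have hE₃ : Holds E s₃ := hE₂.of_agree a₃ (clicksProg_writesNat hc (by omega))
    (clicksProg_writesReal hc (by omega))
  have hB₃ : s₃.nat 4 0 0 = E.buckets := by rw [n₃ 4 (by omega), hB₂]
  refine Halts.seq (lotteryProg_halts hE₃ hB₃ h₃.1) fun s₄ a₄ h₄ => ?_
  have hE₄ : Holds E s₄ := hE₃.of_agree a₄ (lotteryProg_writesNat (by omega))
    (lotteryProg_writesReal (by omega))
  have hB₄ : s₄.nat 4 0 0 = E.buckets := by rw [a₄.nat 4 (lotteryProg_writesNat (by omega)), hB₃]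
  have r₄ : ∀ k < 6, k ≠ 3 → s₄.real k = s₂.real k := fun k hk hk3 => by
    rw [a₄.real k (lotteryProg_writesReal hk3), r₃ k hk]
  refine ((payProg_halts hc hp hg hε hβ hR0 hE₄ hB₄ ?_ (fun i hi => ?_) fun i hi => ?_).agree).mono
    le_rfl fun s₅ h₅ => ⟨h₄.congr ?_ ?_ ?_ ?_, h₅.2⟩
  · rw [r₄ 2 (by omega) (by omega), r₂ 2 (by omega), hε']
  · rw [r₄ 1 (by omega) (by omega), r₂ 1 (by omega), h1 i hi]
  · rw [r₄ 5 (by omega) (by omega), h5R i hi]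
  · exact h₅.1.nat 1 (payProg_writesNat hc (by omega))
  · exact h₅.1.nat 2 (payProg_writesNat hc (by omega))
  · exact h₅.1.nat 3 (payProg_writesNat hc (by omega))
  · exact h₅.1.real 3 (payProg_writesReal hc (by omega))

theorem auctionCost_mono {n m K B β n' m' K' B' β' : ℕ} (hn : n ≤ n') (hm : m ≤ m') (hK : K ≤ K')
    (hB : B ≤ B') (hβ : β ≤ β') : auctionCost n m K B β ≤ auctionCost n' m' K' B' β' := by
  unfold auctionCost initCost payCost lotteryCost entryCost clicksCost bucketCost bestCost
  gcongr

/-- A time bound for `auctionProg` in terms of the problem size: every parameter is at most the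
problem size plus one. -/
def auctionTime : Polynomial ℕ :=
  auctionCost (.X + 1) (.X + 1) (.X + 1) (.X + 1) (.X + 1)

theorem eval_auctionTime (x : ℕ) :
    auctionTime.eval x = auctionCost (x + 1) (x + 1) (x + 1) (x + 1) (x + 1) := by
  simp [auctionTime, auctionCost, initCost, payCost, lotteryCost, entryCost, clicksCost, bucketCost,
    bestCost]

/-! ### The programs for the scores -/

/-- The score is the report. -/
def reportProg : Prog := .setR 6 (nvar 10) (.const 0) (.get 5 (nvar 10) (.const 0))

theorem scoreProg_report (O : Oracle) : ScoreProg O (fun _ x => x) reportProg where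
  writesNat a := rfl
  writesReal a := rfl
  halts s := (Halts.setR (by
    constructor
    · simp [Store.setReal_real, NExpr.eval, RExpr.eval]
    · intro i hi
      funext j
      simp [Store.setReal_real, hi])).weaken (N₁ := 1) (by omega)

/-- The score is `virtualScore`, obtained from oracle queries. -/
def virtualProg : Prog :=
  .ite (.leR (.cdf (nvar 10) (.get 5 (nvar 10) (.const 0))) (.ofNat (.const 0)))
    (.setR 6 (nvar 10) (.const 0) (.ofNat (.const 0)))
    (.ite (.leR (.pdf (nvar 10) (.get 5 (nvar 10) (.const 0))) (.ofNat (.const 0)))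
      (.setR 6 (nvar 10) (.const 0) (.get 5 (nvar 10) (.const 0)))
      (.setR 6 (nvar 10) (.const 0) (.sub (.get 5 (nvar 10) (.const 0))
        (.div (.sub (.ofNat (.const 1)) (.cdf (nvar 10) (.get 5 (nvar 10) (.const 0))))
          (.pdf (nvar 10) (.get 5 (nvar 10) (.const 0)))))))

theorem scoreProg_virtual (O : Oracle) : ScoreProg O (virtualScore O) virtualProg where
  writesNat a := rfl
  writesReal a := by simp [virtualProg, Prog.writesReal]
  halts s := by
    have key : ∀ e : RExpr, e.eval O s = virtualScore O (s.nat 10 0 0) (s.real 5 (s.nat 10 0 0) 0) →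
        Halts O (.setR 6 (nvar 10) (.const 0) e) s 1 fun s' =>
          s'.real 6 (s.nat 10 0 0) 0 = virtualScore O (s.nat 10 0 0) (s.real 5 (s.nat 10 0 0) 0) ∧
          ∀ i ≠ s.nat 10 0 0, s'.real 6 i = s.real 6 i := by
      intro e he
      refine Halts.setR ⟨by simp [Store.setReal_real, NExpr.eval, he], fun i hi => ?_⟩
      funext j
      simp [Store.setReal_real, hi]
    refine Halts.ite (N := 2) (fun h => (key _ ?_).weaken (by omega)) fun h =>
      Halts.ite (N := 1) (fun h' => key _ ?_) fun h' => key _ ?_ <;>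
      simp only [BExpr.Holds, RExpr.eval, NExpr.eval, nvar_eval, Nat.cast_zero, Nat.cast_one] at *
    · rw [virtualScore, if_pos h]
    · rw [virtualScore, if_neg h, if_pos h']
    · rw [virtualScore, if_neg h, if_neg h']

/-! ### The auction and its implementation -/

/-- The market described by the input. -/
abbrev Market.ofInput {n m : ℕ} (K : ℕ) (p : Fin n → Fin m → ℝ) : Market where
  n := n
  m := m
  K := K
  p i j := if h : i < n ∧ j < m then p ⟨i, h.1⟩ ⟨j, h.2⟩ else 0

theorem Market.ofInput_mem {n m : ℕ} (K : ℕ) {p : Fin n → Fin m → ℝ}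
    (hp : ∀ i j, 0 ≤ p i j ∧ p i j ≤ 1) (i j : ℕ) :
    0 ≤ (ofInput K p).p i j ∧ (ofInput K p).p i j ≤ 1 := by
  simp only
  split_ifs with h
  · exact hp _ _
  · simp

theorem Market.ofInput_fin {n m : ℕ} (K : ℕ) (p : Fin n → Fin m → ℝ) (i : Fin n) (j : Fin m) :
    p i j = (ofInput K p).p i j := by simp

/-- A complete lottery and the payments in memory are an output of the mechanism. -/
theorem LotteryInv.isOutput {E : Market} (hp : ∀ i j, 0 ≤ E.p i j) {g : ℕ → ℝ → ℝ}
    (hg : Market.IsScore g) {ε : ℝ} (hε : 0 < ε) {v : Fin E.n → ℝ} {s : Store}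
    (h : LotteryInv E (Market.scores g (Market.reports v)) (E.buckets * (E.m + 1)) s)
    (ht : ∀ i < E.n, s.real 4 i 0 = E.payment g ε (Market.reports v) i) :
    IsOutput s ((E.mech hp g hg ε hε).q v) ((E.mech hp g hg ε hε).t v) := by
  set sc := Market.scores g (Market.reports v) with hsc
  have hw : ∀ l < E.len, s.real 3 l 0 = E.weight sc l := by
    intro l hl
    cases l with
    | zero => rw [h.rest]; rfl
    | succ l => exact h.weight l (by simpa [Market.len] using hl)
  have hlen : s.nat 1 0 0 = E.len := h.len
  refine ⟨⟨fun l => E.augAlloc sc l, fun l => ?_, fun χ' => ?_⟩, fun i => (ht i i.2).symm⟩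
  · have hl : (l : ℕ) < E.len := hlen ▸ l.2
    have hl' : (l : ℕ) ≤ E.buckets * (E.m + 1) := Nat.lt_succ_iff.1 hl
    refine ⟨?_, fun i j => ?_, fun j => ?_⟩
    · rw [hw l hl]
      exact Market.weight_nonneg hp _ _
    · rw [h.entry l hl' j j.2]
      simp [Market.augAlloc]
    · rw [h.order l hl' j j.2]
      simp [Market.augAlloc]
  · rw [Fin.sum_univ_eq_sum_range (fun l => if E.augAlloc sc l = χ' then s.real 3 l 0 else 0), hlen]
    simp only [Market.mech]
    refine Finset.sum_congr rfl fun l hl => ?_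
    rw [hw l (Finset.mem_range.1 hl)]

/-- A polynomial bound holds since `K`, the number of buckets, and the numbers of digits of all
`⌈v i / ε⌉` are at most the problem size plus one. -/
theorem implements_mech {O : Oracle} {g : ℕ → ℝ → ℝ} {c : Prog} (hc : ScoreProg O g c)
    (hg : Market.IsScore g) {n m K : ℕ} (hK : K ≤ m) {p : Fin n → Fin m → ℝ}
    (hp : ∀ i j, 0 ≤ (Market.ofInput K p).p i j) {ε : ℝ} (hε : 0 < ε) :
    Implements (auctionProg c) auctionTime O p ε ((Market.ofInput K p).mech hp g hg ε hε) := by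
  intro v hv
  set E := Market.ofInput K p with hE
  have hR : ∀ i (h : i < n), Market.reports v i = v ⟨i, h⟩ := fun i h => Market.reports_fin ⟨i, h⟩ (hv _)
  have hβ : ∀ i < E.n, Nat.size ⌈Market.reports v i / ε⌉₊ ≤ Nat.size ⌈(∑ i, v i) / ε⌉₊ := by
    intro i hi
    refine Nat.size_le_size (Nat.ceil_mono (div_le_div_of_nonneg_right ?_ hε.le))
    rw [hR i hi]
    exact Finset.single_le_sum (fun i _ => hv i) (Finset.mem_univ _)
  have hs : Holds E (input K p ε v) := ⟨by simp [input, hE], by simp [input, hE], by simp [input, hE], by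
    funext i j
    simp [input, hE]⟩
  obtain ⟨k, s, hk, hr, h1, h2⟩ := auctionProg_halts hc hp hg hε hβ (Market.reports_nonneg v) hs
    (by simp [input]) (fun i hi => by rw [hR i hi]; simp [input, show i < n from hi])
  refine ⟨k, s, hr, hk.trans ?_, h1.isOutput hp hg hε h2⟩
  rw [eval_auctionTime]
  have hsize : Nat.size m ≤ m := Nat.size_le.2 Nat.lt_two_pow_self
  have hb : E.buckets = Nat.size m + 1 := rfl
  exact auctionCost_mono (by simp only [problemSize, hE]; omega) (by simp only [problemSize, hE]; omega)
    (by simp only [problemSize, hE]; omega) (by rw [hb, problemSize]; omega) (by rw [problemSize]; omega)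

end CascadeAuction

end

theorem mainTheorem2 :
    ∃ C : ℝ,
      -- welfare maximization: the auction needs no knowledge of the value distributions
      (∃ (P : Prog) (T : Polynomial ℕ),
        ∀ (n m K : ℕ), K ≤ m →
        ∀ (p : Fin n → Fin m → ℝ), (∀ i j, 0 ≤ p i j ∧ p i j ≤ 1) →
        ∀ ε : ℝ, 0 < ε →
        ∃ M : Mechanism n m K,
          Implements P T Oracle.trivial p ε M ∧ M.IsEpsIC p ε ∧ M.IsIR p ∧
          ∀ (D : Fin n → ValueDist) (M' : Mechanism n m K), M'.IsIC p → M'.IsIR p →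
            welfare p D M' ≤ ENNReal.ofReal (C * Real.log (m + 1)) * welfare p D M) ∧
      -- revenue maximization
      (∃ (P : Prog) (T : Polynomial ℕ),
        ∀ (n m K : ℕ), K ≤ m →
        ∀ (p : Fin n → Fin m → ℝ), (∀ i j, 0 ≤ p i j ∧ p i j ≤ 1) →
        ∀ ε : ℝ, 0 < ε →
        ∀ D : Fin n → ValueDist, (∀ i, (D i).IsRegular ∧ (D i).HasFiniteMean) →
        ∃ M : Mechanism n m K,
          Implements P T (Oracle.ofDist D) p ε M ∧ M.IsEpsIC p ε ∧ M.IsIR p ∧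
          ∀ M' : Mechanism n m K, M'.IsIC p → M'.IsIR p →
            revenue D M' ≤ ENNReal.ofReal (C * Real.log (m + 1)) * revenue D M) := by
  refine ⟨50, ⟨auctionProg reportProg, auctionTime, fun n m K hK p hp ε hε => ?_⟩,
    ⟨auctionProg virtualProg, auctionTime, fun n m K hK p hp ε hε D hD => ?_⟩⟩
  · have hp0 := fun i j => (Market.ofInput_mem K hp i j).1
    have hp1 := fun i j => (Market.ofInput_mem K hp i j).2
    have hq := Market.ofInput_fin K p
    exact ⟨_, implements_mech (scoreProg_report _) Market.isScore_id hK hp0 hε,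
      Market.mech_isEpsIC hp0 _ hε hq hp1, Market.mech_isIR hp0 _ hε hq,
      fun D M' _ _ => Market.welfare_le hp0 hε hq hp1 hK D M'⟩
  · have hp0 := fun i j => (Market.ofInput_mem K hp i j).1
    have hp1 := fun i j => (Market.ofInput_mem K hp i j).2
    have hq := Market.ofInput_fin K p
    have hg := isScore_virtualScore fun i => (hD i).1
    exact ⟨_, implements_mech (scoreProg_virtual _) hg hK hp0 hε,
      Market.mech_isEpsIC hp0 hg hε hq hp1, Market.mech_isIR hp0 hg hε hq,
      fun M' hic hir => Market.revenue_le hp0 hε hq hD hp1 hK M' hic hir⟩
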